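/- Let $G$ be one of the simply connected four-dimensional Lie groups $\widetilde{SL}(2,\mathbb{R})\times\mathbb{R}$ or $SU(2)\times\mathbb{R}$, and let $g$ be a left-invariant Riemannian metric on $G$. For $t\in\mathbb{R}$, the metric $g$ is called $\mathcal{F}_t$-critical if it satisfies, with $n=4$, the Euler--Lagrange equation $$-\Delta\rho+(2t+1)\nabla^2\tau-\tfrac{2t}{n}(\Delta\tau)g+\tfrac2n(\|\rho\|^2+t\tau^2)g-2R[\rho]-2t\tau\rho=0$$ of the functional $\mathcal{F}_t(g)=\int_M(\|\rho\|^2+t\tau^2)\,\mathrm{dvol}_g$ restricted to metrics of fixed volume. Here $R$ is the curvature tensor, $\rho$ the Ricci tensor, $\tau$ the scalar curvature, $\Delta$ the trace of $\nabla^2$, and $R[\rho]_{ij}=R_{ikj\ell}\rho^{k\ell}$, with the sign of $R$ such that $R[g]=\rho$. Let $N^3(\kappa)$ denote a three-dimensional Riemannian manifold of constant sectional curvature $\kappa$. (a) The metric $g$ is $\mathcal{F}_t$-critical for some $t\in\mathbb{R}$ if and only if it is locally isometric to a product $\mathbb{R}\times N^3(\kappa)$ for some $\kappa\in\mathbb{R}$.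 (b) The Lie algebra of $G$ has a $g$-orthonormal basis $e_1,e_2,e_3,e_4$ such that, for some non-zero real numbers $\lambda_1,\lambda_2,\lambda_3$ and some real numbers $k_1,k_2,k_3$, $$[e_2,e_3]=\lambda_1e_1,\quad [e_3,e_1]=\lambda_2e_2,\quad [e_1,e_2]=\lambda_3e_3,$$ $$[e_1,e_4]=k_3\lambda_2e_2-k_2\lambda_3e_3,\quad [e_2,e_4]=k_1\lambda_3e_3-k_3\lambda_1e_1,\quad [e_3,e_4]=k_2\lambda_1e_1-k_1\lambda_2e_2.$$ For every such basis: $g$ is $\mathcal{F}_t$-critical if and only if $\lambda_1=\lambda_2=\lambda_3$ and $t=-\frac13$; and $g$ is locally isometric to $\mathbb{R}\times N^3(\kappa)$ if and only if $\lambda_1=\lambda_2=\lambda_3=\lambda$ and $\kappa=\lambda^2/4$. (c) In particular, $\widetilde{SL}(2,\mathbb{R})\times\mathbb{R}$ admits no left-invariant metric that is $\mathcal{F}_t$-critical for some $t\in\mathbb{R}$. -/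

import Mathlib

open scoped Manifold ContDiff
open Bundle

noncomputable section

/-! ## Riemannian metrics and curvature in orthonormal frames -/

/-- Smooth Riemannian metrics on an `n`-dimensional manifold `M`. -/
abbrev SmoothMetric (n : ℕ) (M : Type*) [TopologicalSpace M]
    [ChartedSpace (EuclideanSpace ℝ (Fin n)) M] [IsManifold (𝓡 n) ∞ M] :=
  ContMDiffRiemannianMetric (𝓡 n) ∞ (EuclideanSpace ℝ (Fin n))
    (fun x : M => TangentSpace (𝓡 n) x)

section Frames

variable {n : ℕ} {M : Type*} [TopologicalSpace M] [ChartedSpace (EuclideanSpace ℝ (Fin n)) M]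
  [IsManifold (𝓡 n) ∞ M]

/-- `e` is a smooth `g`-orthonormal frame on `U`. -/
structure IsOrthonormalFrameOn (g : SmoothMetric n M) (U : Set M)
    (e : Fin n → (x : M) → TangentSpace (𝓡 n) x) : Prop where
  smooth : ∀ i, ContMDiffOn (𝓡 n) (𝓡 n).tangent ∞
    (fun x => (⟨x, e i x⟩ : TangentBundle (𝓡 n) M)) U
  orthonormal : ∀ x ∈ U, ∀ i j, g.inner x (e i x) (e j x) = if i = j then 1 else 0

/-- The derivative `X(f)` of a function along a vector field. -/
def dirDeriv (X : (x : M) → TangentSpace (𝓡 n) x) (f : M → ℝ) (x : M) : ℝ :=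
  mfderiv (𝓡 n) 𝓘(ℝ, ℝ) f x (X x)

variable (g : SmoothMetric n M) (e : Fin n → (x : M) → TangentSpace (𝓡 n) x)

/-- `g([e_i, e_j], e_k)`. -/
def structFn (i j k : Fin n) (x : M) : ℝ :=
  g.inner x (VectorField.mlieBracket (𝓡 n) (e i) (e j) x) (e k x)

/-- `g(∇_{e_i} e_j, e_k)` for the Levi-Civita connection `∇`, by the Koszul formula
in an orthonormal frame. -/
def connFn (i j k : Fin n) (x : M) : ℝ :=
  (structFn g e i j k x - structFn g e j k i x + structFn g e k i j x) / 2

/-- `g(R(e_i, e_j) e_k, e_l)`, where `R(X, Y) = ∇_X ∇_Y - ∇_Y ∇_X - ∇_{[X, Y]}`. -/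
def riemann (i j k l : Fin n) (x : M) : ℝ :=
  dirDeriv (e i) (connFn g e j k l) x - dirDeriv (e j) (connFn g e i k l) x
    + ∑ m, (connFn g e j k m x * connFn g e i m l x - connFn g e i k m x * connFn g e j m l x
      - structFn g e i j m x * connFn g e m k l x)

/-- The Ricci tensor `ρ(e_i, e_j)`, the trace of `X ↦ R(X, e_i) e_j`. -/
def ricci (i j : Fin n) (x : M) : ℝ := ∑ a, riemann g e a i j a x

/-- The scalar curvature `τ`. -/
def scalarCurv (x : M) : ℝ := ∑ i, ricci g e i i x

/-- `‖ρ‖²`. -/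
def ricciNormSq (x : M) : ℝ := ∑ i, ∑ j, ricci g e i j x ^ 2

/-- `(∇_{e_a} ρ)(e_i, e_j)`. -/
def nablaRicci (a i j : Fin n) (x : M) : ℝ :=
  dirDeriv (e a) (ricci g e i j) x
    - ∑ m, (connFn g e a i m x * ricci g e m j x + connFn g e a j m x * ricci g e i m x)

/-- `(∇² ρ)(e_b, e_a; e_i, e_j)`, the covariant derivative of `∇ρ` in the direction `e_b`. -/
def nabla2Ricci (b a i j : Fin n) (x : M) : ℝ :=
  dirDeriv (e b) (nablaRicci g e a i j) x
    - ∑ m, (connFn g e b a m x * nablaRicci g e m i j x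
      + connFn g e b i m x * nablaRicci g e a m j x
      + connFn g e b j m x * nablaRicci g e a i m x)

/-- `(Δρ)(e_i, e_j)`, where `Δ` is the trace of `∇²`. -/
def laplaceRicci (i j : Fin n) (x : M) : ℝ := ∑ a, nabla2Ricci g e a a i j x

/-- The Hessian `(∇² τ)(e_i, e_j)`. -/
def hessScalar (i j : Fin n) (x : M) : ℝ :=
  dirDeriv (e i) (dirDeriv (e j) (scalarCurv g e)) x
    - ∑ m, connFn g e i j m x * dirDeriv (e m) (scalarCurv g e) x

/-- `Δτ`. -/
def laplaceScalar (x : M) : ℝ := ∑ i, hessScalar g e i i x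

/-- `R[ρ](e_i, e_j) = ∑ R_{ikjl} ρ_{kl}`, with `R_{ikjl}` normalised so that
`∑ R_{ikjk} = ρ_{ij}`. -/
def riemannRicci (i j : Fin n) (x : M) : ℝ :=
  ∑ k, ∑ l, riemann g e i k l j x * ricci g e k l x

/-- The component on `(e_i, e_j)` of the Euler-Lagrange tensor
`-Δρ + (2t+1)∇²τ - (2t/n)(Δτ) g + (2/n)(‖ρ‖² + tτ²) g - 2R[ρ] - 2tτρ` of the functional
`𝓕_t(g) = ∫ (‖ρ‖² + tτ²) dvol_g` restricted to metrics of fixed volume. -/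
def eulerLagrange (t : ℝ) (i j : Fin n) (x : M) : ℝ :=
  - laplaceRicci g e i j x + (2 * t + 1) * hessScalar g e i j x
    - 2 * t / n * laplaceScalar g e x * (if i = j then 1 else 0)
    + 2 / n * (ricciNormSq g e x + t * scalarCurv g e x ^ 2) * (if i = j then 1 else 0)
    - 2 * riemannRicci g e i j x - 2 * t * scalarCurv g e x * ricci g e i j x

end Frames

/-- `g` is `𝓕_t`-critical: its Euler-Lagrange tensor vanishes, that is, all the components of that
tensor vanish in all local orthonormal frames. -/
def IsCritical {n : ℕ} {M : Type*} [TopologicalSpace M]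
    [ChartedSpace (EuclideanSpace ℝ (Fin n)) M] [IsManifold (𝓡 n) ∞ M]
    (g : SmoothMetric n M) (t : ℝ) : Prop :=
  ∀ (U : Set M) (e : Fin n → (x : M) → TangentSpace (𝓡 n) x), IsOpen U →
    IsOrthonormalFrameOn g U e → ∀ x ∈ U, ∀ i j, eulerLagrange g e t i j x = 0

/-! ## The product of a line and a three-dimensional space of constant curvature -/

/-- The quadratic form, at the point `(r, p)` and on the tangent vector `(s, w)`, of the metric
`dr² + |dp|² / (1 + κ|p|²/4)²` on `ℝ × {p ∈ ℝ³ : 1 + κ|p|²/4 > 0}`. This is the product of `ℝ`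
and Riemann's local model of the three-manifolds of constant sectional curvature `κ`. -/
def productForm (κ : ℝ) (p : EuclideanSpace ℝ (Fin 3)) (s : ℝ) (w : EuclideanSpace ℝ (Fin 3)) : ℝ :=
  s ^ 2 + ‖w‖ ^ 2 / (1 + κ / 4 * ‖p‖ ^ 2) ^ 2

/-- `(M, g)` is locally isometric to a product `ℝ × N³(κ)`: near each point there is a smooth map
`(r, p)` to the model which pulls the metric of the model back to `g` (as the dimensions agree, such
a map is a local diffeomorphism). -/
def IsLocallyIsometricToProduct {M : Type*} [TopologicalSpace M]
    [ChartedSpace (EuclideanSpace ℝ (Fin 4)) M] [IsManifold (𝓡 4) ∞ M]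
    (g : SmoothMetric 4 M) (κ : ℝ) : Prop :=
  ∀ x : M, ∃ (U : Set M) (r : M → ℝ) (p : M → EuclideanSpace ℝ (Fin 3)),
    IsOpen U ∧ x ∈ U ∧
    ContMDiffOn (𝓡 4) 𝓘(ℝ, ℝ) ∞ r U ∧ ContMDiffOn (𝓡 4) (𝓡 3) ∞ p U ∧
    ∀ y ∈ U, 0 < 1 + κ / 4 * ‖p y‖ ^ 2 ∧
      ∀ v : TangentSpace (𝓡 4) y,
        g.inner y v v = productForm κ (p y) (mfderiv (𝓡 4) 𝓘(ℝ, ℝ) r y v)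
          (mfderiv (𝓡 4) (𝓡 3) p y v)

/-! ## The groups and their left-invariant metrics -/

section Groups

variable (G : Type*) [TopologicalSpace G] [ChartedSpace (EuclideanSpace ℝ (Fin 4)) G] [Group G]

/-- The four-dimensional Lie group `G` is `SL̃(2, ℝ) × ℝ`, the universal covering group of
`SL(2, ℝ) × ℝ`: it is simply connected, with a covering homomorphism onto `SL(2, ℝ) × ℝ` that is
smooth and immersive as a map to `(2 × 2 matrices) × ℝ`. -/
def IsSL2TildeTimesR : Prop :=
  SimplyConnectedSpace G ∧
  ∃ φ : G →* Matrix.SpecialLinearGroup (Fin 2) ℝ × Multiplicative ℝ,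
    IsCoveringMap φ ∧
    (∀ i j, ContMDiff (𝓡 4) 𝓘(ℝ, ℝ) ∞ (fun x => (φ x).1.1 i j)) ∧
    ContMDiff (𝓡 4) 𝓘(ℝ, ℝ) ∞ (fun x => (φ x).2.toAdd) ∧
    ∀ (x : G) (v : TangentSpace (𝓡 4) x),
      (∀ i j, mfderiv (𝓡 4) 𝓘(ℝ, ℝ) (fun y => (φ y).1.1 i j) x v = 0) →
      mfderiv (𝓡 4) 𝓘(ℝ, ℝ) (fun y => (φ y).2.toAdd) x v = 0 → v = 0

/-- The four-dimensional Lie group `G` is `SU(2) × ℝ`: there is an isomorphism of topological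
groups onto `SU(2) × ℝ` that is smooth and immersive as a map to `(2 × 2 complex matrices) × ℝ`. -/
def IsSU2TimesR : Prop :=
  ∃ φ : G ≃ₜ* Matrix.specialUnitaryGroup (Fin 2) ℂ × Multiplicative ℝ,
    (∀ i j, ContMDiff (𝓡 4) 𝓘(ℝ, ℂ) ∞ (fun x => (φ x).1.1 i j)) ∧
    ContMDiff (𝓡 4) 𝓘(ℝ, ℝ) ∞ (fun x => (φ x).2.toAdd) ∧
    ∀ (x : G) (v : TangentSpace (𝓡 4) x),
      (∀ i j, mfderiv (𝓡 4) 𝓘(ℝ, ℂ) (fun y => (φ y).1.1 i j) x v = 0) →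
      mfderiv (𝓡 4) 𝓘(ℝ, ℝ) (fun y => (φ y).2.toAdd) x v = 0 → v = 0

variable {G} [IsManifold (𝓡 4) ∞ G]

/-- `g` is invariant under all left translations. -/
def IsLeftInvariant (g : SmoothMetric 4 G) : Prop :=
  ∀ (a x : G) (v w : TangentSpace (𝓡 4) x),
    g.inner (a * x) (mfderiv (𝓡 4) (𝓡 4) (fun y => a * y) x v)
      (mfderiv (𝓡 4) (𝓡 4) (fun y => a * y) x w) = g.inner x v w

/-- `e 0, e 1, e 2, e 3` is an orthonormal basis of the Lie algebra of `G` in which the brackets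
are given by the parameters `lam 0, lam 1, lam 2` (all non-zero) and `k 0, k 1, k 2`. -/
structure IsAdaptedBasis (g : SmoothMetric 4 G) (e : Fin 4 → GroupLieAlgebra (𝓡 4) G)
    (lam k : Fin 3 → ℝ) : Prop where
  orthonormal : ∀ i j, g.inner 1 (e i) (e j) = if i = j then 1 else 0
  lam_ne_zero : ∀ i, lam i ≠ 0
  bracket12 : ⁅e 1, e 2⁆ = lam 0 • e 0
  bracket20 : ⁅e 2, e 0⁆ = lam 1 • e 1
  bracket01 : ⁅e 0, e 1⁆ = lam 2 • e 2
  bracket03 : ⁅e 0, e 3⁆ = (k 2 * lam 1) • e 1 - (k 1 * lam 2) • e 2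
  bracket13 : ⁅e 1, e 3⁆ = (k 0 * lam 2) • e 2 - (k 2 * lam 0) • e 0
  bracket23 : ⁅e 2, e 3⁆ = (k 1 * lam 0) • e 0 - (k 0 * lam 1) • e 1

end Groups

end

open scoped Manifold ContDiff
open Bundle

noncomputable section

/-! The Lie algebra of `G` is `ℝ³ × ℝ`, where `ℝ³` carries the cross product twisted by a sign `η`
(`1` for `𝔰𝔲(2)`, `-1` for `𝔰𝔩(2, ℝ)`). Everything passes through one basis-free condition on the
inner product at the identity, `IsSkewOnDerived`: each `ad X` is skew on commutators. In an adapted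
basis it says exactly that the three `λ` agree (`IsAdaptedBasis.isSkewOnDerived_iff`). It fails for
`𝔰𝔩(2, ℝ)`, where some `ad X` has a non-zero real eigenvalue on a commutator
(`IsTwistedIso.not_isSkewOnDerived`).

Critical implies skew (`IsCritical.isSkewOnDerived`). Here a second orthonormal basis is better than
the adapted one: it contains a unit central vector `ζ`, and the brackets of the other three vectors
are diagonal with coefficients `a, b, c`, plus multiples `x, y, z` of `ζ`. In the left-invariant
frame all structure functions are constant, so the Euler-Lagrange tensor is polynomial in these six
numbers. A change of left-invariant metric is a change of frame, hence of structure constants, so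
the equation says that `‖ρ‖² + tτ²`, as a function of the six numbers, vanishes together with its
gradient. Eliminating `t` leaves a real algebra problem whose only solutions
(`isCriticalCentral_of_algEL`) are those of `IsCriticalCentral`, and these are skew.

Equal `λ` imply a local product (`IsAdaptedBasis.isLocallyIsometric`). The group must then be `SU(2)
× ℝ`. The vector `e 3` need not be central, so the splitting of the group is not the metric
splitting; the projection to unit quaternions is corrected by right multiplication with a
one-parameter group so as to become constant along `e 3`. Followed by stereographic projection it
gives the map to the space of curvature `λ² / 4`.

A local product is critical for `t = -1/3`, and for no other `t` when `κ ≠ 0`. In the coframe `dr,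
dpᵢ / (1 + κ|p|²/4)` of the model the Levi-Civita connection is explicit, the Ricci identity gives
the curvature, and the Euler-Lagrange tensor is `(6 + 18t) κ² g - (8 + 24t) κ² P` with `P` the
projection onto the second factor. This is done in an arbitrary orthonormal frame, as criticality
demands. Since any local product is critical for `-1/3`, it has equal `λ` by the first implication,
and its scalar curvature `6κ` then determines `κ`. -/

theorem inverse_apply_of_eq_id {E : Type*} [NormedAddCommGroup E] [NormedSpace ℝ E]
    (L : E →L[ℝ] E) (h : L = ContinuousLinearMap.id ℝ E) (w : E) : L.inverse w = w := by
  rw [h, ContinuousLinearMap.inverse_id]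
  rfl

/-! ### Derivatives along tangent vectors and the Lie bracket -/

section Derivations

variable {n : ℕ} {M : Type*} [TopologicalSpace M]
  [ChartedSpace (EuclideanSpace ℝ (Fin n)) M]
  {F : Type*} [NormedAddCommGroup F] [NormedSpace ℝ F]

/-- The derivative of a vector-valued function along a tangent vector. -/
def tanDeriv (f : M → F) (x : M) : TangentSpace (𝓡 n) x →ₗ[ℝ] F :=
  (mfderiv (𝓡 n) 𝓘(ℝ, F) f x).toLinearMap

theorem tanDeriv_apply (f : M → F) (x : M) (v : TangentSpace (𝓡 n) x) :
    tanDeriv f x v = mfderiv (𝓡 n) 𝓘(ℝ, F) f x v := rfl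

-- The bracket acts as the commutator of derivations. Both fields are pulled back along the inverse
-- chart, where the identity is the symmetry of the second derivative.
open VectorField in
theorem tanDeriv_mlieBracket [IsManifold (𝓡 n) ∞ M] {f : M → F} {x : M}
    {V W : (x : M) → TangentSpace (𝓡 n) x}
    (hf : ContMDiffAt (𝓡 n) 𝓘(ℝ, F) 2 f x)
    (hV : MDifferentiableAt (𝓡 n) (𝓡 n).tangent
      (fun x => (⟨x, V x⟩ : TangentBundle (𝓡 n) M)) x)
    (hW : MDifferentiableAt (𝓡 n) (𝓡 n).tangent
      (fun x => (⟨x, W x⟩ : TangentBundle (𝓡 n) M)) x)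
    (hVf : MDifferentiableAt (𝓡 n) 𝓘(ℝ, F) (fun y => tanDeriv f y (V y)) x)
    (hWf : MDifferentiableAt (𝓡 n) 𝓘(ℝ, F) (fun y => tanDeriv f y (W y)) x) :
    tanDeriv f x (mlieBracket (𝓡 n) V W x) =
      tanDeriv (fun y => tanDeriv f y (W y)) x (V x)
      - tanDeriv (fun y => tanDeriv f y (V y)) x (W x) := by
  set ψ := extChartAt (𝓡 n) x with hψ
  have hx : x ∈ ψ.source := mem_extChartAt_source x
  have hx' : ψ.symm (ψ x) = x := ψ.left_inv hx
  have hmem : ψ.target ∈ nhds (ψ x) := extChartAt_target_mem_nhds x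
  have hmx : ψ x ∈ ψ.target := ψ.map_source hx
  have hsymm' : ContMDiffOn 𝓘(ℝ, EuclideanSpace ℝ (Fin n)) (𝓡 n) ∞ ψ.symm ψ.target :=
    contMDiffOn_extChartAt_symm (I := 𝓡 n) (n := ∞) x
  have hsymm : ∀ y ∈ ψ.target, MDifferentiableAt 𝓘(ℝ, EuclideanSpace ℝ (Fin n)) (𝓡 n) ψ.symm y := by
    intro y hy
    exact (hsymm'.contMDiffAt ((isOpen_extChartAt_target x).mem_nhds hy)).mdifferentiableAt (by simp)
  have hinv : ∀ y ∈ ψ.target, (mfderiv 𝓘(ℝ, EuclideanSpace ℝ (Fin n)) (𝓡 n) ψ.symm y).IsInvertible := by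
    intro y hy
    have := isInvertible_mfderivWithin_extChartAt_symm (I := 𝓡 n) (x := x) hy
    rw [ModelWithCorners.range_eq_univ, mfderivWithin_univ] at this
    exact this
  let P : ((x : M) → TangentSpace (𝓡 n) x) → EuclideanSpace ℝ (Fin n) → EuclideanSpace ℝ (Fin n) :=
    fun X => mpullbackWithin 𝓘(ℝ, EuclideanSpace ℝ (Fin n)) (𝓡 n) ψ.symm X Set.univ
  have hP : ∀ X, ∀ y ∈ ψ.target,
      mfderiv 𝓘(ℝ, EuclideanSpace ℝ (Fin n)) (𝓡 n) ψ.symm y (P X y) = X (ψ.symm y) := by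
    intro X y hy
    have h2 := congrArg (fun L => L (X (ψ.symm y))) (hinv y hy).self_comp_inverse
    have h3 : P X y = (mfderiv 𝓘(ℝ, EuclideanSpace ℝ (Fin n)) (𝓡 n) ψ.symm y).inverse
        (X (ψ.symm y)) := by
      simp only [P, mpullbackWithin_apply, mfderivWithin_univ]
      rfl
    rw [h3]; exact h2
  have hcomp : ∀ (φ : M → F), ∀ y ∈ ψ.target, MDifferentiableAt (𝓡 n) 𝓘(ℝ, F) φ (ψ.symm y) →
      ∀ v : EuclideanSpace ℝ (Fin n), fderiv ℝ (φ ∘ ψ.symm) y v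
      = tanDeriv φ (ψ.symm y) (mfderiv 𝓘(ℝ, EuclideanSpace ℝ (Fin n)) (𝓡 n) ψ.symm y v) := by
    intro φ y hy hφ v
    have h := mfderiv_comp y hφ (hsymm y hy)
    rw [mfderiv_eq_fderiv] at h
    exact congrArg (fun L => L v) h
  have key : ∀ (φ : M → F) (X : (x : M) → TangentSpace (𝓡 n) x), ∀ y ∈ ψ.target,
      MDifferentiableAt (𝓡 n) 𝓘(ℝ, F) φ (ψ.symm y) →
      fderiv ℝ (φ ∘ ψ.symm) y (P X y) = tanDeriv φ (ψ.symm y) (X (ψ.symm y)) := by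
    intro φ X y hy hφ
    rw [hcomp φ y hy hφ, hP X y hy]
  have hPd : ∀ X : (x : M) → TangentSpace (𝓡 n) x, MDifferentiableAt (𝓡 n) (𝓡 n).tangent
      (fun x => (⟨x, X x⟩ : TangentBundle (𝓡 n) M)) x → DifferentiableAt ℝ (P X) (ψ x) := by
    intro X hX
    have h := MDifferentiableWithinAt.differentiableWithinAt_mpullbackWithin_vectorField
      (hX.mdifferentiableWithinAt (s := Set.univ))
    rw [ModelWithCorners.range_eq_univ, Set.preimage_univ, Set.univ_inter] at h
    exact differentiableWithinAt_univ.1 h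
  have hsymmx : ContMDiffAt 𝓘(ℝ, EuclideanSpace ℝ (Fin n)) (𝓡 n) 2 ψ.symm (ψ x) :=
    (hsymm'.contMDiffAt hmem).of_le (by norm_cast)
  have hh : ContDiffAt ℝ 2 (f ∘ ψ.symm) (ψ x) := by
    apply ContMDiffAt.contDiffAt
    apply ContMDiffAt.comp (I' := 𝓡 n) (ψ x) _ hsymmx
    rw [hx']; exact hf
  have hev : ∀ᶠ y in nhds (ψ x), y ∈ ψ.target ∧ MDifferentiableAt (𝓡 n) 𝓘(ℝ, F) f (ψ.symm y) := by
    have h1 : ∀ᶠ z in nhds x, MDifferentiableAt (𝓡 n) 𝓘(ℝ, F) f z := by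
      have := (contMDiffAt_iff_contMDiffAt_nhds (by simp)).1 hf
      exact this.mono fun z hz => hz.mdifferentiableAt (by simp)
    have h2 : Filter.Tendsto ψ.symm (nhds (ψ x)) (nhds x) := by
      have := (hsymm _ hmx).continuousAt
      rwa [ContinuousAt, hx'] at this
    filter_upwards [hmem, h2.eventually h1] with y a b using ⟨a, b⟩
  have hfun : ∀ X : (x : M) → TangentSpace (𝓡 n) x,
      (fun y => fderiv ℝ (f ∘ ψ.symm) y (P X y)) =ᶠ[nhds (ψ x)]
        ((fun y => tanDeriv f y (X y)) ∘ ψ.symm) := by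
    intro X
    filter_upwards [hev] with y hy using key f X y hy.1 hy.2
  have hder : ∀ X Y : (x : M) → TangentSpace (𝓡 n) x,
      MDifferentiableAt (𝓡 n) 𝓘(ℝ, F) (fun y => tanDeriv f y (X y)) x →
      fderiv ℝ (fun y => fderiv ℝ (f ∘ ψ.symm) y (P X y)) (ψ x) (P Y (ψ x)) =
        tanDeriv (fun y => tanDeriv f y (X y)) x (Y x) := by
    intro X Y hX
    rw [(hfun X).fderiv_eq, key _ Y _ hmx (by rw [hx']; exact hX), hx']
  -- The derivative of a chart at its own base point is the identity of the model space, so the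
  -- bracket computed in the chart needs no correction.
  have hbr : mlieBracket (𝓡 n) V W x = lieBracket ℝ (P V) (P W) (ψ x) := by
    have h := inverse_apply_of_eq_id (E := EuclideanSpace ℝ (Fin n))
      (mfderiv (𝓡 n) 𝓘(ℝ, EuclideanSpace ℝ (Fin n)) ψ x) mfderiv_extChartAt_self
    rw [← mlieBracketWithin_univ, mlieBracketWithin_apply, ← lieBracketWithin_univ]
    simp only [ModelWithCorners.range_eq_univ, Set.preimage_univ, Set.univ_inter]
    exact h _
  have hid : ∀ v : EuclideanSpace ℝ (Fin n),
      fderiv ℝ (f ∘ ψ.symm) (ψ x) v = tanDeriv f x v := by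
    intro v
    have h := mfderivWithin_range_extChartAt_symm (I := 𝓡 n) (x := x)
    rw [ModelWithCorners.range_eq_univ, mfderivWithin_univ] at h
    have h2 := hcomp f (ψ x) hmx (by rw [hx']; exact hf.mdifferentiableAt (by simp)) v
    rw [h2]
    have h3 := congrArg (fun L => L v) h
    have h4 : (mfderiv 𝓘(ℝ, EuclideanSpace ℝ (Fin n)) (𝓡 n) ψ.symm (ψ x)) v = v := h3
    rw [h4, hx']
  have := fderiv_apply_lieBracket hh (by simp) (hPd W hW) (hPd V hV)
  rw [hder W V hWf, hder V W hVf, hid] at this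
  rw [hbr]
  exact this
end Derivations

/-! ### Calculus rules along tangent vectors -/

section Rules

variable {n : ℕ} {M : Type*} [TopologicalSpace M]
  [ChartedSpace (EuclideanSpace ℝ (Fin n)) M]
  {F : Type*} [NormedAddCommGroup F] [NormedSpace ℝ F]

theorem ContMDiffOn.tanDeriv [IsManifold (𝓡 n) ∞ M] {f : M → F} {U : Set M} {V : (x : M) → TangentSpace (𝓡 n) x}
    (hU : IsOpen U) (hf : ContMDiffOn (𝓡 n) 𝓘(ℝ, F) ∞ f U)
    (hV : ContMDiffOn (𝓡 n) (𝓡 n).tangent ∞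
      (fun x => (⟨x, V x⟩ : TangentBundle (𝓡 n) M)) U) :
    ContMDiffOn (𝓡 n) 𝓘(ℝ, F) ∞ (fun x => tanDeriv f x (V x)) U := by
  have h1 := hf.contMDiffOn_tangentMapWithin (m := ∞) (by simp) hU.uniqueMDiffOn
  have h2 := h1.comp hV (fun x hx => hx)
  have h3 := (contMDiff_snd_tangentBundle_modelSpace F 𝓘(ℝ, F) (n := ∞)).comp_contMDiffOn h2
  refine h3.congr fun x hx => ?_
  have : mfderivWithin (𝓡 n) 𝓘(ℝ, F) f U x = mfderiv (𝓡 n) 𝓘(ℝ, F) f x :=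
    mfderivWithin_of_isOpen hU hx
  exact (congrArg (fun L : EuclideanSpace ℝ (Fin n) →L[ℝ] F => L (V x)) this).symm

theorem tanDeriv_congr {f h : M → F} {U : Set M} (hU : IsOpen U) (hfh : Set.EqOn f h U)
    {x : M} (hx : x ∈ U) (v : TangentSpace (𝓡 n) x) : tanDeriv f x v = tanDeriv h x v := by
  have : f =ᶠ[nhds x] h := Filter.eventuallyEq_of_mem (hU.mem_nhds hx) hfh
  have h1 := this.mfderiv_eq (I := 𝓡 n) (I' := 𝓘(ℝ, F))
  exact congrArg (fun L : EuclideanSpace ℝ (Fin n) →L[ℝ] F => L v) h1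

theorem tanDeriv_const (c : F) (x : M) (v : TangentSpace (𝓡 n) x) :
    tanDeriv (fun _ : M => c) x v = 0 := by
  rw [tanDeriv_apply, mfderiv_const]; rfl

/-- A chain rule for a differentiable map between vector spaces. -/
theorem tanDeriv_comp {F' : Type*} [NormedAddCommGroup F'] [NormedSpace ℝ F'] {f : M → F}
    {x : M} {φ : F → F'} {L : F →L[ℝ] F'} (hφ : HasFDerivAt φ L (f x))
    (hf : MDifferentiableAt (𝓡 n) 𝓘(ℝ, F) f x) (v : TangentSpace (𝓡 n) x) :
    tanDeriv (fun y => φ (f y)) x v = L (tanDeriv f x v) := by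
  have h := (hφ.hasMFDerivAt.comp x hf.hasMFDerivAt).mfderiv
  exact congrArg (fun L : EuclideanSpace ℝ (Fin n) →L[ℝ] F' => L v) h

theorem tanDeriv_clm {F' : Type*} [NormedAddCommGroup F'] [NormedSpace ℝ F'] {f : M → F}
    {x : M} (L : F →L[ℝ] F') (hf : MDifferentiableAt (𝓡 n) 𝓘(ℝ, F) f x)
    (v : TangentSpace (𝓡 n) x) :
    tanDeriv (fun y => L (f y)) x v = L (tanDeriv f x v) :=
  tanDeriv_comp L.hasFDerivAt hf v

theorem tanDeriv_add {f h : M → F} {x : M} (hf : MDifferentiableAt (𝓡 n) 𝓘(ℝ, F) f x)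
    (hh : MDifferentiableAt (𝓡 n) 𝓘(ℝ, F) h x) (v : TangentSpace (𝓡 n) x) :
    tanDeriv (fun y => f y + h y) x v = tanDeriv f x v + tanDeriv h x v :=
  congrArg (fun L : EuclideanSpace ℝ (Fin n) →L[ℝ] F => L v)
    (hf.hasMFDerivAt.add hh.hasMFDerivAt).mfderiv

theorem tanDeriv_prodMk {F' : Type*} [NormedAddCommGroup F'] [NormedSpace ℝ F'] {f : M → F}
    {h : M → F'} {x : M} (hf : MDifferentiableAt (𝓡 n) 𝓘(ℝ, F) f x)
    (hh : MDifferentiableAt (𝓡 n) 𝓘(ℝ, F') h x) (v : TangentSpace (𝓡 n) x) :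
    tanDeriv (fun y => (f y, h y)) x v = (tanDeriv f x v, tanDeriv h x v) := by
  have h1 := tanDeriv_clm (ContinuousLinearMap.inl ℝ F F') hf v
  have h2 := tanDeriv_clm (ContinuousLinearMap.inr ℝ F F') hh v
  have h3 := tanDeriv_add (f := fun y => ContinuousLinearMap.inl ℝ F F' (f y))
    (h := fun y => ContinuousLinearMap.inr ℝ F F' (h y))
    ((ContinuousLinearMap.inl ℝ F F').differentiableAt.comp_mdifferentiableAt hf)
    ((ContinuousLinearMap.inr ℝ F F').differentiableAt.comp_mdifferentiableAt hh) v
  rw [h1, h2] at h3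
  simpa using h3

theorem tanDeriv_bilin {F₁ F₂ : Type*} [NormedAddCommGroup F₁] [NormedSpace ℝ F₁]
    [NormedAddCommGroup F₂] [NormedSpace ℝ F₂] (B : F₁ →L[ℝ] F₂ →L[ℝ] F) {f : M → F₁}
    {h : M → F₂} {x : M} (hf : MDifferentiableAt (𝓡 n) 𝓘(ℝ, F₁) f x)
    (hh : MDifferentiableAt (𝓡 n) 𝓘(ℝ, F₂) h x) (v : TangentSpace (𝓡 n) x) :
    tanDeriv (fun y => B (f y) (h y)) x v = B (tanDeriv f x v) (h x) + B (f x) (tanDeriv h x v) := by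
  have h1 := (B.isBoundedBilinearMap.hasFDerivAt (f x, h x))
  have h2 := tanDeriv_comp (f := fun y => (f y, h y)) h1 (hf.prodMk_space hh) v
  rw [tanDeriv_prodMk hf hh] at h2
  rw [add_comm]
  exact h2

theorem tanDeriv_mul {A : Type*} [NormedRing A] [NormedAlgebra ℝ A] {f h : M → A} {x : M}
    (hf : MDifferentiableAt (𝓡 n) 𝓘(ℝ, A) f x)
    (hh : MDifferentiableAt (𝓡 n) 𝓘(ℝ, A) h x) (v : TangentSpace (𝓡 n) x) :
    tanDeriv (fun y => f y * h y) x v = tanDeriv f x v * h x + f x * tanDeriv h x v :=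
  tanDeriv_bilin (ContinuousLinearMap.mul ℝ A) hf hh v

theorem mdifferentiableAt_sum {ι : Type*} (s : Finset ι) {f : ι → M → F} {x : M}
    (hf : ∀ i ∈ s, MDifferentiableAt (𝓡 n) 𝓘(ℝ, F) (f i) x) :
    MDifferentiableAt (𝓡 n) 𝓘(ℝ, F) (fun y => ∑ i ∈ s, f i y) x := by
  classical
  induction s using Finset.induction_on with
  | empty => simpa using mdifferentiableAt_const
  | insert a s ha ih =>
    simp only [Finset.sum_insert ha]
    exact (hf a (Finset.mem_insert_self _ _)).add
      (ih fun i hi => hf i (Finset.mem_insert_of_mem hi))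

theorem tanDeriv_sum {ι : Type*} (s : Finset ι) {f : ι → M → F} {x : M}
    (hf : ∀ i ∈ s, MDifferentiableAt (𝓡 n) 𝓘(ℝ, F) (f i) x) (v : TangentSpace (𝓡 n) x) :
    tanDeriv (fun y => ∑ i ∈ s, f i y) x v = ∑ i ∈ s, tanDeriv (f i) x v := by
  classical
  induction s using Finset.induction_on with
  | empty => simpa using tanDeriv_const (0 : F) x v
  | insert a s ha ih =>
    have h2 := mdifferentiableAt_sum s fun i hi => hf i (Finset.mem_insert_of_mem hi)
    simp only [Finset.sum_insert ha]
    rw [tanDeriv_add (hf a (Finset.mem_insert_self _ _)) h2,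
      ih fun i hi => hf i (Finset.mem_insert_of_mem hi)]

theorem dirDeriv_eq (X : (x : M) → TangentSpace (𝓡 n) x) (f : M → ℝ) (x : M) :
    dirDeriv X f x = tanDeriv f x (X x) := rfl

end Rules

theorem eq_sum_of_orthonormal {V : Type*} [AddCommGroup V] [Module ℝ V] [FiniteDimensional ℝ V]
    {n : ℕ} (hn : Module.finrank ℝ V = n) (B : V →ₗ[ℝ] V →ₗ[ℝ] ℝ)
    (hpos : ∀ v, v ≠ 0 → 0 < B v v) {e : Fin n → V}
    (he : ∀ i j, B (e i) (e j) = if i = j then 1 else 0) (v : V) :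
    v = ∑ i, B v (e i) • e i := by
  have hli : LinearIndependent ℝ e := by
    rw [Fintype.linearIndependent_iff]
    intro c hc i
    have : B (∑ i, c i • e i) (e i) = 0 := by rw [hc]; simp
    simpa [he] using this
  have hsp := hli.span_eq_top_of_card_eq_finrank' (by simp [hn])
  set w := v - ∑ i, B v (e i) • e i with hw
  have hwe : ∀ j, B w (e j) = 0 := by
    intro j
    simp [hw, he]
  have h0 : ∀ u, B w u = 0 := by
    intro u
    have hu : u ∈ Submodule.span ℝ (Set.range e) := hsp ▸ Submodule.mem_top
    induction hu using Submodule.span_induction with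
    | mem x h => obtain ⟨j, rfl⟩ := h; exact hwe j
    | zero => simp
    | add x y _ _ hx hy => simp [hx, hy]
    | smul a x _ hx => simp [hx]
  by_contra hne
  have : w ≠ 0 := by rwa [hw, sub_ne_zero]
  exact absurd (h0 w) (hpos w this).ne'

/-! ### Orthonormal frames, torsion and the Ricci identity -/

section FrameCalculus

variable {n : ℕ} {M : Type*} [TopologicalSpace M] [ChartedSpace (EuclideanSpace ℝ (Fin n)) M]
  [IsManifold (𝓡 n) ∞ M] {g : SmoothMetric n M} {U : Set M}
  {e : Fin n → (x : M) → TangentSpace (𝓡 n) x}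

theorem IsOrthonormalFrameOn.mono (he : IsOrthonormalFrameOn g U e) {W : Set M} (h : W ⊆ U) :
    IsOrthonormalFrameOn g W e :=
  ⟨fun i => (he.smooth i).mono h, fun x hx => he.orthonormal x (h hx)⟩

omit [IsManifold (𝓡 n) ∞ M] in
theorem ContMDiffOn.mdifferentiableAt_of_isOpen {F : Type*} [NormedAddCommGroup F]
    [NormedSpace ℝ F] {f : M → F} (hU : IsOpen U) (hf : ContMDiffOn (𝓡 n) 𝓘(ℝ, F) ∞ f U)
    {x : M} (hx : x ∈ U) : MDifferentiableAt (𝓡 n) 𝓘(ℝ, F) f x :=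
  (hf.contMDiffAt (hU.mem_nhds hx)).mdifferentiableAt (by simp)

/-- The metric at a point as a bilinear form. -/
def metricForm (g : SmoothMetric n M) (x : M) :
    TangentSpace (𝓡 n) x →ₗ[ℝ] TangentSpace (𝓡 n) x →ₗ[ℝ] ℝ :=
  LinearMap.mk₂ ℝ (fun v w => g.inner x v w) (by simp) (by simp) (by simp) (by simp)

theorem metricForm_apply (x : M) (v w : TangentSpace (𝓡 n) x) :
    metricForm g x v w = g.inner x v w := rfl

instance (x : M) : FiniteDimensional ℝ (TangentSpace (𝓡 n) x) :=
  inferInstanceAs (FiniteDimensional ℝ (EuclideanSpace ℝ (Fin n)))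

omit [IsManifold (𝓡 n) ∞ M] in
theorem finrank_tangentSpace (x : M) : Module.finrank ℝ (TangentSpace (𝓡 n) x) = n :=
  (finrank_euclideanSpace_fin : Module.finrank ℝ (EuclideanSpace ℝ (Fin n)) = n)

theorem IsOrthonormalFrameOn.eq_sum (he : IsOrthonormalFrameOn g U e) {x : M} (hx : x ∈ U)
    (v : TangentSpace (𝓡 n) x) : v = ∑ i, g.inner x v (e i x) • e i x :=
  eq_sum_of_orthonormal (finrank_tangentSpace x) (metricForm g x) (fun v hv => g.pos x v hv)
    (e := fun i => e i x) (fun i j => he.orthonormal x hx i j) v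

theorem IsOrthonormalFrameOn.smooth_dirDeriv (he : IsOrthonormalFrameOn g U e) (hU : IsOpen U)
    {f : M → ℝ} (hf : ContMDiffOn (𝓡 n) 𝓘(ℝ, ℝ) ∞ f U) (i : Fin n) :
    ContMDiffOn (𝓡 n) 𝓘(ℝ, ℝ) ∞ (dirDeriv (e i) f) U :=
  ContMDiffOn.tanDeriv hU hf (he.smooth i)

theorem IsOrthonormalFrameOn.dirDeriv_comm (he : IsOrthonormalFrameOn g U e) (hU : IsOpen U)
    {f : M → ℝ} (hf : ContMDiffOn (𝓡 n) 𝓘(ℝ, ℝ) ∞ f U) {x : M} (hx : x ∈ U) (a b : Fin n) :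
    dirDeriv (e a) (dirDeriv (e b) f) x - dirDeriv (e b) (dirDeriv (e a) f) x =
      ∑ m, structFn g e a b m x * dirDeriv (e m) f x := by
  have hd : ∀ i, MDifferentiableAt (𝓡 n) (𝓡 n).tangent
      (fun x => (⟨x, e i x⟩ : TangentBundle (𝓡 n) M)) x := fun i =>
    ((he.smooth i).contMDiffAt (hU.mem_nhds hx)).mdifferentiableAt (by simp)
  have h := tanDeriv_mlieBracket (f := f) (x := x) (V := e a) (W := e b)
    ((hf.contMDiffAt (hU.mem_nhds hx)).of_le (by norm_cast)) (hd a) (hd b)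
    ((he.smooth_dirDeriv hU hf a).mdifferentiableAt_of_isOpen hU hx)
    ((he.smooth_dirDeriv hU hf b).mdifferentiableAt_of_isOpen hU hx)
  have h2 := congrArg (tanDeriv f x)
    (he.eq_sum hx (VectorField.mlieBracket (𝓡 n) (e a) (e b) x))
  rw [map_sum] at h2
  simp only [map_smul, smul_eq_mul] at h2
  exact h.symm.trans h2

omit [IsManifold (𝓡 n) ∞ M] in
theorem dirDeriv_congr {X : (x : M) → TangentSpace (𝓡 n) x} {f h : M → ℝ} (hU : IsOpen U)
    (hfh : Set.EqOn f h U) {x : M} (hx : x ∈ U) : dirDeriv X f x = dirDeriv X h x :=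
  tanDeriv_congr hU hfh hx (X x)

omit [IsManifold (𝓡 n) ∞ M] in
theorem dirDeriv_const (X : (x : M) → TangentSpace (𝓡 n) x) (c : ℝ) (x : M) :
    dirDeriv X (fun _ => c) x = 0 := tanDeriv_const c x (X x)

theorem structFn_antisymm (i j k : Fin n) (x : M) :
    structFn g e i j k x = - structFn g e j i k x := by
  simp only [structFn]
  rw [VectorField.mlieBracket_swap_apply]
  simp

theorem connFn_antisymm (i j k : Fin n) (x : M) :
    connFn g e i j k x = - connFn g e i k j x := by
  simp only [connFn]
  rw [structFn_antisymm i k j, structFn_antisymm k j i, structFn_antisymm j i k]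
  ring

theorem connFn_torsion (i j k : Fin n) (x : M) :
    connFn g e i j k x - connFn g e j i k x = structFn g e i j k x := by
  simp only [connFn]
  rw [structFn_antisymm j i k, structFn_antisymm i k j, structFn_antisymm j k i]
  ring

/-- The Ricci identity for a covector field `w` with covariant derivative `η`. -/
theorem ricci_identity (he : IsOrthonormalFrameOn g U e) (hU : IsOpen U)
    (hΓ : ∀ i j k, ContMDiffOn (𝓡 n) 𝓘(ℝ, ℝ) ∞ (connFn g e i j k) U)
    {w : Fin n → M → ℝ} {η : Fin n → Fin n → M → ℝ}
    (hw : ∀ i, ContMDiffOn (𝓡 n) 𝓘(ℝ, ℝ) ∞ (w i) U)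
    (hη : ∀ i j, ContMDiffOn (𝓡 n) 𝓘(ℝ, ℝ) ∞ (η i j) U)
    (h : ∀ a c, ∀ x ∈ U, dirDeriv (e a) (w c) x = η a c x + ∑ m, connFn g e a c m x * w m x)
    {x : M} (hx : x ∈ U) (a b c : Fin n) :
    dirDeriv (e a) (η b c) x - dirDeriv (e b) (η a c) x =
      ∑ m, (structFn g e a b m x * η m c x - connFn g e b c m x * η a m x
        + connFn g e a c m x * η b m x) - ∑ l, riemann g e a b c l x * w l x := by
  have hD : ∀ a b c, dirDeriv (e a) (dirDeriv (e b) (w c)) x = dirDeriv (e a) (η b c) x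
      + ∑ m, (dirDeriv (e a) (connFn g e b c m) x * w m x
        + connFn g e b c m x * (η a m x + ∑ l, connFn g e a m l x * w l x)) := by
    intro a b c
    have md := fun {f : M → ℝ} (hf : ContMDiffOn (𝓡 n) 𝓘(ℝ, ℝ) ∞ f U) =>
      hf.mdifferentiableAt_of_isOpen hU hx
    have hm : ∀ m, MDifferentiableAt (𝓡 n) 𝓘(ℝ, ℝ) (fun y => connFn g e b c m y * w m y) x :=
      fun m => (md (hΓ b c m)).mul (md (hw m))
    rw [dirDeriv_congr hU (fun y hy => h b c y hy) hx, dirDeriv_eq,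
      tanDeriv_add (md (hη b c)) (mdifferentiableAt_sum _ fun m _ => hm m),
      tanDeriv_sum _ fun m _ => hm m]
    congr 1
    refine Finset.sum_congr rfl fun m _ => ?_
    rw [tanDeriv_mul (md (hΓ b c m)) (md (hw m)), ← h a m x hx]
    rfl
  have h1 := he.dirDeriv_comm hU (hw c) hx a b
  rw [hD, hD] at h1
  have h2 : ∑ m, structFn g e a b m x * dirDeriv (e m) (w c) x
      = ∑ m, structFn g e a b m x * (η m c x + ∑ l, connFn g e m c l x * w l x) :=
    Finset.sum_congr rfl fun m _ => by rw [h m c x hx]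
  rw [h2] at h1
  simp only [riemann, mul_add, add_mul, sub_mul, Finset.sum_add_distrib, Finset.sum_sub_distrib,
    Finset.mul_sum, Finset.sum_mul] at h1 ⊢
  -- The double sums coming from the connection terms must be reindexed so that `w l` is the outer
  -- factor, as in the curvature term.
  have s1 : ∀ A B : Fin n → Fin n → ℝ, ∑ m, ∑ l, A m l * (B m l * w l x)
      = ∑ l, ∑ m, A m l * B m l * w l x := by
    intro A B
    rw [Finset.sum_comm]
    simp only [mul_assoc]
  rw [s1 (fun m l => connFn g e b c m x) (fun m l => connFn g e a m l x),
    s1 (fun m l => connFn g e a c m x) (fun m l => connFn g e b m l x),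
    s1 (fun m l => structFn g e a b m x) (fun m l => connFn g e m c l x)] at h1
  linarith

end FrameCalculus

/-- Uniqueness of the Levi-Civita connection at a point, with respect to an orthonormal coframe `Θ`
with connection form `W`. -/
theorem levi_civita_unique {ι κ : Type*} [Fintype ι] [Fintype κ] [DecidableEq ι] [DecidableEq κ]
    (hcard : Fintype.card ι = Fintype.card κ) {Θ : κ → ι → ℝ} {dΘ : ι → κ → ι → ℝ}
    {c Γ : ι → ι → ι → ℝ} {W : ι → κ → κ → ℝ}
    (hΓ : ∀ i j k, Γ i j k = - Γ i k j) (hT : ∀ i j k, Γ i j k - Γ j i k = c i j k)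
    (hW : ∀ a α β, W a α β = - W a β α)
    (orth : ∀ a b, ∑ α, Θ α a * Θ α b = if a = b then 1 else 0)
    (dorth : ∀ a b d, ∑ α, (dΘ a α b * Θ α d + Θ α b * dΘ a α d) = 0)
    (tors : ∀ a b α, dΘ a α b - dΘ b α a = ∑ m, c a b m * Θ α m
      + ∑ β, (W a α β * Θ β b - W b α β * Θ β a)) (a : ι) (α : κ) (b : ι) :
    dΘ a α b = ∑ m, Γ a b m * Θ α m + ∑ β, W a α β * Θ β b := by
  set S : ι → κ → ι → ℝ := fun a α b =>
    dΘ a α b - ∑ m, Γ a b m * Θ α m - ∑ β, W a α β * Θ β b with hS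
  set T : ι → ι → ι → ℝ := fun a b d => ∑ α, Θ α d * S a α b with hTdef
  have hsym : ∀ a α b, S a α b = S b α a := by
    intro a α b
    have h1 := tors a b α
    have h2 : ∑ m, c a b m * Θ α m = ∑ m, Γ a b m * Θ α m - ∑ m, Γ b a m * Θ α m := by
      rw [← Finset.sum_sub_distrib]
      exact Finset.sum_congr rfl fun m _ => by rw [← hT a b m]; ring
    rw [h2, Finset.sum_sub_distrib] at h1
    simp only [hS]; linarith
  have e1 : ∀ a b d, ∑ α, Θ α d * ∑ m, Γ a b m * Θ α m = Γ a b d := by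
    intro a b d
    simp only [Finset.mul_sum]
    rw [Finset.sum_comm]
    have : ∀ m, ∑ α, Θ α d * (Γ a b m * Θ α m) = Γ a b m * if d = m then 1 else 0 := by
      intro m
      rw [← orth d m, Finset.mul_sum]
      exact Finset.sum_congr rfl fun _ _ => by ring
    simp [this]
  have e2 : ∀ a b d, ∑ α, Θ α d * ∑ β, W a α β * Θ β b = - ∑ α, Θ α b * ∑ β, W a α β * Θ β d := by
    intro a b d
    simp only [Finset.mul_sum]
    rw [Finset.sum_comm, ← Finset.sum_neg_distrib]
    refine Finset.sum_congr rfl fun α _ => ?_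
    rw [← Finset.sum_neg_distrib]
    refine Finset.sum_congr rfl fun β _ => ?_
    rw [hW a β α]; ring
  have hT1 : ∀ a b d, T a b d = - T a d b := by
    intro a b d
    have h1 := dorth a b d
    have h2 : T a b d = ∑ α, dΘ a α b * Θ α d - Γ a b d - ∑ α, Θ α d * ∑ β, W a α β * Θ β b := by
      rw [← e1 a b d]
      simp only [hTdef, hS, mul_sub, Finset.sum_sub_distrib]
      congr 2
      exact Finset.sum_congr rfl fun _ _ => by ring
    have h3 : T a d b = ∑ α, Θ α b * dΘ a α d - Γ a d b - ∑ α, Θ α b * ∑ β, W a α β * Θ β d := by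
      rw [← e1 a d b]
      simp only [hTdef, hS, mul_sub, Finset.sum_sub_distrib]
    rw [Finset.sum_add_distrib] at h1
    have := e2 a b d
    have := hΓ a b d
    linarith
  have hT2 : ∀ a b d, T a b d = T b a d := fun a b d => by
    simp only [hTdef]; exact Finset.sum_congr rfl fun α _ => by rw [hsym]
  -- A three-index array symmetric in the first pair and skew in the last pair vanishes.
  have hT0 : ∀ a b d, T a b d = 0 := by
    intro a b d
    have := hT2 a b d; have := hT1 b a d; have := hT2 b d a
    have := hT1 d b a; have := hT2 d a b; have := hT1 a d b
    linarith
  -- Orthonormal columns of a square matrix force orthonormal rows, so `S` can be recovered from its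
  -- contraction `T`.
  have orth' : ∀ α β, ∑ d, Θ α d * Θ β d = if α = β then 1 else 0 := by
    have h1 : (Matrix.of Θ).transpose * Matrix.of Θ = 1 := by
      ext a b
      simp [Matrix.mul_apply, Matrix.one_apply, orth]
    have h2 := (Matrix.mul_eq_one_comm_of_card_eq _ _ _ hcard).1 h1
    intro α β
    have := congrFun (congrFun h2 α) β
    simpa [Matrix.mul_apply, Matrix.one_apply] using this
  have hS0 : S a α b = 0 := by
    have : ∑ d, Θ α d * T a b d = S a α b := by
      simp only [hTdef, Finset.mul_sum]
      rw [Finset.sum_comm]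
      have : ∀ β, ∑ d, Θ α d * (Θ β d * S a β b) = (if α = β then 1 else 0) * S a β b := by
        intro β
        rw [← orth' α β, Finset.sum_mul]
        exact Finset.sum_congr rfl fun _ _ => by ring
      simp [this]
    rw [← this]; simp [hT0]
  simp only [hS] at hS0
  linarith

/-! ### Differentiability bundled with the value of the derivative -/

section HasTanDeriv

variable {n : ℕ} {M : Type*} [TopologicalSpace M] [ChartedSpace (EuclideanSpace ℝ (Fin n)) M]

/-- `f` is differentiable at `x` and `d` is its derivative along `v`. -/
structure HasTanDeriv {F : Type*} [NormedAddCommGroup F] [NormedSpace ℝ F]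
    (f : M → F) (x : M) (v : TangentSpace (𝓡 n) x) (d : F) : Prop where
  diff : MDifferentiableAt (𝓡 n) 𝓘(ℝ, F) f x
  eq : tanDeriv f x v = d

namespace HasTanDeriv

variable {x : M} {v : TangentSpace (𝓡 n) x}
  {F : Type*} [NormedAddCommGroup F] [NormedSpace ℝ F]

theorem const (c : F) : HasTanDeriv (fun _ : M => c) x v 0 :=
  ⟨mdifferentiableAt_const, tanDeriv_const c x v⟩

theorem add {f h : M → F} {d d' : F} (hf : HasTanDeriv f x v d) (hh : HasTanDeriv h x v d') :
    HasTanDeriv (fun y => f y + h y) x v (d + d') :=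
  ⟨hf.diff.add hh.diff, by rw [tanDeriv_add hf.diff hh.diff, hf.eq, hh.eq]⟩

theorem clm {F' : Type*} [NormedAddCommGroup F'] [NormedSpace ℝ F'] (L : F →L[ℝ] F') {f : M → F}
    {d : F} (hf : HasTanDeriv f x v d) : HasTanDeriv (fun y => L (f y)) x v (L d) :=
  ⟨L.differentiableAt.comp_mdifferentiableAt hf.diff, by rw [tanDeriv_clm L hf.diff, hf.eq]⟩

theorem comp {F' : Type*} [NormedAddCommGroup F'] [NormedSpace ℝ F'] {f : M → F} {d : F}
    (hf : HasTanDeriv f x v d) {φ : F → F'} {L : F →L[ℝ] F'} (hφ : HasFDerivAt φ L (f x)) :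
    HasTanDeriv (fun y => φ (f y)) x v (L d) :=
  ⟨hφ.differentiableAt.comp_mdifferentiableAt hf.diff, by rw [tanDeriv_comp hφ hf.diff, hf.eq]⟩

theorem neg {f : M → F} {d : F} (hf : HasTanDeriv f x v d) :
    HasTanDeriv (fun y => - f y) x v (- d) :=
  hf.clm (-ContinuousLinearMap.id ℝ F)

theorem sub {f h : M → F} {d d' : F} (hf : HasTanDeriv f x v d) (hh : HasTanDeriv h x v d') :
    HasTanDeriv (fun y => f y - h y) x v (d - d') := by
  simpa only [sub_eq_add_neg] using hf.add hh.neg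

theorem mul {A : Type*} [NormedRing A] [NormedAlgebra ℝ A] {f h : M → A} {d d' : A}
    (hf : HasTanDeriv f x v d) (hh : HasTanDeriv h x v d') :
    HasTanDeriv (fun y => f y * h y) x v (d * h x + f x * d') :=
  ⟨hf.diff.mul hh.diff, by rw [tanDeriv_mul hf.diff hh.diff, hf.eq, hh.eq]⟩

theorem const_mul {A : Type*} [NormedRing A] [NormedAlgebra ℝ A] {f : M → A} {d : A} (c : A)
    (hf : HasTanDeriv f x v d) : HasTanDeriv (fun y => c * f y) x v (c * d) :=
  hf.clm (ContinuousLinearMap.mul ℝ A c)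

theorem sum {ι : Type*} (s : Finset ι) {f : ι → M → F} {d : ι → F}
    (hf : ∀ i ∈ s, HasTanDeriv (f i) x v (d i)) :
    HasTanDeriv (fun y => ∑ i ∈ s, f i y) x v (∑ i ∈ s, d i) :=
  ⟨mdifferentiableAt_sum s fun i hi => (hf i hi).diff, by
    rw [tanDeriv_sum s fun i hi => (hf i hi).diff]
    exact Finset.sum_congr rfl fun i hi => (hf i hi).eq⟩

theorem inv {f : M → ℝ} {d : ℝ} (hf : HasTanDeriv f x v d) (h0 : f x ≠ 0) :
    HasTanDeriv (fun y => (f y)⁻¹) x v (-d / f x ^ 2) := by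
  have := hf.comp (hasDerivAt_inv h0).hasFDerivAt
  convert this using 1
  simp
  ring

theorem congr_deriv {f : M → F} {d d' : F} (hf : HasTanDeriv f x v d) (h : d = d') :
    HasTanDeriv f x v d' := h ▸ hf

theorem of_contMDiffOn {f : M → F} {U : Set M} (hU : IsOpen U)
    (hf : ContMDiffOn (𝓡 n) 𝓘(ℝ, F) ∞ f U) (hx : x ∈ U) : HasTanDeriv f x v (tanDeriv f x v) :=
  ⟨hf.mdifferentiableAt_of_isOpen hU hx, rfl⟩

end HasTanDeriv

end HasTanDeriv

/-! ### Connection and curvature of `ℝ × N³(κ)` -/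

/-- `r` and `p` are smooth functions on the open set `U` that pull back the metric of the model of
`ℝ × N³(κ)` to `g`. -/
structure IsProductChartOn {M : Type*} [TopologicalSpace M]
    [ChartedSpace (EuclideanSpace ℝ (Fin 4)) M] [IsManifold (𝓡 4) ∞ M]
    (g : SmoothMetric 4 M) (κ : ℝ) (U : Set M) (r : M → ℝ) (p : Fin 3 → M → ℝ) : Prop where
  smooth_fst : ContMDiffOn (𝓡 4) 𝓘(ℝ, ℝ) ∞ r U
  smooth_snd : ∀ i, ContMDiffOn (𝓡 4) 𝓘(ℝ, ℝ) ∞ (p i) U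
  pos : ∀ x ∈ U, 0 < 1 + κ / 4 * ∑ i, p i x ^ 2
  metric : ∀ x ∈ U, ∀ v : TangentSpace (𝓡 4) x, g.inner x v v = tanDeriv r x v ^ 2
    + (∑ i, tanDeriv (p i) x v ^ 2) / (1 + κ / 4 * ∑ i, p i x ^ 2) ^ 2

namespace IsProductChartOn

variable {M : Type*} [TopologicalSpace M]
  [ChartedSpace (EuclideanSpace ℝ (Fin 4)) M] [IsManifold (𝓡 4) ∞ M]
  {g : SmoothMetric 4 M} {κ : ℝ} {U : Set M} {r : M → ℝ} {p : Fin 3 → M → ℝ}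

theorem mono (h : IsProductChartOn g κ U r p) {W : Set M} (hW : W ⊆ U) :
    IsProductChartOn g κ W r p :=
  ⟨h.smooth_fst.mono hW, fun i => (h.smooth_snd i).mono hW, fun x hx => h.pos x (hW hx),
    fun x hx => h.metric x (hW hx)⟩

theorem metric_polar (h : IsProductChartOn g κ U r p) {x : M} (hx : x ∈ U)
    (v w : TangentSpace (𝓡 4) x) : g.inner x v w = tanDeriv r x v * tanDeriv r x w
    + (∑ i, tanDeriv (p i) x v * tanDeriv (p i) x w) / (1 + κ / 4 * ∑ i, p i x ^ 2) ^ 2 := by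
  have h1 := h.metric x hx (v + w)
  have h2 := h.metric x hx v
  have h3 := h.metric x hx w
  have h4 : g.inner x w v = g.inner x v w := g.symm x w v
  simp only [map_add, add_apply, h2, h3, h4, Fin.sum_univ_three] at h1 ⊢
  linear_combination h1 / 2

end IsProductChartOn

/-- The conformal factor `1 + κ|p|²/4`. -/
def confFactor {M : Type*} (κ : ℝ) (p : Fin 3 → M → ℝ) (x : M) : ℝ := 1 + κ / 4 * ∑ i, p i x ^ 2

section Coframe

variable {M : Type*} [TopologicalSpace M]
  [ChartedSpace (EuclideanSpace ℝ (Fin 4)) M]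
  (κ : ℝ) (p : Fin 3 → M → ℝ) (e : Fin 4 → (x : M) → TangentSpace (𝓡 4) x)

/-- The components on the frame `e` of the coframe `dpᵢ / (1 + κ|p|²/4)`. -/
def coframe (i : Fin 3) (a : Fin 4) (x : M) : ℝ := dirDeriv (e a) (p i) x * (confFactor κ p x)⁻¹

/-- `∑ᵢ pᵢ θᵢ`. -/
def radialForm (a : Fin 4) (x : M) : ℝ := ∑ i, p i x * coframe κ p e i a x

/-- `∑ᵢ θᵢ ⊗ θᵢ`. -/
def projForm (a b : Fin 4) (x : M) : ℝ := ∑ i, coframe κ p e i a x * coframe κ p e i b x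

/-- The covariant derivative of `θᵢ`. -/
def nablaCoframe (i : Fin 3) (a b : Fin 4) (x : M) : ℝ :=
  κ / 2 * (coframe κ p e i a x * radialForm κ p e b x - p i x * projForm κ p e a b x)

end Coframe

namespace IsProductChartOn

variable {M : Type*} [TopologicalSpace M]
  [ChartedSpace (EuclideanSpace ℝ (Fin 4)) M] [IsManifold (𝓡 4) ∞ M]
  {g : SmoothMetric 4 M} {κ : ℝ} {U : Set M} {r : M → ℝ} {p : Fin 3 → M → ℝ}
  {e : Fin 4 → (x : M) → TangentSpace (𝓡 4) x}

theorem confFactor_pos (h : IsProductChartOn g κ U r p) {x : M} (hx : x ∈ U) :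
    0 < confFactor κ p x := h.pos x hx

theorem smooth_confFactor (h : IsProductChartOn g κ U r p) :
    ContMDiffOn (𝓡 4) 𝓘(ℝ, ℝ) ∞ (confFactor κ p) U := by
  have h1 := h.smooth_snd
  unfold confFactor
  simp only [Fin.sum_univ_three]
  exact contMDiffOn_const.add (contMDiffOn_const.mul ((((h1 0).pow 2).add ((h1 1).pow 2)).add ((h1 2).pow 2)))

theorem smooth_coframe (h : IsProductChartOn g κ U r p) (hU : IsOpen U)
    (he : IsOrthonormalFrameOn g U e) (i : Fin 3) (a : Fin 4) :
    ContMDiffOn (𝓡 4) 𝓘(ℝ, ℝ) ∞ (coframe κ p e i a) U :=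
  (he.smooth_dirDeriv hU (h.smooth_snd i) a).mul
    (h.smooth_confFactor.inv₀ fun _ hx => (h.confFactor_pos hx).ne')

theorem smooth_radialForm (h : IsProductChartOn g κ U r p) (hU : IsOpen U)
    (he : IsOrthonormalFrameOn g U e) (a : Fin 4) :
    ContMDiffOn (𝓡 4) 𝓘(ℝ, ℝ) ∞ (radialForm κ p e a) U := by
  have := fun i => (h.smooth_snd i).mul (h.smooth_coframe hU he i a)
  unfold radialForm
  simp only [Fin.sum_univ_three]
  exact ((this 0).add (this 1)).add (this 2)

theorem smooth_projForm (h : IsProductChartOn g κ U r p) (hU : IsOpen U)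
    (he : IsOrthonormalFrameOn g U e) (a b : Fin 4) :
    ContMDiffOn (𝓡 4) 𝓘(ℝ, ℝ) ∞ (projForm κ p e a b) U := by
  have := fun i => (h.smooth_coframe hU he i a).mul (h.smooth_coframe hU he i b)
  unfold projForm
  simp only [Fin.sum_univ_three]
  exact ((this 0).add (this 1)).add (this 2)

theorem smooth_nablaCoframe (h : IsProductChartOn g κ U r p) (hU : IsOpen U)
    (he : IsOrthonormalFrameOn g U e) (i : Fin 3) (a b : Fin 4) :
    ContMDiffOn (𝓡 4) 𝓘(ℝ, ℝ) ∞ (nablaCoframe κ p e i a b) U :=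
  contMDiffOn_const.mul (((h.smooth_coframe hU he i a).mul (h.smooth_radialForm hU he b)).sub
    ((h.smooth_snd i).mul (h.smooth_projForm hU he a b)))

theorem orthonormal (h : IsProductChartOn g κ U r p) (he : IsOrthonormalFrameOn g U e) {x : M}
    (hx : x ∈ U) (a b : Fin 4) : dirDeriv (e a) r x * dirDeriv (e b) r x + projForm κ p e a b x
      = if a = b then 1 else 0 := by
  have h1 := h.metric_polar hx (e a x) (e b x)
  change _ = _ + _ / confFactor κ p x ^ 2 at h1
  rw [← he.orthonormal x hx a b, h1]
  simp only [projForm, coframe, Fin.sum_univ_three, dirDeriv_eq]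
  ring

theorem dirDeriv_snd (h : IsProductChartOn g κ U r p) {x : M} (hx : x ∈ U) (i : Fin 3)
    (a : Fin 4) : dirDeriv (e a) (p i) x = confFactor κ p x * coframe κ p e i a x := by
  have := (h.confFactor_pos hx).ne'
  rw [coframe]
  field_simp

theorem hasTanDeriv_snd (h : IsProductChartOn g κ U r p) (hU : IsOpen U) {x : M} (hx : x ∈ U)
    (i : Fin 3) (a : Fin 4) :
    HasTanDeriv (p i) x (e a x) (confFactor κ p x * coframe κ p e i a x) :=
  (HasTanDeriv.of_contMDiffOn hU (h.smooth_snd i) hx).congr_deriv (h.dirDeriv_snd hx i a)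

theorem hasTanDeriv_confFactor (h : IsProductChartOn g κ U r p) (hU : IsOpen U) {x : M}
    (hx : x ∈ U) (a : Fin 4) : HasTanDeriv (confFactor κ p) x (e a x)
      (κ / 2 * confFactor κ p x * radialForm κ p e a x) := by
  have h1 := HasTanDeriv.sum Finset.univ fun i (_ : i ∈ Finset.univ) =>
    (h.hasTanDeriv_snd (e := e) hU hx i a).mul (h.hasTanDeriv_snd hU hx i a)
  have h2 := (HasTanDeriv.const (1 : ℝ)).add (h1.const_mul (κ / 4))
  simp only [← pow_two] at h2
  refine h2.congr_deriv ?_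
  simp only [radialForm, Fin.sum_univ_three]
  ring

theorem dirDeriv_coframe_eq (h : IsProductChartOn g κ U r p) (hU : IsOpen U)
    (he : IsOrthonormalFrameOn g U e) {x : M} (hx : x ∈ U) (i : Fin 3) (a b : Fin 4) :
    dirDeriv (e a) (coframe κ p e i b) x = dirDeriv (e a) (dirDeriv (e b) (p i)) x
      * (confFactor κ p x)⁻¹ - κ / 2 * coframe κ p e i b x * radialForm κ p e a x := by
  have h0 := (h.confFactor_pos hx).ne'
  have h1 := (HasTanDeriv.of_contMDiffOn (v := e a x) hU
    (he.smooth_dirDeriv hU (h.smooth_snd i) b) hx).mul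
    ((h.hasTanDeriv_confFactor hU hx a).inv h0)
  refine h1.eq.trans ?_
  rw [← dirDeriv_eq, h.dirDeriv_snd (e := e) hx i b]
  field_simp
  ring

/-- First structure equation for `θᵢ = dpᵢ / F`, `F` the conformal factor: the second derivatives of
`pᵢ` contribute only the bracket, and the differential of `1 / F` the rest. -/
theorem coframe_torsion (h : IsProductChartOn g κ U r p) (hU : IsOpen U)
    (he : IsOrthonormalFrameOn g U e) {x : M} (hx : x ∈ U) (i : Fin 3) (a b : Fin 4) :
    dirDeriv (e a) (coframe κ p e i b) x - dirDeriv (e b) (coframe κ p e i a) x =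
      ∑ m, structFn g e a b m x * coframe κ p e i m x
        + (nablaCoframe κ p e i a b x - nablaCoframe κ p e i b a x) := by
  rw [h.dirDeriv_coframe_eq hU he hx, h.dirDeriv_coframe_eq hU he hx]
  have h1 := he.dirDeriv_comm hU (h.smooth_snd i) hx a b
  have h2 : ∑ m, structFn g e a b m x * coframe κ p e i m x =
      (∑ m, structFn g e a b m x * dirDeriv (e m) (p i) x) * (confFactor κ p x)⁻¹ := by
    rw [Finset.sum_mul]
    exact Finset.sum_congr rfl fun m _ => by rw [coframe]; ring
  have h3 : projForm κ p e a b x = projForm κ p e b a x := by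
    simp only [projForm]; exact Finset.sum_congr rfl fun m _ => by ring
  rw [h2, ← h1]
  simp only [nablaCoframe, h3]
  ring

/-- The skew connection form `W` below solves the structure equations for the orthonormal coframe
`dr, θᵢ`, so by uniqueness it is the Levi-Civita connection: `dr` is parallel and `∇θᵢ` is
`nablaCoframe`. -/
theorem levi_civita (h : IsProductChartOn g κ U r p) (hU : IsOpen U)
    (he : IsOrthonormalFrameOn g U e) {x : M} (hx : x ∈ U) (a b : Fin 4) :
    dirDeriv (e a) (dirDeriv (e b) r) x = ∑ m, connFn g e a b m x * dirDeriv (e m) r x ∧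
    ∀ i, dirDeriv (e a) (coframe κ p e i b) x = nablaCoframe κ p e i a b x
      + ∑ m, connFn g e a b m x * coframe κ p e i m x := by
  -- The index `none` stands for `dr` and `some i` for `θᵢ`.
  let Θ : Option (Fin 3) → Fin 4 → M → ℝ := fun α a =>
    α.elim (dirDeriv (e a) r) (fun i => coframe κ p e i a)
  let W : Fin 4 → Option (Fin 3) → Option (Fin 3) → ℝ := fun a α β =>
    α.elim 0 fun i => β.elim 0 fun j =>
      κ / 2 * (p j x * coframe κ p e i a x - p i x * coframe κ p e j a x)
  have hΘ : ∀ α a, ContMDiffOn (𝓡 4) 𝓘(ℝ, ℝ) ∞ (Θ α a) U := by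
    rintro (_ | i) a
    · exact he.smooth_dirDeriv hU h.smooth_fst a
    · exact h.smooth_coframe hU he i a
  have orth : ∀ y ∈ U, ∀ a b, ∑ α, Θ α a y * Θ α b y = if a = b then 1 else 0 := by
    intro y hy a b
    rw [Fintype.sum_option]
    exact h.orthonormal he hy a b
  have hWs : ∀ a i b, ∑ β, W a (some i) β * Θ β b x = nablaCoframe κ p e i a b x := by
    intro a i b
    rw [Fintype.sum_option]
    simp only [W, Θ, Option.elim, nablaCoframe, radialForm, projForm, Fin.sum_univ_three]
    ring
  have hWn : ∀ a b, ∑ β, W a none β * Θ β b x = 0 := by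
    intro a b
    simp [W]
  have key := levi_civita_unique (ι := Fin 4) (κ := Option (Fin 3)) (by simp)
    (Θ := fun α a => Θ α a x) (dΘ := fun a α b => dirDeriv (e a) (Θ α b) x)
    (c := fun a b m => structFn g e a b m x) (Γ := fun a b m => connFn g e a b m x) (W := W)
    (fun i j k => connFn_antisymm i j k x) (fun i j k => connFn_torsion i j k x)
    (by
      rintro a (_ | i) (_ | j)
      all_goals simp only [W, Option.elim]
      all_goals ring)
    (orth x hx)
    (by
      intro a b d
      have h1 := HasTanDeriv.sum Finset.univ fun α (_ : α ∈ Finset.univ) =>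
        (HasTanDeriv.of_contMDiffOn (v := e a x) hU (hΘ α b) hx).mul
          (HasTanDeriv.of_contMDiffOn (v := e a x) hU (hΘ α d) hx)
      have h2 := tanDeriv_congr hU (fun y hy => orth y hy b d) hx (e a x)
      rw [tanDeriv_const] at h2
      exact h1.eq.symm.trans h2)
    (by
      rintro a b (_ | i)
      · have h1 := he.dirDeriv_comm hU h.smooth_fst hx a b
        simp only [Finset.sum_sub_distrib, hWn, sub_zero, add_zero]
        exact h1
      · simp only [Finset.sum_sub_distrib, hWs]
        exact h.coframe_torsion hU he hx i a b)
  refine ⟨?_, fun i => ?_⟩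
  · have := key a none b
    simp only [hWn, add_zero] at this
    exact this
  · have := key a (some i) b
    simp only [hWs] at this
    rw [add_comm]
    exact this

end IsProductChartOn

namespace IsProductChartOn

variable {M : Type*} [TopologicalSpace M]
  [ChartedSpace (EuclideanSpace ℝ (Fin 4)) M] [IsManifold (𝓡 4) ∞ M]
  {g : SmoothMetric 4 M} {κ : ℝ} {U : Set M} {r : M → ℝ} {p : Fin 3 → M → ℝ}
  {e : Fin 4 → (x : M) → TangentSpace (𝓡 4) x}

omit [IsManifold (𝓡 4) ∞ M] in
theorem projForm_comm (a b : Fin 4) (x : M) : projForm κ p e a b x = projForm κ p e b a x := by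
  simp only [projForm]; exact Finset.sum_congr rfl fun m _ => by ring

theorem projForm_eq (h : IsProductChartOn g κ U r p) (he : IsOrthonormalFrameOn g U e) {x : M}
    (hx : x ∈ U) (a b : Fin 4) : projForm κ p e a b x
      = (if a = b then 1 else 0) - dirDeriv (e a) r x * dirDeriv (e b) r x := by
  rw [← h.orthonormal he hx a b]; ring

/-- Contracting the covariant derivative of the coframe with the coframe solves for the connection
coefficients. They are thereby expressed through visibly smooth functions, and the Ricci identity
needs their smoothness. -/
theorem connFn_eq (h : IsProductChartOn g κ U r p) (hU : IsOpen U)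
    (he : IsOrthonormalFrameOn g U e) {x : M} (hx : x ∈ U) (a b c : Fin 4) :
    connFn g e a b c x = dirDeriv (e c) r x * dirDeriv (e a) (dirDeriv (e b) r) x
      + ∑ i, coframe κ p e i c x *
        (dirDeriv (e a) (coframe κ p e i b) x - nablaCoframe κ p e i a b x) := by
  obtain ⟨h1, h2⟩ := h.levi_civita hU he hx a b
  have h3 := fun m => h.orthonormal he hx m c
  simp only [h1, h2, add_sub_cancel_left]
  have h4 : connFn g e a b c x = ∑ m, connFn g e a b m x *
      (dirDeriv (e m) r x * dirDeriv (e c) r x + projForm κ p e m c x) := by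
    simp [h3]
  rw [h4]
  simp only [projForm, Fin.sum_univ_three, Fin.sum_univ_four]
  ring

theorem smooth_connFn (h : IsProductChartOn g κ U r p) (hU : IsOpen U)
    (he : IsOrthonormalFrameOn g U e) (a b c : Fin 4) :
    ContMDiffOn (𝓡 4) 𝓘(ℝ, ℝ) ∞ (connFn g e a b c) U := by
  have s1 := fun i => (h.smooth_coframe hU he i c).mul
    ((he.smooth_dirDeriv hU (h.smooth_coframe hU he i b) a).sub (h.smooth_nablaCoframe hU he i a b))
  refine ContMDiffOn.congr (f := fun x => dirDeriv (e c) r x * dirDeriv (e a) (dirDeriv (e b) r) x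
      + ∑ i, coframe κ p e i c x *
        (dirDeriv (e a) (coframe κ p e i b) x - nablaCoframe κ p e i a b x)) ?_
    fun x hx => h.connFn_eq hU he hx a b c
  simp only [Fin.sum_univ_three]
  exact ((he.smooth_dirDeriv hU h.smooth_fst c).mul (he.smooth_dirDeriv hU
    (he.smooth_dirDeriv hU h.smooth_fst b) a)).add (((s1 0).add (s1 1)).add (s1 2))

theorem hasTanDeriv_coframe (h : IsProductChartOn g κ U r p) (hU : IsOpen U)
    (he : IsOrthonormalFrameOn g U e) {x : M} (hx : x ∈ U) (i : Fin 3) (a b : Fin 4) :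
    HasTanDeriv (coframe κ p e i b) x (e a x) (nablaCoframe κ p e i a b x
      + ∑ m, connFn g e a b m x * coframe κ p e i m x) :=
  (HasTanDeriv.of_contMDiffOn hU (h.smooth_coframe hU he i b) hx).congr_deriv
    ((h.levi_civita hU he hx a b).2 i)

theorem hasTanDeriv_radialForm (h : IsProductChartOn g κ U r p) (hU : IsOpen U)
    (he : IsOrthonormalFrameOn g U e) {x : M} (hx : x ∈ U) (a b : Fin 4) :
    HasTanDeriv (radialForm κ p e b) x (e a x) (∑ m, connFn g e a b m x * radialForm κ p e m x
      + (confFactor κ p x - κ / 2 * ∑ i, p i x ^ 2) * projForm κ p e a b x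
      + κ / 2 * (radialForm κ p e a x * radialForm κ p e b x)) := by
  have h1 := HasTanDeriv.sum Finset.univ fun i (_ : i ∈ Finset.univ) =>
    (h.hasTanDeriv_snd (e := e) hU hx i a).mul (h.hasTanDeriv_coframe hU he hx i a b)
  refine h1.congr_deriv ?_
  simp only [nablaCoframe]
  generalize confFactor κ p x = F
  simp only [radialForm, projForm, Fin.sum_univ_three, Fin.sum_univ_four]
  ring

theorem hasTanDeriv_projForm (h : IsProductChartOn g κ U r p) (hU : IsOpen U)
    (he : IsOrthonormalFrameOn g U e) {x : M} (hx : x ∈ U) (a b c : Fin 4) :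
    HasTanDeriv (projForm κ p e b c) x (e a x) (∑ m, connFn g e a b m x * projForm κ p e m c x
      + ∑ m, connFn g e a c m x * projForm κ p e b m x) := by
  have h1 := HasTanDeriv.sum Finset.univ fun i (_ : i ∈ Finset.univ) =>
    (h.hasTanDeriv_coframe hU he hx i a b).mul (h.hasTanDeriv_coframe hU he hx i a c)
  refine h1.congr_deriv ?_
  simp only [nablaCoframe, radialForm, projForm, Fin.sum_univ_three, Fin.sum_univ_four]
  ring

theorem hasTanDeriv_nablaCoframe (h : IsProductChartOn g κ U r p) (hU : IsOpen U)
    (he : IsOrthonormalFrameOn g U e) {x : M} (hx : x ∈ U) (i : Fin 3) (a b c : Fin 4) :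
    HasTanDeriv (nablaCoframe κ p e i b c) x (e a x)
      (∑ m, connFn g e a b m x * nablaCoframe κ p e i m c x
      + ∑ m, connFn g e a c m x * nablaCoframe κ p e i b m x
      + κ / 2 * (nablaCoframe κ p e i a b x * radialForm κ p e c x
        + coframe κ p e i b x * ((confFactor κ p x - κ / 2 * ∑ i, p i x ^ 2)
          * projForm κ p e a c x + κ / 2 * (radialForm κ p e a x * radialForm κ p e c x))
        - confFactor κ p x * coframe κ p e i a x * projForm κ p e b c x)) := by
  have h1 := (((h.hasTanDeriv_coframe hU he hx i a b).mul
    (h.hasTanDeriv_radialForm hU he hx a c)).sub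
    ((h.hasTanDeriv_snd (e := e) hU hx i a).mul (h.hasTanDeriv_projForm hU he hx a b c))).const_mul
    (κ / 2)
  refine h1.congr_deriv ?_
  simp only [nablaCoframe, Fin.sum_univ_four]
  ring

/-- The Ricci identity for `θᵢ`. The connection terms cancel, and the definition of `F` turns what
remains into the curvature of a space form. -/
theorem riemann_coframe (h : IsProductChartOn g κ U r p) (hU : IsOpen U)
    (he : IsOrthonormalFrameOn g U e) {x : M} (hx : x ∈ U) (i : Fin 3) (a b c : Fin 4) :
    ∑ l, riemann g e a b c l x * coframe κ p e i l x = κ * (coframe κ p e i a x *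
      projForm κ p e b c x - coframe κ p e i b x * projForm κ p e a c x) := by
  have h1 := ricci_identity he hU (h.smooth_connFn hU he) (w := coframe κ p e i)
    (η := nablaCoframe κ p e i) (h.smooth_coframe hU he i) (h.smooth_nablaCoframe hU he i)
    (fun a c x hx => (h.levi_civita hU he hx a c).2 i) hx a b c
  have h2 := (h.hasTanDeriv_nablaCoframe hU he hx i a b c).eq
  have h3 := (h.hasTanDeriv_nablaCoframe hU he hx i b a c).eq
  rw [← dirDeriv_eq] at h2 h3
  rw [h2, h3] at h1
  have h4 : ∑ m, structFn g e a b m x * nablaCoframe κ p e i m c x =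
      ∑ m, connFn g e a b m x * nablaCoframe κ p e i m c x
      - ∑ m, connFn g e b a m x * nablaCoframe κ p e i m c x := by
    rw [← Finset.sum_sub_distrib]
    exact Finset.sum_congr rfl fun m _ => by rw [← connFn_torsion a b m x]; ring
  rw [Finset.sum_add_distrib, Finset.sum_sub_distrib, h4] at h1
  have hF : confFactor κ p x = 1 + κ / 4 * ∑ i, p i x ^ 2 := rfl
  have h5 := projForm_comm (κ := κ) (p := p) (e := e) a b x
  have h6 : nablaCoframe κ p e i a b x - nablaCoframe κ p e i b a x = κ / 2 * (coframe κ p e i a x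
    * radialForm κ p e b x - coframe κ p e i b x * radialForm κ p e a x) := by
    simp only [nablaCoframe, h5]; ring
  rw [hF] at h1
  linear_combination h1 - κ / 2 * radialForm κ p e c x * h6

/-- The Ricci identity for the parallel form `dr`. -/
theorem riemann_fst (h : IsProductChartOn g κ U r p) (hU : IsOpen U)
    (he : IsOrthonormalFrameOn g U e) {x : M} (hx : x ∈ U) (a b c : Fin 4) :
    ∑ l, riemann g e a b c l x * dirDeriv (e l) r x = 0 := by
  have h1 := ricci_identity he hU (h.smooth_connFn hU he) (w := fun a => dirDeriv (e a) r)
    (η := fun _ _ _ => 0) (he.smooth_dirDeriv hU h.smooth_fst) (fun _ _ => contMDiffOn_const)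
    (fun a c x hx => by rw [(h.levi_civita hU he hx a c).1, zero_add]) hx a b c
  simp only [dirDeriv_const, mul_zero, sub_zero, add_zero, Finset.sum_const_zero, zero_sub] at h1
  linarith

theorem riemann_eq (h : IsProductChartOn g κ U r p) (hU : IsOpen U)
    (he : IsOrthonormalFrameOn g U e) {x : M} (hx : x ∈ U) (a b c d : Fin 4) :
    riemann g e a b c d x = κ * (projForm κ p e a d x * projForm κ p e b c x
      - projForm κ p e b d x * projForm κ p e a c x) := by
  have h1 : riemann g e a b c d x = ∑ l, riemann g e a b c l x *
      (dirDeriv (e l) r x * dirDeriv (e d) r x + projForm κ p e l d x) := by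
    simp [h.orthonormal he hx]
  have h2 : ∑ l, riemann g e a b c l x *
      (dirDeriv (e l) r x * dirDeriv (e d) r x + projForm κ p e l d x) =
      (∑ l, riemann g e a b c l x * dirDeriv (e l) r x) * dirDeriv (e d) r x
      + ∑ i, (∑ l, riemann g e a b c l x * coframe κ p e i l x) * coframe κ p e i d x := by
    simp only [projForm, Fin.sum_univ_three, Fin.sum_univ_four]
    ring
  rw [h1, h2, h.riemann_fst hU he hx]
  simp only [h.riemann_coframe hU he hx]
  generalize projForm κ p e b c x = A
  generalize projForm κ p e a c x = B
  simp only [projForm, Fin.sum_univ_three]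
  ring

/-- `dr` has unit length: the components of `dr, θᵢ` form a square matrix with orthonormal columns,
hence with orthonormal rows. -/
theorem sum_dirDeriv_fst_sq (h : IsProductChartOn g κ U r p) (he : IsOrthonormalFrameOn g U e)
    {x : M} (hx : x ∈ U) : ∑ i, dirDeriv (e i) r x ^ 2 = 1 := by
  let Θ : Matrix (Option (Fin 3)) (Fin 4) ℝ := Matrix.of fun α a =>
    α.elim (dirDeriv (e a) r x) (fun i => coframe κ p e i a x)
  have h1 : Θ.transpose * Θ = 1 := by
    ext a b
    rw [Matrix.mul_apply, Fintype.sum_option, Matrix.one_apply]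
    exact h.orthonormal he hx a b
  have h2 := (Matrix.mul_eq_one_comm_of_card_eq _ _ _ (by simp)).1 h1
  have h3 := congrFun (congrFun h2 none) none
  rw [Matrix.mul_apply, Matrix.one_apply_eq] at h3
  simp only [pow_two]
  exact h3

theorem sum_projForm_self (h : IsProductChartOn g κ U r p) (he : IsOrthonormalFrameOn g U e)
    {x : M} (hx : x ∈ U) : ∑ i, projForm κ p e i i x = 3 := by
  have h1 := h.sum_dirDeriv_fst_sq he hx
  simp only [h.projForm_eq he hx, if_true, Finset.sum_sub_distrib, ← pow_two, h1]
  norm_num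

theorem sum_projForm_mul (h : IsProductChartOn g κ U r p) (he : IsOrthonormalFrameOn g U e)
    {x : M} (hx : x ∈ U) (a b : Fin 4) :
    ∑ i, projForm κ p e a i x * projForm κ p e i b x = projForm κ p e a b x := by
  have h1 := h.sum_dirDeriv_fst_sq he hx
  have h2 : ∑ i, dirDeriv (e a) r x * dirDeriv (e i) r x * (dirDeriv (e i) r x * dirDeriv (e b) r x)
      = dirDeriv (e a) r x * dirDeriv (e b) r x := by
    calc _ = dirDeriv (e a) r x * dirDeriv (e b) r x * ∑ i, dirDeriv (e i) r x ^ 2 := by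
          rw [Finset.mul_sum]; exact Finset.sum_congr rfl fun _ _ => by ring
      _ = _ := by rw [h1, mul_one]
  simp only [h.projForm_eq he hx, sub_mul, mul_sub, Finset.sum_sub_distrib, h2]
  simp

theorem ricci_eq (h : IsProductChartOn g κ U r p) (hU : IsOpen U)
    (he : IsOrthonormalFrameOn g U e) {x : M} (hx : x ∈ U) (a b : Fin 4) :
    ricci g e a b x = 2 * κ * projForm κ p e a b x := by
  simp only [ricci, h.riemann_eq hU he hx]
  rw [← Finset.mul_sum, Finset.sum_sub_distrib, ← Finset.sum_mul, h.sum_projForm_self he hx,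
    h.sum_projForm_mul he hx]
  ring

theorem scalarCurv_eq (h : IsProductChartOn g κ U r p) (hU : IsOpen U)
    (he : IsOrthonormalFrameOn g U e) {x : M} (hx : x ∈ U) : scalarCurv g e x = 6 * κ := by
  simp only [scalarCurv, h.ricci_eq hU he hx]
  rw [← Finset.mul_sum, h.sum_projForm_self he hx]
  ring

theorem ricciNormSq_eq (h : IsProductChartOn g κ U r p) (hU : IsOpen U)
    (he : IsOrthonormalFrameOn g U e) {x : M} (hx : x ∈ U) : ricciNormSq g e x = 12 * κ ^ 2 := by
  have h1 : ∀ i j, ricci g e i j x ^ 2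
      = 4 * κ ^ 2 * (projForm κ p e i j x * projForm κ p e j i x) := by
    intro i j
    rw [h.ricci_eq hU he hx, projForm_comm j i]; ring
  simp only [ricciNormSq, h1, ← Finset.mul_sum, h.sum_projForm_mul he hx,
    h.sum_projForm_self he hx]
  ring

theorem riemannRicci_eq (h : IsProductChartOn g κ U r p) (hU : IsOpen U)
    (he : IsOrthonormalFrameOn g U e) {x : M} (hx : x ∈ U) (a b : Fin 4) :
    riemannRicci g e a b x = 4 * κ ^ 2 * projForm κ p e a b x := by
  have h1 : ∀ k l, riemann g e a k l b x * ricci g e k l x = 2 * κ ^ 2 *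
      (projForm κ p e a b x * (projForm κ p e k l x * projForm κ p e l k x)
        - projForm κ p e k b x * (projForm κ p e a l x * projForm κ p e l k x)) := by
    intro k l
    rw [h.riemann_eq hU he hx, h.ricci_eq hU he hx, projForm_comm l k]; ring
  simp only [riemannRicci, h1, ← Finset.mul_sum, Finset.sum_sub_distrib, h.sum_projForm_mul he hx,
    h.sum_projForm_self he hx]
  have h2 : ∑ k, projForm κ p e k b x * projForm κ p e a k x = projForm κ p e a b x := by
    rw [← h.sum_projForm_mul he hx a b]
    exact Finset.sum_congr rfl fun _ _ => by ring
  rw [h2]; ring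

/-- `ρ = 2κP`, and `P = ∑ θᵢ ⊗ θᵢ` is parallel because the connection form is skew. -/
theorem nablaRicci_eq (h : IsProductChartOn g κ U r p) (hU : IsOpen U)
    (he : IsOrthonormalFrameOn g U e) {x : M} (hx : x ∈ U) (a b c : Fin 4) :
    nablaRicci g e a b c x = 0 := by
  have h1 : dirDeriv (e a) (ricci g e b c) x = _ :=
    (dirDeriv_congr hU (fun y hy => h.ricci_eq hU he hy b c) hx).trans
      ((h.hasTanDeriv_projForm hU he hx a b c).const_mul (2 * κ)).eq
  rw [nablaRicci, h1]
  simp only [h.ricci_eq hU he hx, Fin.sum_univ_four]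
  ring

theorem laplaceRicci_eq (h : IsProductChartOn g κ U r p) (hU : IsOpen U)
    (he : IsOrthonormalFrameOn g U e) {x : M} (hx : x ∈ U) (a b : Fin 4) :
    laplaceRicci g e a b x = 0 := by
  have h1 : ∀ d a b c, dirDeriv (e d) (nablaRicci g e a b c) x = 0 := fun d a b c =>
    (dirDeriv_congr hU (fun y hy => h.nablaRicci_eq hU he hy a b c) hx).trans
      (dirDeriv_const _ 0 x)
  simp [laplaceRicci, nabla2Ricci, h1, h.nablaRicci_eq hU he hx]

theorem hessScalar_eq (h : IsProductChartOn g κ U r p) (hU : IsOpen U)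
    (he : IsOrthonormalFrameOn g U e) {x : M} (hx : x ∈ U) (a b : Fin 4) :
    hessScalar g e a b x = 0 := by
  have h1 : ∀ d, ∀ y ∈ U, dirDeriv (e d) (scalarCurv g e) y = 0 := fun d y hy =>
    (dirDeriv_congr hU (fun y hy => h.scalarCurv_eq hU he hy) hy).trans (dirDeriv_const _ (6 * κ) y)
  have h2 : ∀ d c, dirDeriv (e d) (dirDeriv (e c) (scalarCurv g e)) x = 0 := fun d c =>
    (dirDeriv_congr hU (fun y hy => h1 c y hy) hx).trans (dirDeriv_const _ 0 x)
  simp [hessScalar, h1 _ x hx, h2]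

theorem eulerLagrange_eq (h : IsProductChartOn g κ U r p) (hU : IsOpen U)
    (he : IsOrthonormalFrameOn g U e) {x : M} (hx : x ∈ U) (t : ℝ) (a b : Fin 4) :
    eulerLagrange g e t a b x = (6 + 18 * t) * κ ^ 2 * (if a = b then 1 else 0)
      - (8 + 24 * t) * κ ^ 2 * projForm κ p e a b x := by
  simp only [eulerLagrange, laplaceScalar, h.laplaceRicci_eq hU he hx, h.hessScalar_eq hU he hx,
    h.ricciNormSq_eq hU he hx, h.scalarCurv_eq hU he hx, h.riemannRicci_eq hU he hx,
    h.ricci_eq hU he hx, Finset.sum_const_zero]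
  push_cast
  ring

end IsProductChartOn

/-! ### Criticality of local products -/

section LocallyIsometric

variable {M : Type*} [TopologicalSpace M]
  [ChartedSpace (EuclideanSpace ℝ (Fin 4)) M] [IsManifold (𝓡 4) ∞ M]
  {g : SmoothMetric 4 M} {κ : ℝ} {U : Set M} {e : Fin 4 → (x : M) → TangentSpace (𝓡 4) x}

theorem IsLocallyIsometricToProduct.exists_chart (h : IsLocallyIsometricToProduct g κ) (x : M) :
    ∃ (W : Set M) (r : M → ℝ) (p : Fin 3 → M → ℝ), IsOpen W ∧ x ∈ W ∧
      IsProductChartOn g κ W r p := by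
  obtain ⟨W, r, p, hW, hx, hr, hp, hm⟩ := h x
  have hn : ∀ v : EuclideanSpace ℝ (Fin 3), ‖v‖ ^ 2 = ∑ i, v i ^ 2 := fun v => by
    rw [EuclideanSpace.norm_sq_eq]; simp
  have hd : ∀ y ∈ W, ∀ i (v : TangentSpace (𝓡 4) y),
      tanDeriv (fun z => p z i) y v = (tanDeriv p y v) i := fun y hy i v =>
    tanDeriv_clm (EuclideanSpace.proj i : EuclideanSpace ℝ (Fin 3) →L[ℝ] ℝ)
      (hp.mdifferentiableAt_of_isOpen hW hy) v
  refine ⟨W, r, fun i y => p y i, hW, hx, hr, fun i =>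
    (EuclideanSpace.proj i : EuclideanSpace ℝ (Fin 3) →L[ℝ] ℝ).contMDiff.comp_contMDiffOn hp,
    fun y hy => ?_, fun y hy v => ?_⟩
  · have := (hm y hy).1
    rwa [hn] at this
  · have h1 := (hm y hy).2 v
    simp only [hd y hy]
    rw [← hn, ← hn]
    exact h1.trans rfl

theorem IsProductChartOn.isLocallyIsometric (h : ∀ x : M, ∃ (W : Set M) (r : M → ℝ)
    (p : Fin 3 → M → ℝ), IsOpen W ∧ x ∈ W ∧ IsProductChartOn g κ W r p) :
    IsLocallyIsometricToProduct g κ := by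
  intro x
  obtain ⟨W, r, p, hW, hx, hc⟩ := h x
  have hn : ∀ v : EuclideanSpace ℝ (Fin 3), ‖v‖ ^ 2 = ∑ i, v i ^ 2 := fun v => by
    rw [EuclideanSpace.norm_sq_eq]; simp
  let P : M → EuclideanSpace ℝ (Fin 3) := fun y => WithLp.toLp 2 fun i => p i y
  have hP : ContMDiffOn (𝓡 4) (𝓡 3) ∞ P W := by
    have h1 : ContMDiffOn (𝓡 4) 𝓘(ℝ, Fin 3 → ℝ) ∞ (fun y i => p i y) W :=
      contMDiffOn_pi_space.2 hc.smooth_snd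
    exact (EuclideanSpace.equiv (Fin 3) ℝ).symm.contDiff.contMDiff.comp_contMDiffOn h1
  have hd : ∀ y ∈ W, ∀ i (v : TangentSpace (𝓡 4) y),
      tanDeriv (p i) y v = (tanDeriv P y v) i := fun y hy i v =>
    tanDeriv_clm (EuclideanSpace.proj i : EuclideanSpace ℝ (Fin 3) →L[ℝ] ℝ)
      (hP.mdifferentiableAt_of_isOpen hW hy) v
  refine ⟨W, r, P, hW, hx, hc.smooth_fst, hP, fun y hy => ⟨?_, fun v => ?_⟩⟩
  · rw [hn]; exact hc.pos y hy
  · rw [hc.metric y hy v]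
    simp only [hd y hy]
    rw [← hn]
    have : 1 + κ / 4 * ∑ i, p i y ^ 2 = 1 + κ / 4 * ‖P y‖ ^ 2 := by rw [hn]
    rw [this]
    rfl

/-- Of the chart only the unit covector `u = dr` survives; the frame is restricted to the domain of
the chart, and all quantities are local. -/
theorem IsLocallyIsometricToProduct.eulerLagrange_eq (h : IsLocallyIsometricToProduct g κ)
    (hU : IsOpen U) (he : IsOrthonormalFrameOn g U e) {x : M} (hx : x ∈ U) :
    scalarCurv g e x = 6 * κ ∧ ∃ u : Fin 4 → ℝ, ∑ i, u i ^ 2 = 1 ∧ ∀ t i j,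
      eulerLagrange g e t i j x = (6 + 18 * t) * κ ^ 2 * (if i = j then 1 else 0)
        - (8 + 24 * t) * κ ^ 2 * ((if i = j then 1 else 0) - u i * u j) := by
  obtain ⟨W, r, p, hW, hxW, hc⟩ := h.exists_chart x
  have hUW := hU.inter hW
  have hc' := hc.mono (Set.inter_subset_right : U ∩ W ⊆ W)
  have he' := he.mono (Set.inter_subset_left : U ∩ W ⊆ U)
  have hx' : x ∈ U ∩ W := ⟨hx, hxW⟩
  refine ⟨hc'.scalarCurv_eq hUW he' hx', fun i => dirDeriv (e i) r x,
    hc'.sum_dirDeriv_fst_sq he' hx', fun t i j => ?_⟩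
  rw [hc'.eulerLagrange_eq hUW he' hx', hc'.projForm_eq he' hx']

theorem IsLocallyIsometricToProduct.isCritical (h : IsLocallyIsometricToProduct g κ) :
    IsCritical g (-1 / 3) := by
  intro U e hU he x hx i j
  obtain ⟨-, u, -, hEL⟩ := h.eulerLagrange_eq hU he hx
  rw [hEL]; ring

/-- Contracted with `u`, the projection term drops out and `(6 + 18t) κ² u = 0` remains, with `u` a
unit covector. -/
theorem IsLocallyIsometricToProduct.eq_of_isCritical (h : IsLocallyIsometricToProduct g κ)
    (hκ : κ ≠ 0) (hU : IsOpen U) (he : IsOrthonormalFrameOn g U e) {x : M} (hx : x ∈ U) {t : ℝ}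
    (ht : IsCritical g t) : t = -1 / 3 := by
  obtain ⟨-, u, hu, hEL⟩ := h.eulerLagrange_eq hU he hx
  have h1 : ∀ i j, _ = (0 : ℝ) := fun i j => (hEL t i j).symm.trans (ht U e hU he x hx i j)
  have h2 : ∀ i, (6 + 18 * t) * κ ^ 2 * u i = 0 := by
    intro i
    have h3 : ∑ j, u j * ((6 + 18 * t) * κ ^ 2 * (if i = j then 1 else 0)
        - (8 + 24 * t) * κ ^ 2 * ((if i = j then 1 else 0) - u i * u j)) = 0 :=
      Finset.sum_eq_zero fun j _ => by rw [h1 i j, mul_zero]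
    have h4 : ∀ j, u j * ((6 + 18 * t) * κ ^ 2 * (if i = j then 1 else 0)
        - (8 + 24 * t) * κ ^ 2 * ((if i = j then 1 else 0) - u i * u j)) =
        (if i = j then -((2 + 6 * t) * κ ^ 2 * u j) else 0)
          + (8 + 24 * t) * κ ^ 2 * u i * u j ^ 2 := by
      intro j
      split_ifs <;> ring
    simp only [h4, Finset.sum_add_distrib, ← Finset.mul_sum, hu, Finset.sum_ite_eq,
      Finset.mem_univ, if_true] at h3
    linear_combination h3
  by_contra hne
  have h5 : ∀ i, u i = 0 := fun i => by
    have h6 : (6 + 18 * t) ≠ 0 := fun h0 => hne (by linarith)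
    simpa [h6, hκ] using h2 i
  simp [h5] at hu

end LocallyIsometric

/-! ### Left-invariant fields and frames -/

section LeftInvariant

variable {G : Type*} [TopologicalSpace G] [ChartedSpace (EuclideanSpace ℝ (Fin 4)) G] [Group G]
  [LieGroup (𝓡 4) ∞ G]

instance lieGroup_minSmoothness : LieGroup (𝓡 4) (minSmoothness ℝ 3) G := by
  rw [minSmoothness_of_isRCLikeNormedField]
  infer_instance

/-- The field at `x` is the derivative of multiplication at `(x, 1)` applied to `(0, v)`, a
composition of smooth maps of tangent bundles. -/
theorem contMDiff_infty_mulInvariantVectorField (v : GroupLieAlgebra (𝓡 4) G) :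
    ContMDiff (𝓡 4) (𝓡 4).tangent ∞
      (fun x => (⟨x, mulInvariantVectorField v x⟩ : TangentBundle (𝓡 4) G)) := by
  let fg : G → TangentBundle (𝓡 4) G := fun g => TotalSpace.mk' (EuclideanSpace ℝ (Fin 4)) g 0
  have sfg : ContMDiff (𝓡 4) (𝓡 4).tangent ∞ fg := contMDiff_zeroSection _ _
  let fv : G → TangentBundle (𝓡 4) G := fun _ => TotalSpace.mk' (EuclideanSpace ℝ (Fin 4)) 1 v
  have sfv : ContMDiff (𝓡 4) (𝓡 4).tangent ∞ fv := contMDiff_const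
  let F₂ : (TangentBundle (𝓡 4) G × TangentBundle (𝓡 4) G) →
      TangentBundle ((𝓡 4).prod (𝓡 4)) (G × G) := (equivTangentBundleProd (𝓡 4) G (𝓡 4) G).symm
  have S₂ : ContMDiff ((𝓡 4).tangent.prod (𝓡 4).tangent) ((𝓡 4).prod (𝓡 4)).tangent ∞ F₂ :=
    contMDiff_equivTangentBundleProd_symm
  let F₃ : TangentBundle ((𝓡 4).prod (𝓡 4)) (G × G) → TangentBundle (𝓡 4) G :=
    tangentMap ((𝓡 4).prod (𝓡 4)) (𝓡 4) (fun (p : G × G) => p.1 * p.2)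
  have S₃ : ContMDiff ((𝓡 4).prod (𝓡 4)).tangent (𝓡 4).tangent ∞ F₃ :=
    ContMDiff.contMDiff_tangentMap (n := ∞) (contMDiff_mul (𝓡 4) ∞) (by simp)
  have S := (S₃.comp S₂).comp (sfg.prodMk sfv)
  refine S.congr fun x => ?_
  -- The composition produces a vector over `x * 1`; this transports it to `x`.
  have key : ∀ y : G, y = x → ∀ a b : EuclideanSpace ℝ (Fin 4), a = b →
      (⟨x, a⟩ : TangentBundle (𝓡 4) G) = ⟨y, b⟩ := by
    rintro y rfl a b rfl; rfl
  have h1 := mfderiv_prod_eq_add_apply (I := 𝓡 4) (I' := 𝓡 4) (I'' := 𝓡 4)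
    (f := fun p : G × G => p.1 * p.2) (p := (x, 1)) (v := ((0 : EuclideanSpace ℝ (Fin 4)), v))
    ((contMDiff_mul (𝓡 4) ∞).mdifferentiableAt (by simp))
  refine key _ (mul_one x) _ _ (Eq.trans ?_ h1.symm)
  have h2 : (mfderiv (𝓡 4) (𝓡 4) (fun z : G => z * 1) x :
      EuclideanSpace ℝ (Fin 4) →L[ℝ] EuclideanSpace ℝ (Fin 4)) 0 = 0 := map_zero _
  have h3 : ∀ a b : EuclideanSpace ℝ (Fin 4), a = 0 → b = a + b := by
    rintro a b rfl; rw [zero_add]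
  exact h3 _ _ h2

theorem inner_mulInvariantVectorField {g : SmoothMetric 4 G} (hg : IsLeftInvariant g) (x : G)
    (v w : GroupLieAlgebra (𝓡 4) G) :
    g.inner x (mulInvariantVectorField v x) (mulInvariantVectorField w x) = g.inner 1 v w := by
  have h1 : ∀ y : G, y = x → ∀ a b : EuclideanSpace ℝ (Fin 4),
      (g.inner y : EuclideanSpace ℝ (Fin 4) →L[ℝ] EuclideanSpace ℝ (Fin 4) →L[ℝ] ℝ) a b
      = (g.inner x : EuclideanSpace ℝ (Fin 4) →L[ℝ] EuclideanSpace ℝ (Fin 4) →L[ℝ] ℝ) a b := by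
    rintro y rfl a b; rfl
  exact (h1 (x * 1) (mul_one x) _ _).symm.trans (hg x 1 v w)

variable {g : SmoothMetric 4 G} {f : Fin 4 → GroupLieAlgebra (𝓡 4) G}

theorem isOrthonormalFrameOn_mulInvariantVectorField (hg : IsLeftInvariant g)
    (hf : ∀ i j, g.inner 1 (f i) (f j) = if i = j then 1 else 0) :
    IsOrthonormalFrameOn g Set.univ fun i => mulInvariantVectorField (f i) :=
  ⟨fun i => (contMDiff_infty_mulInvariantVectorField (f i)).contMDiffOn, fun x _ i j => by
    rw [inner_mulInvariantVectorField hg, hf]⟩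

theorem structFn_mulInvariantVectorField (hg : IsLeftInvariant g) (i j k : Fin 4) :
    structFn g (fun i => mulInvariantVectorField (f i)) i j k
      = fun _ => g.inner 1 ⁅f i, f j⁆ (f k) := by
  funext x
  rw [← inner_mulInvariantVectorField hg x, GroupLieAlgebra.bracket_def,
    mulInvariantVector_mlieBracket]
  rfl

end LeftInvariant

/-! ### Curvature in terms of structure constants -/

section StructureConstants

variable {n : ℕ} (c : Fin n → Fin n → Fin n → ℝ)

/-- The connection coefficients of a left-invariant frame with structure constants `c`. -/
def algConn (i j k : Fin n) : ℝ := (c i j k - c j k i + c k i j) / 2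

/-- The curvature tensor of a left-invariant frame with structure constants `c`. -/
def algRiemann (i j k l : Fin n) : ℝ :=
  ∑ m, (algConn c j k m * algConn c i m l - algConn c i k m * algConn c j m l
    - c i j m * algConn c m k l)

/-- The Ricci tensor of a left-invariant frame with structure constants `c`. -/
def algRicci (i j : Fin n) : ℝ := ∑ a, algRiemann c a i j a

/-- The scalar curvature of a left-invariant frame with structure constants `c`. -/
def algScalar : ℝ := ∑ i, algRicci c i i

/-- The squared norm of the Ricci tensor. -/
def algRicciNormSq : ℝ := ∑ i, ∑ j, algRicci c i j ^ 2

/-- The covariant derivative of the Ricci tensor. -/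
def algNablaRicci (a i j : Fin n) : ℝ :=
  - ∑ m, (algConn c a i m * algRicci c m j + algConn c a j m * algRicci c i m)

/-- The Laplacian of the Ricci tensor. -/
def algLaplaceRicci (i j : Fin n) : ℝ :=
  - ∑ a, ∑ m, (algConn c a a m * algNablaRicci c m i j + algConn c a i m * algNablaRicci c a m j
      + algConn c a j m * algNablaRicci c a i m)

/-- The contraction `R[ρ]`. -/
def algRiemannRicci (i j : Fin n) : ℝ := ∑ k, ∑ l, algRiemann c i k l j * algRicci c k l

/-- The Euler-Lagrange tensor of a left-invariant frame with structure constants `c`. -/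
def algEL (t : ℝ) (i j : Fin n) : ℝ :=
  - algLaplaceRicci c i j
    + 2 / n * (algRicciNormSq c + t * algScalar c ^ 2) * (if i = j then 1 else 0)
    - 2 * algRiemannRicci c i j - 2 * t * algScalar c * algRicci c i j

variable {M : Type*} [TopologicalSpace M] [ChartedSpace (EuclideanSpace ℝ (Fin n)) M]
  [IsManifold (𝓡 n) ∞ M] {g : SmoothMetric n M}
  {e : Fin n → (x : M) → TangentSpace (𝓡 n) x} {c}

theorem connFn_of_const (hc : ∀ i j k, structFn g e i j k = fun _ => c i j k) (i j k : Fin n) :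
    connFn g e i j k = fun _ => algConn c i j k := by
  funext x
  simp only [connFn, hc, algConn]

theorem riemann_of_const (hc : ∀ i j k, structFn g e i j k = fun _ => c i j k) (i j k l : Fin n) :
    riemann g e i j k l = fun _ => algRiemann c i j k l := by
  funext x
  simp only [riemann, hc, connFn_of_const hc, dirDeriv_const, algRiemann]
  ring

theorem ricci_of_const (hc : ∀ i j k, structFn g e i j k = fun _ => c i j k) (i j : Fin n) :
    ricci g e i j = fun _ => algRicci c i j := by
  funext x
  simp only [ricci, riemann_of_const hc, algRicci]

theorem scalarCurv_of_const (hc : ∀ i j k, structFn g e i j k = fun _ => c i j k) :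
    scalarCurv g e = fun _ => algScalar c := by
  funext x
  simp only [scalarCurv, ricci_of_const hc, algScalar]

theorem nablaRicci_of_const (hc : ∀ i j k, structFn g e i j k = fun _ => c i j k)
    (a i j : Fin n) : nablaRicci g e a i j = fun _ => algNablaRicci c a i j := by
  funext x
  simp only [nablaRicci, ricci_of_const hc, connFn_of_const hc, dirDeriv_const, algNablaRicci,
    zero_sub]

/-- Derivatives of constant coefficients vanish, and so does every term with `∇²τ` or `Δτ`; the
equation becomes polynomial in `c`. -/
theorem eulerLagrange_of_const (hc : ∀ i j k, structFn g e i j k = fun _ => c i j k) (t : ℝ)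
    (i j : Fin n) (x : M) : eulerLagrange g e t i j x = algEL c t i j := by
  have h1 : laplaceRicci g e i j x = algLaplaceRicci c i j := by
    simp only [laplaceRicci, nabla2Ricci, nablaRicci_of_const hc, connFn_of_const hc,
      dirDeriv_const, algLaplaceRicci, zero_sub, Finset.sum_neg_distrib]
  have h2 : ∀ i j, hessScalar g e i j x = 0 := fun i j => by
    have h3 : ∀ k, dirDeriv (e k) (fun _ : M => algScalar c) = fun _ => 0 := fun k => by
      funext y; exact dirDeriv_const _ _ y
    simp only [hessScalar, scalarCurv_of_const hc, h3, dirDeriv_const, mul_zero,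
      Finset.sum_const_zero, sub_zero]
  simp only [eulerLagrange, h1, h2, laplaceScalar, ricciNormSq, riemannRicci,
    ricci_of_const hc, riemann_of_const hc, scalarCurv_of_const hc, algEL, algRicciNormSq,
    algRiemannRicci, Finset.sum_const_zero]
  ring

end StructureConstants

/-! ### Connection and Ricci tensor in a frame containing a central vector -/

section CentralAlgebra

/-- The structure constants of an orthonormal basis `f₀, f₁, f₂, ζ` with `ζ` central,
`[f₁, f₂] = a f₀ + x ζ`, `[f₂, f₀] = b f₁ + y ζ` and `[f₀, f₁] = c f₂ + z ζ`. -/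
def centralStruct (a b c x y z : ℝ) : Fin 4 → Fin 4 → Fin 4 → ℝ :=
  ![![![0, 0, 0, 0],
      ![0, 0, c, z],
      ![0, -b, 0, -y],
      ![0, 0, 0, 0]],
    ![![0, 0, -c, -z],
      ![0, 0, 0, 0],
      ![a, 0, 0, x],
      ![0, 0, 0, 0]],
    ![![0, b, 0, y],
      ![-a, 0, 0, -x],
      ![0, 0, 0, 0],
      ![0, 0, 0, 0]],
    ![![0, 0, 0, 0],
      ![0, 0, 0, 0],
      ![0, 0, 0, 0],
      ![0, 0, 0, 0]]]

/-- The connection coefficients for `centralStruct`. -/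
def centralConn (a b c x y z : ℝ) : Fin 4 → Fin 4 → Fin 4 → ℝ :=
  ![![![0, 0, 0, 0],
      ![0, 0, (-a + b + c) / 2, z / 2],
      ![0, (a - b - c) / 2, 0, (-y) / 2],
      ![0, (-z) / 2, y / 2, 0]],
    ![![0, 0, (-a + b - c) / 2, (-z) / 2],
      ![0, 0, 0, 0],
      ![(a - b + c) / 2, 0, 0, x / 2],
      ![z / 2, 0, (-x) / 2, 0]],
    ![![0, (a + b - c) / 2, 0, y / 2],
      ![(-a - b + c) / 2, 0, 0, (-x) / 2],
      ![0, 0, 0, 0],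
      ![(-y) / 2, x / 2, 0, 0]],
    ![![0, (-z) / 2, y / 2, 0],
      ![z / 2, 0, (-x) / 2, 0],
      ![(-y) / 2, x / 2, 0, 0],
      ![0, 0, 0, 0]]]

/-- The Ricci tensor for `centralStruct`. -/
def centralRicci (a b c x y z : ℝ) : Fin 4 → Fin 4 → ℝ :=
  ![![(a ^ 2 - b ^ 2 + 2 * b * c - c ^ 2 - y ^ 2 - z ^ 2) / 2, x * y / 2, x * z / 2, a * x / 2],
      ![x * y / 2, (-a ^ 2 + 2 * a * c + b ^ 2 - c ^ 2 - x ^ 2 - z ^ 2) / 2, y * z / 2, b * y / 2],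
      ![x * z / 2, y * z / 2, (-a ^ 2 + 2 * a * b - b ^ 2 + c ^ 2 - x ^ 2 - y ^ 2) / 2, c * z / 2],
      ![a * x / 2, b * y / 2, c * z / 2, (x ^ 2 + y ^ 2 + z ^ 2) / 2]]

set_option maxHeartbeats 2000000 in
/-- The covariant derivative of the Ricci tensor for `centralStruct`. -/
def centralNabla (a b c x y z : ℝ) : Fin 4 → Fin 4 → Fin 4 → ℝ :=
  ![![![0, (-b * x * z - c * x * z) / 4, (b * x * y + c * x * y) / 4, 0],
      ![(-b * x * z - c * x * z) / 4, (a * y * z - 2 * b * y * z - c * y * z) / 2, (2 * a ^ 2 * b - 2 * a ^ 2 * c - 4 * a * b ^ 2 + 4 * a * c ^ 2 - a * y ^ 2 + a * z ^ 2 + 2 * b ^ 3 + 2 * b ^ 2 * c - 2 * b * c ^ 2 + 2 * b * y ^ 2 - b * z ^ 2 - 2 * c ^ 3 + c * y ^ 2 - 2 * c * z ^ 2) / 4, (-a ^ 2 * z + 3 * a * c * z + b ^ 2 * z - b * c * z - 2 * c ^ 2 * z - 2 * x ^ 2 * z - 2 * y ^ 2 * z - 2 * z ^ 3) / 4],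
      ![(b * x * y + c * x * y) / 4, (2 * a ^ 2 * b - 2 * a ^ 2 * c - 4 * a * b ^ 2 + 4 * a * c ^ 2 - a * y ^ 2 + a * z ^ 2 + 2 * b ^ 3 + 2 * b ^ 2 * c - 2 * b * c ^ 2 + 2 * b * y ^ 2 - b * z ^ 2 - 2 * c ^ 3 + c * y ^ 2 - 2 * c * z ^ 2) / 4, (-a * y * z + b * y * z + 2 * c * y * z) / 2, (a ^ 2 * y - 3 * a * b * y + 2 * b ^ 2 * y + b * c * y - c ^ 2 * y + 2 * x ^ 2 * y + 2 * y ^ 3 + 2 * y * z ^ 2) / 4],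
      ![0, (-a ^ 2 * z + 3 * a * c * z + b ^ 2 * z - b * c * z - 2 * c ^ 2 * z - 2 * x ^ 2 * z - 2 * y ^ 2 * z - 2 * z ^ 3) / 4, (a ^ 2 * y - 3 * a * b * y + 2 * b ^ 2 * y + b * c * y - c ^ 2 * y + 2 * x ^ 2 * y + 2 * y ^ 3 + 2 * y * z ^ 2) / 4, (b * y * z - c * y * z) / 2]],
    ![![(2 * a * x * z - b * x * z + c * x * z) / 2, (a * y * z + c * y * z) / 4, (-2 * a ^ 3 + 4 * a ^ 2 * b - 2 * a ^ 2 * c - 2 * a * b ^ 2 + 2 * a * c ^ 2 - 2 * a * x ^ 2 + a * z ^ 2 + 2 * b ^ 2 * c - 4 * b * c ^ 2 + b * x ^ 2 - b * z ^ 2 + 2 * c ^ 3 - c * x ^ 2 + 2 * c * z ^ 2) / 4, (-a ^ 2 * z + a * c * z + b ^ 2 * z - 3 * b * c * z + 2 * c ^ 2 * z + 2 * x ^ 2 * z + 2 * y ^ 2 * z + 2 * z ^ 3) / 4],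
      ![(a * y * z + c * y * z) / 4, 0, (-a * x * y - c * x * y) / 4, 0],
      ![(-2 * a ^ 3 + 4 * a ^ 2 * b - 2 * a ^ 2 * c - 2 * a * b ^ 2 + 2 * a * c ^ 2 - 2 * a * x ^ 2 + a * z ^ 2 + 2 * b ^ 2 * c - 4 * b * c ^ 2 + b * x ^ 2 - b * z ^ 2 + 2 * c ^ 3 - c * x ^ 2 + 2 * c * z ^ 2) / 4, (-a * x * y - c * x * y) / 4, (-a * x * z + b * x * z - 2 * c * x * z) / 2, (-2 * a ^ 2 * x + 3 * a * b * x - a * c * x - b ^ 2 * x + c ^ 2 * x - 2 * x ^ 3 - 2 * x * y ^ 2 - 2 * x * z ^ 2) / 4],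
      ![(-a ^ 2 * z + a * c * z + b ^ 2 * z - 3 * b * c * z + 2 * c ^ 2 * z + 2 * x ^ 2 * z + 2 * y ^ 2 * z + 2 * z ^ 3) / 4, 0, (-2 * a ^ 2 * x + 3 * a * b * x - a * c * x - b ^ 2 * x + c ^ 2 * x - 2 * x ^ 3 - 2 * x * y ^ 2 - 2 * x * z ^ 2) / 4, (-a * x * z + c * x * z) / 2]],
    ![![(-2 * a * x * y - b * x * y + c * x * y) / 2, (2 * a ^ 3 + 2 * a ^ 2 * b - 4 * a ^ 2 * c - 2 * a * b ^ 2 + 2 * a * c ^ 2 + 2 * a * x ^ 2 - a * y ^ 2 - 2 * b ^ 3 + 4 * b ^ 2 * c - 2 * b * c ^ 2 + b * x ^ 2 - 2 * b * y ^ 2 - c * x ^ 2 + c * y ^ 2) / 4, (-a * y * z - b * y * z) / 4, (a ^ 2 * y - a * b * y - 2 * b ^ 2 * y + 3 * b * c * y - c ^ 2 * y - 2 * x ^ 2 * y - 2 * y ^ 3 - 2 * y * z ^ 2) / 4],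
      ![(2 * a ^ 3 + 2 * a ^ 2 * b - 4 * a ^ 2 * c - 2 * a * b ^ 2 + 2 * a * c ^ 2 + 2 * a * x ^ 2 - a * y ^ 2 - 2 * b ^ 3 + 4 * b ^ 2 * c - 2 * b * c ^ 2 + b * x ^ 2 - 2 * b * y ^ 2 - c * x ^ 2 + c * y ^ 2) / 4, (a * x * y + 2 * b * x * y - c * x * y) / 2, (a * x * z + b * x * z) / 4, (2 * a ^ 2 * x + a * b * x - 3 * a * c * x - b ^ 2 * x + c ^ 2 * x + 2 * x ^ 3 + 2 * x * y ^ 2 + 2 * x * z ^ 2) / 4],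
      ![(-a * y * z - b * y * z) / 4, (a * x * z + b * x * z) / 4, 0, 0],
      ![(a ^ 2 * y - a * b * y - 2 * b ^ 2 * y + 3 * b * c * y - c ^ 2 * y - 2 * x ^ 2 * y - 2 * y ^ 3 - 2 * y * z ^ 2) / 4, (2 * a ^ 2 * x + a * b * x - 3 * a * c * x - b ^ 2 * x + c ^ 2 * x + 2 * x ^ 3 + 2 * x * y ^ 2 + 2 * x * z ^ 2) / 4, 0, (a * x * y - b * x * y) / 2]],
    ![![0, (-a ^ 2 * z + a * c * z + b ^ 2 * z - b * c * z) / 2, (a ^ 2 * y - a * b * y + b * c * y - c ^ 2 * y) / 2, (b * y * z - c * y * z) / 4],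
      ![(-a ^ 2 * z + a * c * z + b ^ 2 * z - b * c * z) / 2, 0, (a * b * x - a * c * x - b ^ 2 * x + c ^ 2 * x) / 2, (-a * x * z + c * x * z) / 4],
      ![(a ^ 2 * y - a * b * y + b * c * y - c ^ 2 * y) / 2, (a * b * x - a * c * x - b ^ 2 * x + c ^ 2 * x) / 2, 0, (a * x * y - b * x * y) / 4],
      ![(b * y * z - c * y * z) / 4, (-a * x * z + c * x * z) / 4, (a * x * y - b * x * y) / 4, 0]]]

variable (a b c x y z t : ℝ)

theorem algConn_centralStruct (i j k : Fin 4) :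
    algConn (centralStruct a b c x y z) i j k = centralConn a b c x y z i j k := by
  fin_cases i <;> fin_cases j <;> fin_cases k <;>
    simp [algConn, centralStruct, centralConn] <;> ring

theorem algRicci_centralStruct (i j : Fin 4) :
    algRicci (centralStruct a b c x y z) i j = centralRicci a b c x y z i j := by
  simp only [algRicci, algRiemann, algConn_centralStruct, Fin.sum_univ_four]
  fin_cases i <;> fin_cases j <;> simp [centralStruct, centralConn, centralRicci] <;> ring

set_option maxHeartbeats 2000000 in
theorem algNablaRicci_centralStruct (i j k : Fin 4) :
    algNablaRicci (centralStruct a b c x y z) i j k = centralNabla a b c x y z i j k := by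
  simp only [algNablaRicci, algConn_centralStruct, algRicci_centralStruct, Fin.sum_univ_four]
  fin_cases i <;> fin_cases j <;> fin_cases k <;>
    simp [centralConn, centralRicci, centralNabla] <;> ring

end CentralAlgebra

/-! ### The Euler-Lagrange tensor as the gradient of the energy -/

section CentralEulerLagrange

/-- Half the partial derivative of `centralEnergy` in `u`; it governs the Euler-Lagrange equation
pairing the first frame field with the centre. -/
def centralGradCentre (t p q r u v w : ℝ) : ℝ :=
  u * (4 * p ^ 2 - 2 * (q - r) ^ 2 - 2 * (2 * (p * q + q * r + r * p) - p ^ 2 - q ^ 2 - r ^ 2)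
    + 6 * (u ^ 2 + v ^ 2 + w ^ 2)
    - 2 * t * (2 * (p * q + q * r + r * p) - p ^ 2 - q ^ 2 - r ^ 2 - (u ^ 2 + v ^ 2 + w ^ 2)))

/-- Half the partial derivative of `centralEnergy` in `p`. -/
def centralGrad (t p q r u v w : ℝ) : ℝ :=
  2 * (p * (p ^ 2 - (q - r) ^ 2) - (p - r) * (q ^ 2 - (r - p) ^ 2)
      - (p - q) * (r ^ 2 - (p - q) ^ 2))
    + 4 * p * u ^ 2 - 2 * (p - r) * v ^ 2 - 2 * (p - q) * w ^ 2
    + (2 * t * (2 * (p * q + q * r + r * p) - p ^ 2 - q ^ 2 - r ^ 2 - (u ^ 2 + v ^ 2 + w ^ 2))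
      - 2 * (u ^ 2 + v ^ 2 + w ^ 2)) * (q + r - p)

/-- Four times `‖ρ‖² + t τ²`. -/
def centralEnergy (t p q r u v w : ℝ) : ℝ :=
  (p ^ 2 - (q - r) ^ 2) ^ 2 + (q ^ 2 - (r - p) ^ 2) ^ 2 + (r ^ 2 - (p - q) ^ 2) ^ 2
    + u ^ 2 * (4 * p ^ 2 - 2 * (q - r) ^ 2) + v ^ 2 * (4 * q ^ 2 - 2 * (r - p) ^ 2)
    + w ^ 2 * (4 * r ^ 2 - 2 * (p - q) ^ 2)
    - 2 * (u ^ 2 + v ^ 2 + w ^ 2) * (2 * (p * q + q * r + r * p) - p ^ 2 - q ^ 2 - r ^ 2)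
    + 3 * (u ^ 2 + v ^ 2 + w ^ 2) ^ 2
    + t * (2 * (p * q + q * r + r * p) - p ^ 2 - q ^ 2 - r ^ 2 - (u ^ 2 + v ^ 2 + w ^ 2)) ^ 2

variable (a b c x y z t : ℝ)

theorem algScalar_centralStruct : algScalar (centralStruct a b c x y z)
    = (2 * (a * b + b * c + c * a) - a ^ 2 - b ^ 2 - c ^ 2 - (x ^ 2 + y ^ 2 + z ^ 2)) / 2 := by
  simp only [algScalar, algRicci_centralStruct, Fin.sum_univ_four]
  simp [centralRicci]
  ring

theorem algRicciNormSq_centralStruct : algRicciNormSq (centralStruct a b c x y z)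
    = centralEnergy 0 a b c x y z / 4 := by
  simp only [algRicciNormSq, algRicci_centralStruct, Fin.sum_univ_four]
  simp [centralRicci, centralEnergy]
  ring

/-- Replacing `f₀` by `f₀ - sζ` moves `x` at rate `a` and fixes the other structure constants, so
this component is a multiple of `a` times the `x`-derivative of the energy. The same principle
underlies the other components; each identity is verified by expansion. -/
theorem algEL_centralStruct_zero_three : algEL (centralStruct a b c x y z) t 0 3
    = a * centralGradCentre t a b c x y z / 4 := by
  simp only [algEL, algLaplaceRicci, algRiemannRicci, algRiemann, algScalar_centralStruct,
    algRicciNormSq_centralStruct, algNablaRicci_centralStruct, algConn_centralStruct,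
    algRicci_centralStruct, Fin.sum_univ_four]
  simp [centralConn, centralRicci, centralNabla, centralStruct, centralGradCentre]
  ring

theorem algEL_centralStruct_one_three : algEL (centralStruct a b c x y z) t 1 3
    = b * centralGradCentre t b c a y z x / 4 := by
  simp only [algEL, algLaplaceRicci, algRiemannRicci, algRiemann, algScalar_centralStruct,
    algRicciNormSq_centralStruct, algNablaRicci_centralStruct, algConn_centralStruct,
    algRicci_centralStruct, Fin.sum_univ_four]
  simp [centralConn, centralRicci, centralNabla, centralStruct, centralGradCentre]
  ring

theorem algEL_centralStruct_two_three : algEL (centralStruct a b c x y z) t 2 3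
    = c * centralGradCentre t c a b z x y / 4 := by
  simp only [algEL, algLaplaceRicci, algRiemannRicci, algRiemann, algScalar_centralStruct,
    algRicciNormSq_centralStruct, algNablaRicci_centralStruct, algConn_centralStruct,
    algRicci_centralStruct, Fin.sum_univ_four]
  simp [centralConn, centralRicci, centralNabla, centralStruct, centralGradCentre]
  ring

/-- Rescaling `ζ` rescales exactly `x, y, z`, inversely. The undifferentiated energy comes from the
multiple of the metric in the equation. -/
theorem algEL_centralStruct_three_three : algEL (centralStruct a b c x y z) t 3 3
    = centralEnergy t a b c x y z / 8
      + (x * centralGradCentre t a b c x y z + y * centralGradCentre t b c a y z x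
        + z * centralGradCentre t c a b z x y) / 4 := by
  simp only [algEL, algLaplaceRicci, algRiemannRicci, algRiemann, algScalar_centralStruct,
    algRicciNormSq_centralStruct, algNablaRicci_centralStruct, algConn_centralStruct,
    algRicci_centralStruct, Fin.sum_univ_four]
  simp [centralConn, centralRicci, centralNabla, centralStruct, centralGradCentre, centralEnergy]
  ring

/-- Rescaling `f₀` by `s` multiplies `b, c, y, z` by `s`, divides `a` by `s` and fixes `x`; this
explains the signs. -/
theorem algEL_centralStruct_zero_zero : algEL (centralStruct a b c x y z) t 0 0
    = centralEnergy t a b c x y z / 8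
      - (b * centralGrad t b c a y z x + c * centralGrad t c a b z x y
        - a * centralGrad t a b c x y z) / 4
      - (y * centralGradCentre t b c a y z x
        + z * centralGradCentre t c a b z x y) / 4 := by
  simp only [algEL, algLaplaceRicci, algRiemannRicci, algRiemann, algScalar_centralStruct,
    algRicciNormSq_centralStruct, algNablaRicci_centralStruct, algConn_centralStruct,
    algRicci_centralStruct, Fin.sum_univ_four]
  simp [centralConn, centralRicci, centralNabla, centralStruct, centralGradCentre, centralGrad, centralEnergy]
  ring

theorem algEL_centralStruct_one_one : algEL (centralStruct a b c x y z) t 1 1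
    = centralEnergy t a b c x y z / 8
      - (c * centralGrad t c a b z x y + a * centralGrad t a b c x y z
        - b * centralGrad t b c a y z x) / 4
      - (z * centralGradCentre t c a b z x y
        + x * centralGradCentre t a b c x y z) / 4 := by
  simp only [algEL, algLaplaceRicci, algRiemannRicci, algRiemann, algScalar_centralStruct,
    algRicciNormSq_centralStruct, algNablaRicci_centralStruct, algConn_centralStruct,
    algRicci_centralStruct, Fin.sum_univ_four]
  simp [centralConn, centralRicci, centralNabla, centralStruct, centralGradCentre, centralGrad, centralEnergy]
  ring

theorem algEL_centralStruct_two_two : algEL (centralStruct a b c x y z) t 2 2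
    = centralEnergy t a b c x y z / 8
      - (a * centralGrad t a b c x y z + b * centralGrad t b c a y z x
        - c * centralGrad t c a b z x y) / 4
      - (x * centralGradCentre t a b c x y z
        + y * centralGradCentre t b c a y z x) / 4 := by
  simp only [algEL, algLaplaceRicci, algRiemannRicci, algRiemann, algScalar_centralStruct,
    algRicciNormSq_centralStruct, algNablaRicci_centralStruct, algConn_centralStruct,
    algRicci_centralStruct, Fin.sum_univ_four]
  simp [centralConn, centralRicci, centralNabla, centralStruct, centralGradCentre, centralGrad, centralEnergy]
  ring

end CentralEulerLagrange

/-! ### Solving the gradient equations -/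

section CentralClassification

/-- The hypotheses are the partial derivatives of half of `q²r² + r²p² + p²q² + t(pq + qr + rp)²`.
None of `p, q, r` can vanish, and the hypotheses form a linear system in `qr + Y`, `rp + Y`, `pq +
Y` with determinant `2pqr`; hence all three vanish and `qr = rp = pq`. -/
theorem eq_of_pairwise_cubic {p q r t : ℝ} (hpq : p + q ≠ 0) (hqr : q + r ≠ 0) (hrp : r + p ≠ 0)
    (h1 : r * (r * p + t * (p * q + q * r + r * p)) + q * (p * q + t * (p * q + q * r + r * p)) = 0)
    (h2 : p * (p * q + t * (p * q + q * r + r * p)) + r * (q * r + t * (p * q + q * r + r * p)) = 0)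
    (h3 : q * (q * r + t * (p * q + q * r + r * p)) + p * (r * p + t * (p * q + q * r + r * p)) = 0) :
    p = q ∧ q = r := by
  have key : ∀ {p q r : ℝ}, p + q ≠ 0 → r + p ≠ 0 → p ≠ 0 ∨ q + r = 0 ∨
      r * (r * p + t * (p * q + q * r + r * p)) + q * (p * q + t * (p * q + q * r + r * p)) ≠ 0 ∨
      p * (p * q + t * (p * q + q * r + r * p)) + r * (q * r + t * (p * q + q * r + r * p)) ≠ 0 := by
    intro p q r hpq hrp
    by_contra! h
    obtain ⟨rfl, h4, h5, h6⟩ := h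
    have hq : q ≠ 0 := by simpa using hpq
    have hr : r ≠ 0 := by simpa using hrp
    have h7 : t * (q * r * (q + r)) = 0 := by linear_combination h5
    have h8 : t = 0 := by
      rcases mul_eq_zero.1 h7 with h | h
      · exact h
      · exact absurd h (mul_ne_zero (mul_ne_zero hq hr) h4)
    subst h8
    have : r * (q * r) = 0 := by linear_combination h6
    exact mul_ne_zero hr (mul_ne_zero hq hr) this
  have hp : p ≠ 0 := by
    rcases key hpq hrp with h | h | h | h
    · exact h
    · exact absurd h hqr
    · exact absurd h1 h
    · exact absurd h2 h
  have hq : q ≠ 0 := by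
    rcases key (p := q) (q := r) (r := p) hqr hpq with h | h | h | h
    · exact h
    · exact absurd h hrp
    · exact absurd (by linear_combination h2) h
    · exact absurd (by linear_combination h3) h
  have hr : r ≠ 0 := by
    rcases key (p := r) (q := p) (r := q) hrp hqr with h | h | h | h
    · exact h
    · exact absurd h hpq
    · exact absurd (by linear_combination h3) h
    · exact absurd (by linear_combination h1) h
  set Y := t * (p * q + q * r + r * p)
  -- Multiplying the three equations shows that `pqr` times the product equals its own negative.
  have hprod : (q * r + Y) * (r * p + Y) * (p * q + Y) = 0 := by
    have : p * q * r * ((q * r + Y) * (r * p + Y) * (p * q + Y)) = 0 := by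
      have e1 : q * (p * q + Y) = - (r * (r * p + Y)) := by linarith
      have e2 : r * (q * r + Y) = - (p * (p * q + Y)) := by linarith
      have e3 : p * (r * p + Y) = - (q * (q * r + Y)) := by linarith
      have : q * (p * q + Y) * (r * (q * r + Y)) * (p * (r * p + Y))
        = - (r * (r * p + Y)) * - (p * (p * q + Y)) * - (q * (q * r + Y)) := by rw [e1, e2, e3]
      linarith
    exact (mul_eq_zero.1 this).resolve_left (mul_ne_zero (mul_ne_zero hp hq) hr)
  have hall : q * r + Y = 0 ∧ r * p + Y = 0 ∧ p * q + Y = 0 := by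
    have step : ∀ {u v A B : ℝ}, u ≠ 0 → u * A + v * B = 0 → B = 0 → A = 0 := by
      intro u v A B hu h hB
      rw [hB, mul_zero, add_zero] at h
      exact (mul_eq_zero.1 h).resolve_left hu
    rcases mul_eq_zero.1 hprod with h | h
    · rcases mul_eq_zero.1 h with h | h
      · exact ⟨h, step hp ((add_comm _ _).trans h3) h, step hp h2 h⟩
      · exact ⟨step hq h3 h, h, step hq ((add_comm _ _).trans h1) h⟩
    · exact ⟨step hr ((add_comm _ _).trans h2) h, step hr h1 h, h⟩
  obtain ⟨a1, a2, a3⟩ := hall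
  constructor
  · exact mul_left_cancel₀ hr (by linarith)
  · exact mul_left_cancel₀ hp (by linarith)

variable {t p q r u v w : ℝ}

/-- Without central components, Milnor's variables `(q + r - p) / 2` and its cyclic analogues
diagonalise the Ricci tensor into pairwise products. Their pairwise sums are the original constants,
which are non-zero. -/
theorem eq_of_centralGrad_of_centre_eq_zero (hp : p ≠ 0) (hq : q ≠ 0) (hr : r ≠ 0)
    (h1 : centralGrad t p q r 0 0 0 = 0) (h2 : centralGrad t q r p 0 0 0 = 0)
    (h3 : centralGrad t r p q 0 0 0 = 0) : p = q ∧ q = r := by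
  have := eq_of_pairwise_cubic (p := (q + r - p) / 2) (q := (r + p - q) / 2)
    (r := (p + q - r) / 2) (t := t) (by intro h; apply hr; linarith)
    (by intro h; apply hp; linarith) (by intro h; apply hq; linarith)
    (by unfold centralGrad at *; linear_combination (h2 + h3) / 16)
    (by unfold centralGrad at *; linear_combination (h3 + h1) / 16)
    (by unfold centralGrad at *; linear_combination (h1 + h2) / 16)
  constructor <;> linarith [this.1, this.2]

/-- All gradients contain `t` only through `t` times the scalar curvature, and since `u ≠ 0` the
equation in `u` expresses that product. Substituting it leaves polynomial equations free of `t`. -/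
theorem eq_of_centralGrad_of_single (hp : p ≠ 0) (hq : q ≠ 0) (hu : u ≠ 0)
    (hX : centralGradCentre t p q r u 0 0 = 0)
    (h1 : centralGrad t p q r u 0 0 = 0) (h2 : centralGrad t q r p 0 0 u = 0)
    (h3 : centralGrad t r p q 0 u 0 = 0) : q = r ∧ u ^ 2 = p * (q - p) := by
  have hν := (mul_eq_zero.1 hX).resolve_left hu
  simp only [centralGrad] at h1 h2 h3
  have e1 : (q + r) * (2 * p ^ 2 - p * (q + r) - (q - r) ^ 2 + 2 * u ^ 2) = 0 := by
    linear_combination h1 / 2 + (q + r - p) / 2 * hν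
  have e2 : (q - r) * ((q - r) ^ 2 + (q + r) ^ 2 - 3 * p ^ 2 - 3 * u ^ 2) = 0 := by
    linear_combination (h2 - h3) / 4 - (q - r) / 2 * hν
  have e3 : 2 * p ^ 3 - p ^ 2 * (q + r) + (q - r) ^ 2 * (q + r - p) + 2 * p * u ^ 2 = 0 := by
    linear_combination (h2 + h3) / 4 + p / 2 * hν
  have hu2 : 0 < u ^ 2 := by positivity
  have hp2 : 0 < p ^ 2 := by positivity
  have hqr : q = r := by
    by_contra hne
    have hne' : q - r ≠ 0 := sub_ne_zero.2 hne
    have f2 := (mul_eq_zero.1 e2).resolve_left hne'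
    -- With `q ≠ r`, either `p (p² + u²) = 0`, or the equations force `2 (q + r) = 3p` and then `(q
    -- - r)² = 0`.
    by_cases hs : q + r = 0
    · rw [hs] at e3 f2
      have : p * (p ^ 2 + u ^ 2) = 0 := by linear_combination -e3 - p * f2
      rcases mul_eq_zero.1 this with h | h
      · exact hp h
      · linarith
    · have f1 := (mul_eq_zero.1 e1).resolve_left hs
      have f3 : (q + r) ^ 2 * (2 * (q + r) - 3 * p) = 0 := by
        linear_combination e3 + (3 * (q + r) - p) * f1 + 2 * (q + r) * f2
      have f4 := (mul_eq_zero.1 f3).resolve_left (pow_ne_zero 2 hs)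
      have : (q - r) ^ 2 = 0 := by
        linear_combination - 3 * f1 - 2 * f2 + (q + r) * f4
      exact hne' (pow_eq_zero_iff two_ne_zero |>.1 this)
  subst hqr
  refine ⟨rfl, ?_⟩
  have : 4 * q * (u ^ 2 - p * (q - p)) = 0 := by linear_combination e1
  have := (mul_eq_zero.1 this).resolve_left (mul_ne_zero four_ne_zero hq)
  linarith

/-- After eliminating `t`, two equations linear in `m = u² + v²` remain. Their compatibility is a
cubic in `k = r / p`, while `m > 0` confines `k` to the complement of `(-2/3, 5/3)`, where the cubic
has no root. -/
theorem centralGrad_ne_zero_of_two_of_eq (hp : p ≠ 0) (hu : u ≠ 0)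
    (hX : centralGradCentre t p p r u v 0 = 0)
    (h1 : centralGrad t p p r u v 0 = 0) (h2 : centralGrad t p r p v 0 u = 0)
    (h3 : centralGrad t r p p 0 u v = 0) : False := by
  have hν := (mul_eq_zero.1 hX).resolve_left hu
  simp only [centralGrad] at h1 h2 h3
  have e1 : 2 * r * (p ^ 2 - r ^ 2) + (u ^ 2 + v ^ 2) * (p + 5 * r) = 0 := by
    linear_combination (h1 + h2) / 2 + r * hν
  have e2 : (r - p) ^ 2 * (3 * r + 2 * p) + (u ^ 2 + v ^ 2) * (5 * p - 3 * r) = 0 := by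
    linear_combination h3 / 2 + (2 * p - r) / 2 * hν
  have hm : 0 < u ^ 2 + v ^ 2 := by positivity
  set m := u ^ 2 + v ^ 2
  obtain ⟨k, rfl⟩ : ∃ k, r = k * p := ⟨r / p, by field_simp⟩
  have hk : k - 1 ≠ 0 := by
    intro h
    have hk1 : k = 1 := by linarith
    rw [hk1] at e1
    have : 6 * m * p = 0 := by linear_combination e1
    exact hp ((mul_eq_zero.1 this).resolve_left (by positivity))
  -- The resultant of `e1` and `e2` in `m`, with the factor `p⁴ (k - 1)` removed.
  have hcub : 9 * k ^ 3 + 2 * k ^ 2 - k - 2 = 0 := by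
    have : p ^ 4 * (k - 1) * (9 * k ^ 3 + 2 * k ^ 2 - k - 2) = 0 := by
      linear_combination (-(5 * p - 3 * (k * p))) * e1 + (p + 5 * (k * p)) * e2
    exact (mul_eq_zero.1 this).resolve_left (mul_ne_zero (pow_ne_zero 4 hp) hk)
  -- By `e2`, `(k - 1)² p² (3k + 2) = m (3k - 5)`, and `m` is positive.
  have hsign : 0 ≤ (3 * k + 2) * (3 * k - 5) := by
    have : 0 ≤ (p ^ 2 * (k - 1)) ^ 2 * ((3 * k + 2) * (3 * k - 5)) := by
      have : (p ^ 2 * (k - 1)) ^ 2 * ((3 * k + 2) * (3 * k - 5)) = m * (p * (3 * k - 5)) ^ 2 := by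
        linear_combination p * (3 * k - 5) * e2
      rw [this]; positivity
    exact nonneg_of_mul_nonneg_right this (by positivity)
  by_cases h5 : 5 ≤ 3 * k
  · nlinarith [mul_nonneg (sub_nonneg.2 h5) (sub_nonneg.2 h5)]
  · have : 3 * k + 2 ≤ 0 := by nlinarith
    nlinarith [mul_nonneg (neg_nonneg.2 this) (neg_nonneg.2 this)]

/-- The difference of the two central equations is free of `t` and factors. In the second branch `r
= 3 (p + q) / 2`, and the difference of the gradients in `p` and `q` is `p - q` times a positive
quantity. -/
theorem centralGrad_ne_zero_of_two (hp : p ≠ 0) (hr : r ≠ 0) (hu : u ≠ 0)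
    (hv : v ≠ 0) (hX : centralGradCentre t p q r u v 0 = 0)
    (hY : centralGradCentre t q r p v 0 u = 0)
    (h1 : centralGrad t p q r u v 0 = 0) (h2 : centralGrad t q r p v 0 u = 0)
    (h3 : centralGrad t r p q 0 u v = 0) : False := by
  have hν := (mul_eq_zero.1 hX).resolve_left hu
  have hν' := (mul_eq_zero.1 hY).resolve_left hv
  have : (p - q) * (3 * (p + q) - 2 * r) = 0 := by linear_combination (hν - hν') / 2
  rcases mul_eq_zero.1 this with h | h
  · obtain rfl : p = q := by linarith
    exact centralGrad_ne_zero_of_two_of_eq hp hu hX h1 h2 h3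
  · by_cases hpq : p = q
    · subst hpq
      exact centralGrad_ne_zero_of_two_of_eq hp hu hX h1 h2 h3
    · simp only [centralGrad] at h1 h2
      obtain rfl : r = 3 * (p + q) / 2 := by linarith
      have : (p - q) * (3 * (p + q) ^ 2 + (p - q) ^ 2 + 7 * (u ^ 2 + v ^ 2)) = 0 := by
        linear_combination h2 - h1 + 2 * (p - q) * hν
      have := (mul_eq_zero.1 this).resolve_left (sub_ne_zero.2 hpq)
      have : 0 < 3 * (p + q) ^ 2 + (p - q) ^ 2 + 7 * (u ^ 2 + v ^ 2) := by positivity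
      linarith

/-- Here `p = -3r`, and eliminating `t` leaves `r` times a positive quantity. -/
theorem centralGrad_ne_zero_of_three_of_eq (hr : r ≠ 0) (hu : u ≠ 0)
    (hX : centralGradCentre t p p r u v w = 0)
    (hpr : 3 * (p + r) = 2 * p) (h3 : centralGrad t r p p w u v = 0) : False := by
  have hν := (mul_eq_zero.1 hX).resolve_left hu
  simp only [centralGrad] at h3
  obtain rfl : p = - 3 * r := by linarith
  have : r * (96 * r ^ 2 + 36 * u ^ 2 + 36 * v ^ 2 + 24 * w ^ 2) = 0 := by
    linear_combination -h3 + 7 * r * hν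
  have := (mul_eq_zero.1 this).resolve_left hr
  have : 0 < 96 * r ^ 2 + 36 * u ^ 2 + 36 * v ^ 2 + 24 * w ^ 2 := by positivity
  linarith

/-- Pairwise differences of the central equations factor as before. They leave `p = q = r`, excluded
by positivity, or two equal constants and a third that is `-1/3` of them. -/
theorem centralGrad_ne_zero_of_three (hp : p ≠ 0) (hq : q ≠ 0) (hr : r ≠ 0) (hu : u ≠ 0)
    (hv : v ≠ 0) (hw : w ≠ 0) (hX : centralGradCentre t p q r u v w = 0)
    (hY : centralGradCentre t q r p v w u = 0) (hZ : centralGradCentre t r p q w u v = 0)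
    (h1 : centralGrad t p q r u v w = 0) (h2 : centralGrad t q r p v w u = 0)
    (h3 : centralGrad t r p q w u v = 0) : False := by
  have k1 := (mul_eq_zero.1 hX).resolve_left hu
  have k2 := (mul_eq_zero.1 hY).resolve_left hv
  have k3 := (mul_eq_zero.1 hZ).resolve_left hw
  have a1 : (p - q) * (3 * (p + q) - 2 * r) = 0 := by linear_combination (k1 - k2) / 2
  have a2 : (q - r) * (3 * (q + r) - 2 * p) = 0 := by linear_combination (k2 - k3) / 2
  have a3 : (r - p) * (3 * (r + p) - 2 * q) = 0 := by linear_combination (k3 - k1) / 2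
  by_cases hpq : p = q
  · subst hpq
    rcases mul_eq_zero.1 a2 with h | h
    · obtain rfl : p = r := by linarith
      simp only [centralGrad] at h1
      have : 4 * p * (u ^ 2 + (u ^ 2 + v ^ 2 + w ^ 2)) = 0 := by linear_combination h1 + p * k1
      have := (mul_eq_zero.1 this).resolve_left (mul_ne_zero four_ne_zero hp)
      have : 0 < u ^ 2 + (u ^ 2 + v ^ 2 + w ^ 2) := by positivity
      linarith
    · exact centralGrad_ne_zero_of_three_of_eq hr hu hX (by linarith) h3
  · have b1 := (mul_eq_zero.1 a1).resolve_left (sub_ne_zero.2 hpq)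
    rcases mul_eq_zero.1 a2 with h | h
    · obtain rfl : q = r := by linarith
      exact centralGrad_ne_zero_of_three_of_eq hp hv hY (by linarith) h1
    · rcases mul_eq_zero.1 a3 with h' | h'
      · obtain rfl : r = p := by linarith
        exact centralGrad_ne_zero_of_three_of_eq hq hw hZ (by linarith) h2
      · exact hpq (by linarith)

/-- The structure constants allowed by the Euler-Lagrange equation, up to a cyclic permutation:
at most one bracket of frame fields has a component `u` along the centre, and
`q = r`, `u ^ 2 = p * (q - p)`. -/
def IsCriticalCentral (p q r u v w : ℝ) : Prop := v = 0 ∧ w = 0 ∧ q = r ∧ u ^ 2 = p * (q - p)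

variable {a b c x y z : ℝ}

/-- The components with `ζ` kill the derivatives in `x, y, z`; the last diagonal component then
kills the energy, and pairs of the other diagonal components isolate the derivatives in `a, b, c`.
The cases are split by which of `x, y, z` vanish. -/
theorem isCriticalCentral_of_algEL (ha : a ≠ 0) (hb : b ≠ 0) (hc : c ≠ 0)
    (h : ∀ i j, algEL (centralStruct a b c x y z) t i j = 0) :
    IsCriticalCentral a b c x y z ∨ IsCriticalCentral b c a y z x ∨
      IsCriticalCentral c a b z x y := by
  have X1 := h 0 3
  have X2 := h 1 3
  have X3 := h 2 3
  rw [algEL_centralStruct_zero_three] at X1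
  rw [algEL_centralStruct_one_three] at X2
  rw [algEL_centralStruct_two_three] at X3
  replace X1 : centralGradCentre t a b c x y z = 0 := by simpa [ha] using X1
  replace X2 : centralGradCentre t b c a y z x = 0 := by simpa [hb] using X2
  replace X3 : centralGradCentre t c a b z x y = 0 := by simpa [hc] using X3
  have F := h 3 3
  have D1 := h 0 0
  have D2 := h 1 1
  have D3 := h 2 2
  rw [algEL_centralStruct_three_three, X1, X2, X3] at F
  rw [algEL_centralStruct_zero_zero, X2, X3] at D1
  rw [algEL_centralStruct_one_one, X1, X3] at D2
  rw [algEL_centralStruct_two_two, X1, X2] at D3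
  replace F : centralEnergy t a b c x y z = 0 := by linarith
  rw [F] at D1 D2 D3
  have E1 : a * centralGrad t a b c x y z = 0 := by linear_combination -2 * (D2 + D3)
  have E2 : b * centralGrad t b c a y z x = 0 := by linear_combination -2 * (D3 + D1)
  have E3 : c * centralGrad t c a b z x y = 0 := by linear_combination -2 * (D1 + D2)
  replace E1 := (mul_eq_zero.1 E1).resolve_left ha
  replace E2 := (mul_eq_zero.1 E2).resolve_left hb
  replace E3 := (mul_eq_zero.1 E3).resolve_left hc
  by_cases hx : x = 0 <;> by_cases hy : y = 0 <;> by_cases hz : z = 0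
  · subst hx hy hz
    obtain ⟨rfl, rfl⟩ := eq_of_centralGrad_of_centre_eq_zero ha hb hc E1 E2 E3
    exact Or.inl ⟨rfl, rfl, rfl, by ring⟩
  · subst hx hy
    exact Or.inr (Or.inr ⟨rfl, rfl, eq_of_centralGrad_of_single hc ha hz X3 E3 E1 E2⟩)
  · subst hx hz
    exact Or.inr (Or.inl ⟨rfl, rfl, eq_of_centralGrad_of_single hb hc hy X2 E2 E3 E1⟩)
  · subst hx
    exact (centralGrad_ne_zero_of_two hb ha hy hz X2 X3 E2 E3 E1).elim
  · subst hy hz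
    exact Or.inl ⟨rfl, rfl, eq_of_centralGrad_of_single ha hb hx X1 E1 E2 E3⟩
  · subst hy
    exact (centralGrad_ne_zero_of_two hc hb hz hx X3 X1 E3 E1 E2).elim
  · subst hz
    exact (centralGrad_ne_zero_of_two ha hc hx hy X1 X2 E1 E2 E3).elim
  · exact (centralGrad_ne_zero_of_three ha hb hc hx hy hz X1 X2 X3 E1 E2 E3).elim

end CentralClassification

/-! ### Simultaneous diagonalisation of the metric and the invariant form -/

section SimultaneousDiagonalization

/-- A positive definite form and a symmetric form have a common orthogonal basis, which may be taken
orthonormal for the first one. -/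
theorem exists_basis_orthonormal_orthogonal {V : Type*} [AddCommGroup V] [Module ℝ V]
    [FiniteDimensional ℝ V] {n : ℕ} (hn : Module.finrank ℝ V = n) (B β : V →ₗ[ℝ] V →ₗ[ℝ] ℝ)
    (hB : ∀ v w, B v w = B w v) (hpos : ∀ v, v ≠ 0 → 0 < B v v) (hβ : ∀ v w, β v w = β w v) :
    ∃ e : Module.Basis (Fin n) ℝ V, (∀ i j, B (e i) (e j) = if i = j then 1 else 0) ∧
      ∀ i j, i ≠ j → β (e i) (e j) = 0 := by
  let core : InnerProductSpace.Core ℝ V :=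
    { inner := fun v w => B v w
      conj_inner_symm := fun v w => hB w v
      re_inner_nonneg := fun v => by
        by_cases h : v = 0
        · simp [h]
        · exact (hpos v h).le
      add_left := fun u v w => by simp
      smul_left := fun u v r => by simp
      definite := fun v h => by
        by_contra hv
        exact (hpos v hv).ne' h }
  let _ : NormedAddCommGroup V := core.toNormedAddCommGroup
  let _ : InnerProductSpace ℝ V := InnerProductSpace.ofCore core.toCore
  have hinner : ∀ v w : V, inner ℝ v w = B v w := fun _ _ => rfl
  let b := stdOrthonormalBasis ℝ V
  -- The operator representing `β` with respect to `B`; an orthonormal eigenbasis of it is the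
  -- required basis.
  let T : V →ₗ[ℝ] V := ∑ i, (β (b i)).smulRight (b i)
  have hT : ∀ v w, inner ℝ (T v) w = β v w := fun v w => by
    have h1 := b.sum_repr w
    conv_rhs => rw [← h1]
    simp only [T, LinearMap.sum_apply, LinearMap.smulRight_apply, sum_inner, inner_smul_left,
      map_sum, map_smul, smul_eq_mul, b.repr_apply_apply]
    refine Finset.sum_congr rfl fun i _ => ?_
    rw [hβ v]
    simp [mul_comm]
  have hsymm : T.IsSymmetric := fun v w => by
    rw [hT, ← real_inner_comm, hT, hβ]
  let e := hsymm.eigenvectorBasis hn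
  refine ⟨e.toBasis, fun i j => ?_, fun i j hij => ?_⟩
  · rw [OrthonormalBasis.coe_toBasis]
    exact orthonormal_iff_ite.1 e.orthonormal i j
  · rw [OrthonormalBasis.coe_toBasis, ← hT, hsymm.apply_eigenvectorBasis, inner_smul_left,
      e.orthonormal.2 hij, mul_zero]

/-- The bracket of `𝔰𝔲(2)` (for `η = 1`) and of `𝔰𝔩(2, ℝ)` (for `η = -1`) in a standard basis. -/
def twistedCross (η : ℝ) (v w : Fin 3 → ℝ) : Fin 3 → ℝ :=
  ![η * (v 1 * w 2 - v 2 * w 1), v 2 * w 0 - v 0 * w 2, v 0 * w 1 - v 1 * w 0]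

/-- The invariant form of `twistedCross η`. -/
def twistedDot (η : ℝ) : (Fin 3 → ℝ) →ₗ[ℝ] (Fin 3 → ℝ) →ₗ[ℝ] ℝ :=
  LinearMap.mk₂ ℝ (fun v w => η * v 0 * w 0 + v 1 * w 1 + v 2 * w 2)
    (fun _ _ _ => by simp; ring) (fun _ _ _ => by simp; ring) (fun _ _ _ => by simp; ring)
    (fun _ _ _ => by simp; ring)

theorem twistedDot_apply (η : ℝ) (v w : Fin 3 → ℝ) :
    twistedDot η v w = η * v 0 * w 0 + v 1 * w 1 + v 2 * w 2 := rfl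

/-- By invariance of the form, the product of `e i` and `e j` is orthogonal to both. The form is
nondegenerate, so no `e l` is null and only the `e k` component remains; it is non-zero because `e
i` and `e j` are independent. -/
theorem exists_twistedCross_eq_smul {η : ℝ} (hη : η ^ 2 = 1) (e : Module.Basis (Fin 3) ℝ (Fin 3 → ℝ))
    (he : ∀ i j, i ≠ j → twistedDot η (e i) (e j) = 0) {i j k : Fin 3} (hij : i ≠ j) (hjk : j ≠ k)
    (hki : k ≠ i) : ∃ l : ℝ, l ≠ 0 ∧ twistedCross η (e i) (e j) = l • e k := by
  have huniv : (Finset.univ : Finset (Fin 3)) = {i, j, k} := by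
    revert i j k; decide
  have hsum : ∀ v : Fin 3 → ℝ, v = e.repr v i • e i + (e.repr v j • e j + e.repr v k • e k) := by
    intro v
    conv_lhs => rw [← e.sum_repr v]
    rw [huniv, Finset.sum_insert (by simp [hij, hki.symm]), Finset.sum_insert (by simp [hjk]),
      Finset.sum_singleton]
  have hself : ∀ l, twistedDot η (e l) (e l) ≠ 0 := by
    intro l hl
    have h0 : ∀ w, twistedDot η (e l) w = 0 := by
      intro w
      rw [← e.sum_repr w, map_sum]
      refine Finset.sum_eq_zero fun m _ => ?_
      rw [map_smul]
      by_cases hm : m = l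
      · rw [hm, hl, smul_zero]
      · rw [he l m (Ne.symm hm), smul_zero]
    apply e.ne_zero l
    have a0 := h0 ![1, 0, 0]
    have a1 := h0 ![0, 1, 0]
    have a2 := h0 ![0, 0, 1]
    simp only [twistedDot_apply] at a0 a1 a2
    simp at a0 a1 a2
    have hη0 : η ≠ 0 := by rintro rfl; simp at hη
    ext m
    fin_cases m
    · simpa [hη0] using a0
    · simpa using a1
    · simpa using a2
  have hN1 : twistedDot η (twistedCross η (e i) (e j)) (e i) = 0 := by
    simp only [twistedDot_apply, twistedCross]
    simp
    linear_combination (e i 0 * (e i 1 * e j 2 - e i 2 * e j 1)) * hη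
  have hN2 : twistedDot η (twistedCross η (e i) (e j)) (e j) = 0 := by
    simp only [twistedDot_apply, twistedCross]
    simp
    linear_combination (e j 0 * (e i 1 * e j 2 - e i 2 * e j 1)) * hη
  have hN := hsum (twistedCross η (e i) (e j))
  rw [hN] at hN1 hN2
  simp only [map_add, map_smul, LinearMap.add_apply, LinearMap.smul_apply, smul_eq_mul,
    he j i hij.symm, he k i hki, he i j hij, he k j hjk.symm, mul_zero, add_zero, zero_add] at hN1 hN2
  have c1 := (mul_eq_zero.1 hN1).resolve_right (hself i)
  have c2 := (mul_eq_zero.1 hN2).resolve_right (hself j)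
  rw [c1, c2, zero_smul, zero_smul, zero_add, zero_add] at hN
  refine ⟨_, ?_, hN⟩
  intro hl
  rw [hl, zero_smul] at hN
  have hli : LinearIndependent ℝ ![e i, e j] := by
    have := e.linearIndependent.comp ![i, j] (by
      intro a b
      fin_cases a <;> fin_cases b <;> simp [hij, hij.symm])
    convert this using 1
    ext a
    fin_cases a <;> rfl
  refine crossProduct_ne_zero_iff_linearIndependent.2 hli ?_
  have hη0 : η ≠ 0 := by rintro rfl; simp at hη
  have b0 := congrFun hN 0
  have b1 := congrFun hN 1
  have b2 := congrFun hN 2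
  simp [twistedCross, hη0] at b0 b1 b2
  rw [cross_apply]
  ext m
  fin_cases m
  · simpa using b0
  · simpa using b1
  · simpa using b2

end SimultaneousDiagonalization

/-! ### Two normal forms of the metric Lie algebra -/

section TwistedLieAlgebra

variable {L : Type*} [LieRing L] [LieAlgebra ℝ L] {η : ℝ} {Φ : L ≃ₗ[ℝ] (Fin 3 → ℝ) × ℝ}
  {B : L →ₗ[ℝ] L →ₗ[ℝ] ℝ}

/-- `Φ` is an isomorphism of Lie algebras onto `𝔰𝔲(2) × ℝ` or `𝔰𝔩(2, ℝ) × ℝ`. -/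
def IsTwistedIso (η : ℝ) (Φ : L ≃ₗ[ℝ] (Fin 3 → ℝ) × ℝ) : Prop :=
  ∀ v w, Φ ⁅v, w⁆ = (twistedCross η (Φ v).1 (Φ w).1, 0)

theorem IsTwistedIso.lie_symm (hΦ : IsTwistedIso η Φ) (v w : Fin 3 → ℝ) (a b : ℝ) :
    ⁅Φ.symm (v, a), Φ.symm (w, b)⁆ = Φ.symm (twistedCross η v w, 0) := by
  apply Φ.injective
  rw [hΦ]
  simp

theorem IsTwistedIso.lie_centre (hΦ : IsTwistedIso η Φ) (v : L) (a : ℝ) :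
    ⁅Φ.symm (0, a), v⁆ = 0 := by
  obtain ⟨⟨w, b⟩, rfl⟩ := Φ.symm.surjective v
  rw [hΦ.lie_symm]
  have : twistedCross η 0 w = 0 := by
    ext i
    fin_cases i <;> simp [twistedCross]
  rw [this, ← Prod.zero_eq_mk, map_zero]

theorem symm_prodMk_eq_smul (l : ℝ) (v : Fin 3 → ℝ) :
    Φ.symm (l • v, 0) = l • Φ.symm (v, 0) := by
  rw [← map_smul, Prod.smul_mk, smul_zero]

/-- The first three vectors diagonalise the inner product on the derived algebra against the
invariant form. The fourth is normal to the derived algebra, hence central up to a correction by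
derived vectors, and `k` records that correction. -/
theorem IsTwistedIso.exists_adapted (hΦ : IsTwistedIso η Φ) (hη : η ^ 2 = 1)
    (hB : ∀ v w, B v w = B w v) (hpos : ∀ v, v ≠ 0 → 0 < B v v) :
    ∃ (e : Fin 4 → L) (lam k : Fin 3 → ℝ), (∀ i j, B (e i) (e j) = if i = j then 1 else 0) ∧
      (∀ i, lam i ≠ 0) ∧ ⁅e 1, e 2⁆ = lam 0 • e 0 ∧ ⁅e 2, e 0⁆ = lam 1 • e 1 ∧
      ⁅e 0, e 1⁆ = lam 2 • e 2 ∧ ⁅e 0, e 3⁆ = (k 2 * lam 1) • e 1 - (k 1 * lam 2) • e 2 ∧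
      ⁅e 1, e 3⁆ = (k 0 * lam 2) • e 2 - (k 2 * lam 0) • e 0 ∧
      ⁅e 2, e 3⁆ = (k 1 * lam 0) • e 0 - (k 0 * lam 1) • e 1 := by
  let ι : (Fin 3 → ℝ) →ₗ[ℝ] L := Φ.symm.toLinearMap.comp (LinearMap.inl ℝ _ _)
  have hι : ∀ v, ι v = Φ.symm (v, 0) := fun _ => rfl
  have hιinj : ∀ v, ι v = 0 → v = 0 := fun v h => by
    have := Φ.symm.map_eq_zero_iff.1 h
    exact (Prod.mk_eq_zero.1 this).1
  obtain ⟨b, hb, hb'⟩ := exists_basis_orthonormal_orthogonal (V := Fin 3 → ℝ) (n := 3) (by simp)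
    (B.compl₁₂ ι ι) (twistedDot η) (fun v w => hB _ _)
    (fun v hv => hpos _ fun h => hv (hιinj v h))
    (fun v w => by simp only [twistedDot_apply]; ring)
  simp only [LinearMap.compl₁₂_apply] at hb
  obtain ⟨l0, h0, e0⟩ := exists_twistedCross_eq_smul hη b hb' (i := 1) (j := 2) (k := 0)
    (by decide) (by decide) (by decide)
  obtain ⟨l1, h1, e1⟩ := exists_twistedCross_eq_smul hη b hb' (i := 2) (j := 0) (k := 1)
    (by decide) (by decide) (by decide)
  obtain ⟨l2, h2, e2⟩ := exists_twistedCross_eq_smul hη b hb' (i := 0) (j := 1) (k := 2)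
    (by decide) (by decide) (by decide)
  have L0 : ⁅ι (b 1), ι (b 2)⁆ = l0 • ι (b 0) := by
    rw [hι, hι, hΦ.lie_symm, e0, symm_prodMk_eq_smul, hι]
  have L1 : ⁅ι (b 2), ι (b 0)⁆ = l1 • ι (b 1) := by
    rw [hι, hι, hΦ.lie_symm, e1, symm_prodMk_eq_smul, hι]
  have L2 : ⁅ι (b 0), ι (b 1)⁆ = l2 • ι (b 2) := by
    rw [hι, hι, hΦ.lie_symm, e2, symm_prodMk_eq_smul, hι]
  have L0' : ⁅ι (b 2), ι (b 1)⁆ = -(l0 • ι (b 0)) := by rw [← lie_skew, L0]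
  have L1' : ⁅ι (b 0), ι (b 2)⁆ = -(l1 • ι (b 1)) := by rw [← lie_skew, L1]
  have L2' : ⁅ι (b 1), ι (b 0)⁆ = -(l2 • ι (b 2)) := by rw [← lie_skew, L2]
  set ζ : L := Φ.symm (0, 1)
  have hζ : ∀ v : L, ⁅v, ζ⁆ = 0 := fun v => by rw [← lie_skew, hΦ.lie_centre, neg_zero]
  -- The component of the central vector normal to the derived algebra.
  set ν : L := ζ - (B ζ (ι (b 0)) • ι (b 0) + B ζ (ι (b 1)) • ι (b 1) + B ζ (ι (b 2)) • ι (b 2))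
    with hν
  have hν0 : ν ≠ 0 := by
    intro h
    have : Φ ν = 0 := by rw [h, map_zero]
    have := congrArg Prod.snd this
    simp [hν, ζ, hι] at this
  have hνB : ∀ i, B ν (ι (b i)) = 0 := by
    intro i
    fin_cases i <;> simp [hν, hb]
  have hνpos := hpos ν hν0
  set s : ℝ := (√(B ν ν))⁻¹ with hs
  have hss : s * s * B ν ν = 1 := by
    rw [hs, ← mul_inv, Real.mul_self_sqrt hνpos.le, inv_mul_cancel₀ hνpos.ne']
  have hbr : ∀ i, ⁅ι (b i), s • ν⁆ = -(s • (B ζ (ι (b 0)) • ⁅ι (b i), ι (b 0)⁆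
      + B ζ (ι (b 1)) • ⁅ι (b i), ι (b 1)⁆ + B ζ (ι (b 2)) • ⁅ι (b i), ι (b 2)⁆)) := by
    intro i
    simp only [hν, lie_smul, lie_sub, hζ, lie_add, zero_sub, smul_neg]
  refine ⟨![ι (b 0), ι (b 1), ι (b 2), s • ν], ![l0, l1, l2], fun i => s * B ζ (ι (b i)), ?_, ?_,
    L0, L1, L2, ?_, ?_, ?_⟩
  · have hνB' : ∀ i, B (ι (b i)) ν = 0 := fun i => by rw [hB, hνB]
    intro i j
    fin_cases i <;> fin_cases j <;> simp [hb, hνB, hνB']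
    rw [← mul_assoc, hss]
  · intro i
    fin_cases i <;> assumption
  · refine (hbr 0).trans ?_
    rw [lie_self, L2, L1']
    simp only [Matrix.cons_val]
    module
  · refine (hbr 1).trans ?_
    rw [lie_self, L2', L0]
    simp only [Matrix.cons_val]
    module
  · refine (hbr 2).trans ?_
    rw [lie_self, L1, L0']
    simp only [Matrix.cons_val]
    module

/-- The complementary choice: `ζ` is a unit central vector, and the derived algebra is projected
onto its orthogonal complement before diagonalising. Brackets do not see the projection of their
arguments, only that of their value, which contributes the components `x, y, z` along `ζ`. -/
theorem IsTwistedIso.exists_central (hΦ : IsTwistedIso η Φ) (hη : η ^ 2 = 1)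
    (hB : ∀ v w, B v w = B w v) (hpos : ∀ v, v ≠ 0 → 0 < B v v) :
    ∃ (f : Fin 4 → L) (a b c x y z : ℝ), a ≠ 0 ∧ b ≠ 0 ∧ c ≠ 0 ∧
      (∀ i j, B (f i) (f j) = if i = j then 1 else 0) ∧
      (∀ i j, ⁅f i, f j⁆ = ∑ k, centralStruct a b c x y z i j k • f k) ∧
      ∀ v, ∃ r : Fin 4 → ℝ, v = ∑ i, r i • f i := by
  set ζ₀ : L := Φ.symm (0, 1) with hζ₀
  have hζ₀0 : ζ₀ ≠ 0 := by
    intro h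
    have : Φ ζ₀ = 0 := by rw [h, map_zero]
    simp [hζ₀] at this
  have hζpos := hpos ζ₀ hζ₀0
  set s : ℝ := (√(B ζ₀ ζ₀))⁻¹ with hs
  have hs0 : s ≠ 0 := inv_ne_zero (Real.sqrt_ne_zero'.2 hζpos)
  obtain ⟨ζ, hζdef⟩ : ∃ ζ, ζ = s • ζ₀ := ⟨_, rfl⟩
  have hζζ : B ζ ζ = 1 := by
    have : B ζ ζ = s * s * B ζ₀ ζ₀ := by simp [hζdef, mul_assoc]
    rw [this, hs, ← mul_inv, Real.mul_self_sqrt hζpos.le, inv_mul_cancel₀ hζpos.ne']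
  have hζ : ∀ v : L, ⁅v, ζ⁆ = 0 := fun v => by
    rw [hζdef, lie_smul, ← lie_skew, hΦ.lie_centre, neg_zero, smul_zero]
  have hζ' : ∀ v : L, ⁅ζ, v⁆ = 0 := fun v => by rw [← lie_skew, hζ, neg_zero]
  let ι : (Fin 3 → ℝ) →ₗ[ℝ] L := Φ.symm.toLinearMap.comp (LinearMap.inl ℝ _ _)
  have hι : ∀ v, ι v = Φ.symm (v, 0) := fun _ => rfl
  -- Orthogonal projection along `ζ`; it is injective on the derived algebra, so the pulled-back
  -- form is positive definite.
  let pr : (Fin 3 → ℝ) →ₗ[ℝ] L := ι - ((B ζ).comp ι).smulRight ζ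
  have hpr : ∀ v, pr v = ι v - B ζ (ι v) • ζ := fun v => by simp [pr]
  have hprinj : ∀ v, pr v = 0 → v = 0 := fun v h => by
    have : Φ (pr v) = 0 := by rw [h, map_zero]
    have := congrArg Prod.fst this
    simpa [hpr, hζdef, hζ₀, hι] using this
  have hprζ : ∀ v, B (pr v) ζ = 0 := fun v => by
    rw [hpr, map_sub, map_smul, LinearMap.sub_apply, LinearMap.smul_apply, hζζ, hB]
    simp
  obtain ⟨b, hb, hb'⟩ := exists_basis_orthonormal_orthogonal (V := Fin 3 → ℝ) (n := 3) (by simp)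
    (B.compl₁₂ pr pr) (twistedDot η) (fun v w => hB _ _)
    (fun v hv => hpos _ fun h => hv (hprinj v h))
    (fun v w => by simp only [twistedDot_apply]; ring)
  simp only [LinearMap.compl₁₂_apply] at hb
  obtain ⟨l0, h0, e0⟩ := exists_twistedCross_eq_smul hη b hb' (i := 1) (j := 2) (k := 0)
    (by decide) (by decide) (by decide)
  obtain ⟨l1, h1, e1⟩ := exists_twistedCross_eq_smul hη b hb' (i := 2) (j := 0) (k := 1)
    (by decide) (by decide) (by decide)
  obtain ⟨l2, h2, e2⟩ := exists_twistedCross_eq_smul hη b hb' (i := 0) (j := 1) (k := 2)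
    (by decide) (by decide) (by decide)
  have hbr : ∀ {v w u : Fin 3 → ℝ} {l : ℝ}, twistedCross η v w = l • u →
      ⁅pr v, pr w⁆ = l • pr u + (l * B ζ (ι u)) • ζ := by
    intro v w u l h
    simp only [hpr, lie_sub, sub_lie, lie_smul, smul_lie, hζ, hζ', smul_zero, sub_zero]
    rw [hι, hι, hΦ.lie_symm, h, symm_prodMk_eq_smul, hι]
    module
  have L0 := hbr e0
  have L1 := hbr e1
  have L2 := hbr e2
  have L0' : ⁅pr (b 2), pr (b 1)⁆ = _ := (lie_skew _ _).symm.trans (congrArg Neg.neg L0)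
  have L1' : ⁅pr (b 0), pr (b 2)⁆ = _ := (lie_skew _ _).symm.trans (congrArg Neg.neg L1)
  have L2' : ⁅pr (b 1), pr (b 0)⁆ = _ := (lie_skew _ _).symm.trans (congrArg Neg.neg L2)
  refine ⟨![pr (b 0), pr (b 1), pr (b 2), ζ], l0, l1, l2, l0 * B ζ (ι (b 0)), l1 * B ζ (ι (b 1)),
    l2 * B ζ (ι (b 2)), h0, h1, h2, ?_, ?_, ?_⟩
  · have hprζ' : ∀ v, B ζ (pr v) = 0 := fun v => by rw [hB, hprζ]
    intro i j
    fin_cases i <;> fin_cases j <;> simp [hb, hprζ, hprζ', hζζ]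
  · intro i j
    simp only [Fin.sum_univ_four]
    fin_cases i <;> fin_cases j <;>
      simp [centralStruct, hζ, hζ', L0, L1, L2, L0', L1', L2'] <;> module
  · intro v
    have hv : v = ι (Φ v).1 + ((Φ v).2 / s) • ζ := by
      apply Φ.injective
      simp [hι, hζdef, hζ₀, hs0]
    have h1 : ι (Φ v).1 = pr (Φ v).1 + B ζ (ι (Φ v).1) • ζ := by rw [hpr]; abel
    have h2 : pr (Φ v).1 = ∑ i, b.repr (Φ v).1 i • pr (b i) := by
      conv_lhs => rw [← b.sum_repr (Φ v).1]
      simp only [map_sum, map_smul]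
    refine ⟨![b.repr (Φ v).1 0, b.repr (Φ v).1 1, b.repr (Φ v).1 2,
      B ζ (ι (Φ v).1) + (Φ v).2 / s], ?_⟩
    rw [Fin.sum_univ_three] at h2
    rw [Fin.sum_univ_four]
    conv_lhs => rw [hv, h1, h2]
    simp only [Matrix.cons_val]
    module

end TwistedLieAlgebra

/-! ### The skewness condition in the two normal forms -/

section SkewOnDerived

variable {L : Type*} [LieRing L] [LieAlgebra ℝ L] {B : L →ₗ[ℝ] L →ₗ[ℝ] ℝ}

/-- The operators `ad X` are skew on commutators. -/
def IsSkewOnDerived (B : L →ₗ[ℝ] L →ₗ[ℝ] ℝ) : Prop := ∀ X v w : L, B ⁅X, ⁅v, w⁆⁆ ⁅v, w⁆ = 0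

theorem lie_sum_smul {n : ℕ} {f : Fin n → L} {c : Fin n → Fin n → Fin n → ℝ}
    (hc : ∀ i j, ⁅f i, f j⁆ = ∑ k, c i j k • f k) (r s : Fin n → ℝ) :
    ⁅∑ i, r i • f i, ∑ j, s j • f j⁆ = ∑ k, (∑ i, ∑ j, r i * s j * c i j k) • f k := by
  simp only [sum_lie, lie_sum, smul_lie, lie_smul, hc, Finset.smul_sum,
    Finset.sum_smul, smul_smul]
  calc _ = ∑ j, ∑ k, ∑ i, (s j * (r i * c i j k)) • f k := by
        refine Finset.sum_congr rfl fun i _ => ?_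
        rw [Finset.sum_comm]
    _ = _ := by
        rw [Finset.sum_comm]
        refine Finset.sum_congr rfl fun k _ => ?_
        rw [Finset.sum_comm]
        refine Finset.sum_congr rfl fun i _ => Finset.sum_congr rfl fun j _ => ?_
        congr 1
        ring

theorem bilin_sum_smul {n : ℕ} {f : Fin n → L}
    (hf : ∀ i j, B (f i) (f j) = if i = j then 1 else 0) (r s : Fin n → ℝ) :
    B (∑ i, r i • f i) (∑ j, s j • f j) = ∑ i, r i * s i := by
  simp only [map_sum, LinearMap.sum_apply, map_smul, LinearMap.smul_apply, hf, smul_eq_mul,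
    mul_ite, mul_one, mul_zero]
  simp [mul_comm]

/-- Up to cyclic order, commutators are spanned by `p f₀ + uζ`, `q f₁`, `q f₂`. The relation `p² +
u² = pq` is exactly what makes the inner product on them invariant. -/
theorem isSkewOnDerived_of_isCriticalCentral {f : Fin 4 → L} {a b c x y z : ℝ}
    (hf : ∀ i j, B (f i) (f j) = if i = j then 1 else 0)
    (hc : ∀ i j, ⁅f i, f j⁆ = ∑ k, centralStruct a b c x y z i j k • f k)
    (hspan : ∀ v, ∃ r : Fin 4 → ℝ, v = ∑ i, r i • f i)
    (h : IsCriticalCentral a b c x y z ∨ IsCriticalCentral b c a y z x ∨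
      IsCriticalCentral c a b z x y) : IsSkewOnDerived B := by
  intro X v w
  obtain ⟨r, rfl⟩ := hspan X
  obtain ⟨s, rfl⟩ := hspan v
  obtain ⟨u, rfl⟩ := hspan w
  rw [lie_sum_smul hc, lie_sum_smul hc, bilin_sum_smul hf]
  -- The cross product of the coordinates of the two arguments, which determines their commutator.
  obtain ⟨p, hp⟩ : ∃ p, p = s 1 * u 2 - s 2 * u 1 := ⟨_, rfl⟩
  obtain ⟨q, hq⟩ : ∃ q, q = s 2 * u 0 - s 0 * u 2 := ⟨_, rfl⟩
  obtain ⟨m, hm⟩ : ∃ m, m = s 0 * u 1 - s 1 * u 0 := ⟨_, rfl⟩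
  have key : (fun k => ∑ i, ∑ j, s i * u j * centralStruct a b c x y z i j k)
      = ![a * p, b * q, c * m, x * p + y * q + z * m] := by
    funext k
    simp only [Fin.sum_univ_four]
    fin_cases k <;> simp [centralStruct, hp, hq, hm] <;> ring
  have key' : ∀ k, ∑ i, ∑ j, s i * u j * centralStruct a b c x y z i j k
      = ![a * p, b * q, c * m, x * p + y * q + z * m] k := congrFun key
  simp only [key']
  simp only [Fin.sum_univ_four]
  simp [centralStruct]
  rcases h with ⟨rfl, rfl, rfl, h⟩ | ⟨rfl, rfl, rfl, h⟩ | ⟨rfl, rfl, rfl, h⟩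
  · linear_combination (r 1 * b * m - r 2 * b * q) * p * h
  · linear_combination (r 2 * c * p - r 0 * c * m) * q * h
  · linear_combination (r 0 * a * q - r 1 * a * p) * m * h

/-- Skewness of `ad e₂` tested on `e₀ + e₁` gives `l₁ - l₀ = 0`. -/
theorem IsSkewOnDerived.eq_of_lie (h : IsSkewOnDerived B) {e₀ e₁ e₂ : L} {l₀ l₁ : ℝ}
    (h0 : l₀ ≠ 0) (h1 : l₁ ≠ 0) (b12 : ⁅e₁, e₂⁆ = l₀ • e₀) (b20 : ⁅e₂, e₀⁆ = l₁ • e₁)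
    (n0 : B e₀ e₀ = 1) (n1 : B e₁ e₁ = 1) (n01 : B e₀ e₁ = 0) (n10 : B e₁ e₀ = 0) : l₀ = l₁ := by
  have b21 : ⁅e₂, e₁⁆ = -(l₀ • e₀) := by rw [← lie_skew, b12]
  -- Exhibits `e₀ + e₁` as a commutator, as the skewness condition requires.
  have e : ⁅e₂, l₁⁻¹ • e₀ - l₀⁻¹ • e₁⁆ = e₁ + e₀ := by
    rw [lie_sub, lie_smul, lie_smul, b20, b21, smul_neg, smul_smul, smul_smul,
      inv_mul_cancel₀ h0, inv_mul_cancel₀ h1]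
    simp
  have := h e₂ e₂ (l₁⁻¹ • e₀ - l₀⁻¹ • e₁)
  rw [e, lie_add, b20, b21] at this
  simp [n0, n1, n01, n10] at this
  linarith

/-- For equal coefficients every `ad X` acts on the span of `e 0, e 1, e 2`, which contains all
commutators, as a cross product with a fixed vector. -/
theorem isSkewOnDerived_of_adapted {e : Fin 4 → L} {l : ℝ} {k : Fin 3 → ℝ}
    (he : ∀ i j, B (e i) (e j) = if i = j then 1 else 0)
    (hspan : ∀ v, ∃ r : Fin 4 → ℝ, v = ∑ i, r i • e i)
    (h12 : ⁅e 1, e 2⁆ = l • e 0) (h20 : ⁅e 2, e 0⁆ = l • e 1) (h01 : ⁅e 0, e 1⁆ = l • e 2)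
    (h03 : ⁅e 0, e 3⁆ = (k 2 * l) • e 1 - (k 1 * l) • e 2)
    (h13 : ⁅e 1, e 3⁆ = (k 0 * l) • e 2 - (k 2 * l) • e 0)
    (h23 : ⁅e 2, e 3⁆ = (k 1 * l) • e 0 - (k 0 * l) • e 1) : IsSkewOnDerived B := by
  have h21 : ⁅e 2, e 1⁆ = -(l • e 0) := by rw [← lie_skew, h12]
  have h02 : ⁅e 0, e 2⁆ = -(l • e 1) := by rw [← lie_skew, h20]
  have h10 : ⁅e 1, e 0⁆ = -(l • e 2) := by rw [← lie_skew, h01]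
  have h30 : ⁅e 3, e 0⁆ = -((k 2 * l) • e 1 - (k 1 * l) • e 2) := by rw [← lie_skew, h03]
  have h31 : ⁅e 3, e 1⁆ = -((k 0 * l) • e 2 - (k 2 * l) • e 0) := by rw [← lie_skew, h13]
  have h32 : ⁅e 3, e 2⁆ = -((k 1 * l) • e 0 - (k 0 * l) • e 1) := by rw [← lie_skew, h23]
  let c : Fin 4 → Fin 4 → Fin 4 → ℝ :=
    ![![![0, 0, 0, 0], ![0, 0, l, 0], ![0, -l, 0, 0], ![0, k 2 * l, -(k 1 * l), 0]],
      ![![0, 0, -l, 0], ![0, 0, 0, 0], ![l, 0, 0, 0], ![-(k 2 * l), 0, k 0 * l, 0]],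
      ![![0, l, 0, 0], ![-l, 0, 0, 0], ![0, 0, 0, 0], ![k 1 * l, -(k 0 * l), 0, 0]],
      ![![0, -(k 2 * l), k 1 * l, 0], ![k 2 * l, 0, -(k 0 * l), 0], ![-(k 1 * l), k 0 * l, 0, 0],
        ![0, 0, 0, 0]]]
  have hc : ∀ i j, ⁅e i, e j⁆ = ∑ k, c i j k • e k := by
    intro i j
    simp only [Fin.sum_univ_four]
    fin_cases i <;> fin_cases j <;>
      simp [c, h12, h20, h01, h21, h02, h10, h03, h13, h23, h30, h31, h32] <;> abel
  have hderived : ∀ v w : L, ∃ p : Fin 4 → ℝ, p 3 = 0 ∧ ⁅v, w⁆ = ∑ i, p i • e i := by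
    intro v w
    obtain ⟨s, rfl⟩ := hspan v
    obtain ⟨u, rfl⟩ := hspan w
    refine ⟨_, ?_, lie_sum_smul hc s u⟩
    simp only [Fin.sum_univ_four]
    simp [c]
  intro X v w
  obtain ⟨p, hp3, hp⟩ := hderived v w
  obtain ⟨r, rfl⟩ := hspan X
  rw [hp, lie_sum_smul hc, bilin_sum_smul he]
  simp only [Fin.sum_univ_four]
  simp [c, hp3]
  ring

end SkewOnDerived

/-! ### Differentials of homomorphisms from `G` -/

section GroupHoms

variable {G : Type*} [TopologicalSpace G] [ChartedSpace (EuclideanSpace ℝ (Fin 4)) G] [Group G]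
  [LieGroup (𝓡 4) ∞ G] {F : Type*} [NormedAddCommGroup F] [NormedSpace ℝ F]
  {A : Type*} [NormedRing A] [NormedAlgebra ℝ A]

theorem tanDeriv_mulInvariantVectorField {f : G → F} (hf : ContMDiff (𝓡 4) 𝓘(ℝ, F) ∞ f) (x : G)
    (v : GroupLieAlgebra (𝓡 4) G) :
    tanDeriv f x (mulInvariantVectorField v x) = tanDeriv (fun y => f (x * y)) (1 : G) v := by
  have h1 : ∀ y : G, y = x → ∀ a : EuclideanSpace ℝ (Fin 4),
      (mfderiv (𝓡 4) 𝓘(ℝ, F) f x : EuclideanSpace ℝ (Fin 4) →L[ℝ] F) a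
      = (mfderiv (𝓡 4) 𝓘(ℝ, F) f y : EuclideanSpace ℝ (Fin 4) →L[ℝ] F) a := by
    rintro y rfl a; rfl
  have h2 := mfderiv_comp (I := 𝓡 4) (I' := 𝓡 4) (I'' := 𝓘(ℝ, F)) (g := f)
    (f := fun y => x * y) (1 : G) (hf.mdifferentiableAt (by simp))
    ((contMDiff_mul_left (I := 𝓡 4) (n := ∞) (a := x)).mdifferentiableAt (by simp))
  refine (h1 (x * 1) (mul_one x) _).trans ?_
  exact (congrArg (fun L : EuclideanSpace ℝ (Fin 4) →L[ℝ] F => L v) h2).symm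

/-- Differentiate `ψ (x * y) = ψ x * ψ y` in `y` at the identity. -/
theorem tanDeriv_mulInvariantVectorField_of_mul {ψ : G → A}
    (hψ : ContMDiff (𝓡 4) 𝓘(ℝ, A) ∞ ψ) (hmul : ∀ x y, ψ (x * y) = ψ x * ψ y) (x : G)
    (v : GroupLieAlgebra (𝓡 4) G) :
    tanDeriv ψ x (mulInvariantVectorField v x) = ψ x * tanDeriv ψ (1 : G) v := by
  rw [tanDeriv_mulInvariantVectorField hψ]
  simp only [hmul]
  exact tanDeriv_clm (ContinuousLinearMap.mul ℝ A (ψ x)) (hψ.mdifferentiableAt (by simp)) v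

theorem tanDeriv_mulInvariantVectorField_of_add {χ : G → F}
    (hχ : ContMDiff (𝓡 4) 𝓘(ℝ, F) ∞ χ) (hadd : ∀ x y, χ (x * y) = χ x + χ y) (x : G)
    (v : GroupLieAlgebra (𝓡 4) G) :
    tanDeriv χ x (mulInvariantVectorField v x) = tanDeriv χ (1 : G) v := by
  rw [tanDeriv_mulInvariantVectorField hχ]
  simp only [hadd]
  exact (((HasTanDeriv.const (χ x)).add
    ⟨hχ.mdifferentiableAt (by simp), rfl⟩).congr_deriv (zero_add _)).eq

theorem mdifferentiableAt_mulInvariantVectorField' (v : GroupLieAlgebra (𝓡 4) G) (x : G) :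
    MDifferentiableAt (𝓡 4) (𝓡 4).tangent
      (fun x => (⟨x, mulInvariantVectorField v x⟩ : TangentBundle (𝓡 4) G)) x :=
  (contMDiff_infty_mulInvariantVectorField v).mdifferentiableAt (by simp)

theorem tanDeriv_lie {f : G → F} (hf : ContMDiff (𝓡 4) 𝓘(ℝ, F) ∞ f)
    (v w : GroupLieAlgebra (𝓡 4) G) {d d' : F}
    (hv : HasTanDeriv (fun x => tanDeriv f x (mulInvariantVectorField w x)) 1 v d)
    (hw : HasTanDeriv (fun x => tanDeriv f x (mulInvariantVectorField v x)) 1 w d') :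
    tanDeriv f (1 : G) ⁅v, w⁆ = d - d' := by
  have e1 : ∀ u : GroupLieAlgebra (𝓡 4) G, mulInvariantVectorField u (1 : G) = u := fun u => by
    have h : (fun y : G => 1 * y) = id := by funext y; exact one_mul y
    have h1 : ∀ f : G → G, f = id → ∀ a : EuclideanSpace ℝ (Fin 4),
        (mfderiv (𝓡 4) (𝓡 4) f 1 : EuclideanSpace ℝ (Fin 4) →L[ℝ] EuclideanSpace ℝ (Fin 4)) a
        = a := by
      rintro f rfl a
      rw [mfderiv_id]; rfl
    exact h1 _ h u
  have := tanDeriv_mlieBracket (hf.contMDiffAt.of_le (by norm_cast))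
    (mdifferentiableAt_mulInvariantVectorField' v 1)
    (mdifferentiableAt_mulInvariantVectorField' w 1) hw.diff hv.diff
  rw [GroupLieAlgebra.bracket_def, this, e1, e1, hv.eq, hw.eq]

theorem tanDeriv_lie_of_mul {ψ : G → A} (hψ : ContMDiff (𝓡 4) 𝓘(ℝ, A) ∞ ψ)
    (hmul : ∀ x y, ψ (x * y) = ψ x * ψ y) (v w : GroupLieAlgebra (𝓡 4) G) :
    tanDeriv ψ (1 : G) ⁅v, w⁆ = tanDeriv ψ (1 : G) v * tanDeriv ψ (1 : G) w
      - tanDeriv ψ (1 : G) w * tanDeriv ψ (1 : G) v := by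
  have h : ∀ v w : GroupLieAlgebra (𝓡 4) G, HasTanDeriv
      (fun x => tanDeriv ψ x (mulInvariantVectorField w x)) 1 v
      (tanDeriv ψ (1 : G) v * tanDeriv ψ (1 : G) w) := fun v w => by
    simp only [tanDeriv_mulInvariantVectorField_of_mul hψ hmul]
    exact HasTanDeriv.clm ((ContinuousLinearMap.mul ℝ A).flip _)
      ⟨hψ.mdifferentiableAt (by simp), rfl⟩
  exact tanDeriv_lie hψ v w (h v w) (h w v)

theorem tanDeriv_lie_of_add {χ : G → F} (hχ : ContMDiff (𝓡 4) 𝓘(ℝ, F) ∞ χ)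
    (hadd : ∀ x y, χ (x * y) = χ x + χ y) (v w : GroupLieAlgebra (𝓡 4) G) :
    tanDeriv χ (1 : G) ⁅v, w⁆ = 0 := by
  have h : ∀ v w : GroupLieAlgebra (𝓡 4) G, HasTanDeriv
      (fun x => tanDeriv χ x (mulInvariantVectorField w x)) 1 v 0 := fun v w => by
    simp only [tanDeriv_mulInvariantVectorField_of_add hχ hadd]
    exact HasTanDeriv.const _
  rw [tanDeriv_lie hχ v w (h v w) (h w v), sub_zero]

/-- An injective linear map between four-dimensional spaces is an isomorphism. -/
theorem exists_isTwistedIso_of {η : ℝ} {Ψ : GroupLieAlgebra (𝓡 4) G →ₗ[ℝ] (Fin 3 → ℝ)}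
    {χ : GroupLieAlgebra (𝓡 4) G →ₗ[ℝ] ℝ}
    (hinj : ∀ v, Ψ v = 0 → χ v = 0 → v = 0)
    (hΨ : ∀ v w : GroupLieAlgebra (𝓡 4) G, Ψ ⁅v, w⁆ = twistedCross η (Ψ v) (Ψ w)) (hχ : ∀ v w : GroupLieAlgebra (𝓡 4) G, χ ⁅v, w⁆ = 0) :
    ∃ Φ : GroupLieAlgebra (𝓡 4) G ≃ₗ[ℝ] (Fin 3 → ℝ) × ℝ,
      IsTwistedIso η Φ ∧ ∀ v, Φ v = (Ψ v, χ v) := by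
  have h1 : Function.Injective (Ψ.prod χ) := by
    rw [← LinearMap.ker_eq_bot, LinearMap.ker_eq_bot']
    intro v hv
    exact hinj v (congrArg Prod.fst hv) (congrArg Prod.snd hv)
  have h2 : Module.finrank ℝ (GroupLieAlgebra (𝓡 4) G)
      = Module.finrank ℝ ((Fin 3 → ℝ) × ℝ) := by
    rw [finrank_tangentSpace]
    simp
  refine ⟨LinearEquiv.ofInjectiveOfFinrankEq _ h1 h2, fun v w => ?_, fun v => rfl⟩
  exact Prod.ext (hΨ v w) (hχ v w)

end GroupHoms

/-! ### The Lie algebra of `SL̃(2, ℝ) × ℝ` -/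

section SpecialLinear

variable {G : Type*} [TopologicalSpace G] [ChartedSpace (EuclideanSpace ℝ (Fin 4)) G] [Group G]
  [LieGroup (𝓡 4) ∞ G]

/-- The matrix commutator entry by entry, which requires no norm on matrices. -/
theorem tanDeriv_lie_of_matrix_mul {n : ℕ} {m : Fin n → Fin n → G → ℝ}
    (hm : ∀ i j, ContMDiff (𝓡 4) 𝓘(ℝ, ℝ) ∞ (m i j))
    (hmul : ∀ i j x y, m i j (x * y) = ∑ k, m i k x * m k j y) (i j : Fin n)
    (v w : GroupLieAlgebra (𝓡 4) G) :
    tanDeriv (m i j) (1 : G) ⁅v, w⁆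
      = ∑ k, (tanDeriv (m i k) (1 : G) v * tanDeriv (m k j) (1 : G) w
        - tanDeriv (m i k) (1 : G) w * tanDeriv (m k j) (1 : G) v) := by
  have hd : ∀ i j (v : GroupLieAlgebra (𝓡 4) G),
      HasTanDeriv (m i j) 1 v (tanDeriv (m i j) (1 : G) v) :=
    fun i j v => ⟨(hm i j).mdifferentiableAt (by simp), rfl⟩
  have h1 : ∀ x (v : GroupLieAlgebra (𝓡 4) G), tanDeriv (m i j) x (mulInvariantVectorField v x)
      = ∑ k, m i k x * tanDeriv (m k j) (1 : G) v := fun x v => by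
    rw [tanDeriv_mulInvariantVectorField (hm i j)]
    simp only [hmul]
    exact (HasTanDeriv.sum Finset.univ fun k _ => (hd k j v).const_mul (m i k x)).eq
  have h : ∀ v w : GroupLieAlgebra (𝓡 4) G, HasTanDeriv
      (fun x => tanDeriv (m i j) x (mulInvariantVectorField w x)) 1 v
      (∑ k, tanDeriv (m i k) (1 : G) v * tanDeriv (m k j) (1 : G) w) := fun v w => by
    simp only [h1]
    refine (HasTanDeriv.sum Finset.univ fun k _ =>
      (hd i k v).mul (HasTanDeriv.const (tanDeriv (m k j) (1 : G) w))).congr_deriv ?_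
    simp
  rw [tanDeriv_lie (hm i j) v w (h v w) (h w v), Finset.sum_sub_distrib]

theorem IsSL2TildeTimesR.exists_isTwistedIso (hG : IsSL2TildeTimesR G) :
    ∃ Φ : GroupLieAlgebra (𝓡 4) G ≃ₗ[ℝ] (Fin 3 → ℝ) × ℝ, IsTwistedIso (-1) Φ := by
  obtain ⟨-, φ, -, hm, hχ, hinj⟩ := hG
  let m : Fin 2 → Fin 2 → G → ℝ := fun i j x => (φ x).1.1 i j
  let χ : G → ℝ := fun x => (φ x).2.toAdd
  have hmul : ∀ i j x y, m i j (x * y) = ∑ k, m i k x * m k j y := fun i j x y => by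
    simp only [m, map_mul, Prod.fst_mul, Matrix.SpecialLinearGroup.coe_mul, Matrix.mul_apply]
  have hadd : ∀ x y, χ (x * y) = χ x + χ y := fun x y => by
    simp only [χ, map_mul, Prod.snd_mul, toAdd_mul]
  have hone : ∀ i j, m i j 1 = if i = j then 1 else 0 := fun i j => by
    simp only [m, map_one, Prod.fst_one, Matrix.SpecialLinearGroup.coe_one, Matrix.one_apply]
  have hdet : ∀ x, m 0 0 x * m 1 1 x - m 0 1 x * m 1 0 x = 1 := fun x => by
    rw [← Matrix.det_fin_two]
    exact (φ x).1.2
  let d : Fin 2 → Fin 2 → GroupLieAlgebra (𝓡 4) G →ₗ[ℝ] ℝ := fun i j => tanDeriv (m i j) (1 : G)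
  have hd : ∀ i j (v : GroupLieAlgebra (𝓡 4) G), HasTanDeriv (m i j) 1 v (d i j v) :=
    fun i j v => ⟨(hm i j).mdifferentiableAt (by simp), rfl⟩
  -- The derivative of the determinant at the identity is the trace.
  have htr : ∀ v, d 1 1 v = - d 0 0 v := fun v => by
    have h1 := (((hd 0 0 v).mul (hd 1 1 v)).sub ((hd 0 1 v).mul (hd 1 0 v))).eq
    simp only [hdet, tanDeriv_const, hone] at h1
    simp at h1
    linarith
  have hlie : ∀ i j (v w : GroupLieAlgebra (𝓡 4) G),
      d i j ⁅v, w⁆ = d i 0 v * d 0 j w - d i 0 w * d 0 j v + (d i 1 v * d 1 j w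
        - d i 1 w * d 1 j v) := fun i j v w => by
    have := tanDeriv_lie_of_matrix_mul hm hmul i j v w
    rwa [Fin.sum_univ_two] at this
  -- Coordinates on traceless matrices in which the commutator is `twistedCross (-1)`: the skew part
  -- first, then the two symmetric directions.
  let Ψ : GroupLieAlgebra (𝓡 4) G →ₗ[ℝ] (Fin 3 → ℝ) :=
    LinearMap.pi ![d 0 1 - d 1 0, (2 : ℝ) • d 0 0, -(d 0 1 + d 1 0)]
  obtain ⟨Φ, hΦ, -⟩ := exists_isTwistedIso_of (η := -1) (Ψ := Ψ) (χ := tanDeriv χ (1 : G))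
    (fun v h1 h2 => by
      have a0 := congrFun h1 0
      have a1 := congrFun h1 1
      have a2 := congrFun h1 2
      simp [Ψ] at a0 a1 a2
      refine hinj 1 v (fun i j => ?_) h2
      have h3 : d i j v = 0 := by
        have := htr v
        fin_cases i <;> fin_cases j <;> simp <;> linarith
      exact h3)
    (fun v w => by
      ext i
      fin_cases i <;> simp [Ψ, twistedCross, hlie, htr] <;> ring)
    (fun v w => tanDeriv_lie_of_add hχ hadd v w)
  exact ⟨Φ, hΦ⟩

end SpecialLinear

/-! ### `SU(2)` as unit quaternions and its Lie algebra -/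

section SpecialUnitary

open scoped Quaternion

/-- The quaternion `a + b i + c j + d k`. -/
def quaternionMk (a b c d : ℝ) : ℍ[ℝ] := ⟨a, b, c, d⟩

@[simp] theorem re_quaternionMk (a b c d : ℝ) : (quaternionMk a b c d).re = a := rfl

@[simp] theorem imI_quaternionMk (a b c d : ℝ) : (quaternionMk a b c d).imI = b := rfl

@[simp] theorem imJ_quaternionMk (a b c d : ℝ) : (quaternionMk a b c d).imJ = c := rfl

@[simp] theorem imK_quaternionMk (a b c d : ℝ) : (quaternionMk a b c d).imK = d := rfl

/-- The matrix entries of the quaternion `q`, viewed as an element of `𝔰𝔲(2) ⊕ ℝ`. -/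
def quaternionEntry (i j : Fin 2) : ℍ[ℝ] →L[ℝ] ℂ :=
  LinearMap.toContinuousLinearMap
    { toFun := fun q => !![(⟨q.re, q.imI⟩ : ℂ), ⟨q.imJ, q.imK⟩; ⟨-q.imJ, q.imK⟩, ⟨q.re, -q.imI⟩] i j
      map_add' := fun p q => by
        fin_cases i <;> fin_cases j <;> apply Complex.ext <;> simp <;> ring
      map_smul' := fun r q => by
        fin_cases i <;> fin_cases j <;> apply Complex.ext <;> simp }

theorem quaternionEntry_apply (i j : Fin 2) (q : ℍ[ℝ]) : quaternionEntry i j q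
    = !![(⟨q.re, q.imI⟩ : ℂ), ⟨q.imJ, q.imK⟩; ⟨-q.imJ, q.imK⟩, ⟨q.re, -q.imI⟩] i j := rfl

/-- The quaternion with first matrix row `(z, 0)`. -/
def quaternionOfEntryZero : ℂ →L[ℝ] ℍ[ℝ] :=
  LinearMap.toContinuousLinearMap
    { toFun := fun z => quaternionMk z.re z.im 0 0
      map_add' := fun p q => by ext <;> simp
      map_smul' := fun r q => by ext <;> simp }

theorem quaternionOfEntryZero_apply (z : ℂ) :
    quaternionOfEntryZero z = quaternionMk z.re z.im 0 0 := rfl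

/-- The quaternion with first matrix row `(0, z)`. -/
def quaternionOfEntryOne : ℂ →L[ℝ] ℍ[ℝ] :=
  LinearMap.toContinuousLinearMap
    { toFun := fun z => quaternionMk 0 0 z.re z.im
      map_add' := fun p q => by ext <;> simp
      map_smul' := fun r q => by ext <;> simp }

theorem quaternionOfEntryOne_apply (z : ℂ) :
    quaternionOfEntryOne z = quaternionMk 0 0 z.re z.im := rfl

/-- The unit quaternion of a special unitary matrix. -/
def quaternionOfMatrix (M : Matrix (Fin 2) (Fin 2) ℂ) : ℍ[ℝ] :=
  quaternionMk (M 0 0).re (M 0 0).im (M 0 1).re (M 0 1).im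

theorem quaternionOfMatrix_eq (M : Matrix (Fin 2) (Fin 2) ℂ) : quaternionOfMatrix M
    = quaternionOfEntryZero (M 0 0) + quaternionOfEntryOne (M 0 1) := by
  ext <;> simp [quaternionOfMatrix, quaternionOfEntryZero_apply, quaternionOfEntryOne_apply]

theorem adjugate_eq_star {M : Matrix (Fin 2) (Fin 2) ℂ}
    (hM : M ∈ Matrix.specialUnitaryGroup (Fin 2) ℂ) : M.adjugate = star M := by
  rw [Matrix.mem_specialUnitaryGroup_iff] at hM
  have h1 : M * M.adjugate = 1 := by rw [Matrix.mul_adjugate, hM.2, one_smul]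
  calc M.adjugate = star M * M * M.adjugate := by
        rw [(Matrix.mem_unitaryGroup_iff'.1 hM.1), one_mul]
    _ = star M := by rw [mul_assoc, h1, mul_one]

/-- The second row of a special unitary matrix is determined by the first, since the adjugate is the
conjugate transpose. -/
theorem quaternionEntry_quaternionOfMatrix {M : Matrix (Fin 2) (Fin 2) ℂ}
    (hM : M ∈ Matrix.specialUnitaryGroup (Fin 2) ℂ) (i j : Fin 2) :
    quaternionEntry i j (quaternionOfMatrix M) = M i j := by
  have h := adjugate_eq_star hM
  rw [Matrix.adjugate_fin_two] at h
  have h1 : M 1 1 = star (M 0 0) := by simpa using congrFun (congrFun h 0) 0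
  have h2 : M 1 0 = -star (M 0 1) := by
    have := congrFun (congrFun h 1) 0
    simp at this
    simp [← this]
  rw [quaternionEntry_apply]
  fin_cases i <;> fin_cases j <;> simp [quaternionOfMatrix, h1, h2] <;> apply Complex.ext <;> simp

theorem quaternionOfMatrix_mul {M N : Matrix (Fin 2) (Fin 2) ℂ}
    (hN : N ∈ Matrix.specialUnitaryGroup (Fin 2) ℂ) :
    quaternionOfMatrix (M * N) = quaternionOfMatrix M * quaternionOfMatrix N := by
  have h1 := quaternionEntry_quaternionOfMatrix hN 1 0
  have h2 := quaternionEntry_quaternionOfMatrix hN 1 1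
  rw [quaternionEntry_apply] at h1 h2
  simp [quaternionOfMatrix] at h1 h2
  simp only [quaternionOfMatrix, Matrix.mul_apply, Fin.sum_univ_two, ← h1, ← h2]
  ext <;> simp <;> ring

theorem normSq_quaternionOfMatrix {M : Matrix (Fin 2) (Fin 2) ℂ}
    (hM : M ∈ Matrix.specialUnitaryGroup (Fin 2) ℂ) :
    Quaternion.normSq (quaternionOfMatrix M) = 1 := by
  have h1 := quaternionEntry_quaternionOfMatrix hM 1 0
  have h2 := quaternionEntry_quaternionOfMatrix hM 1 1
  rw [quaternionEntry_apply] at h1 h2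
  simp [quaternionOfMatrix] at h1 h2
  have h := ((Matrix.mem_specialUnitaryGroup_iff.1 hM).2)
  rw [Matrix.det_fin_two, ← h1, ← h2] at h
  have := congrArg Complex.re h
  rw [Quaternion.normSq_def']
  simp [quaternionOfMatrix] at this ⊢
  linarith

variable {G : Type*} [TopologicalSpace G] [ChartedSpace (EuclideanSpace ℝ (Fin 4)) G] [Group G]

/-- `ψ` and `χ` are the components of a smooth immersive homomorphism to `S³ × ℝ`, with `S³` the
group of unit quaternions. -/
structure IsUnitQuaternionHom (ψ : G → ℍ[ℝ]) (χ : G → ℝ) : Prop where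
  smooth_fst : ContMDiff (𝓡 4) 𝓘(ℝ, ℍ[ℝ]) ∞ ψ
  smooth_snd : ContMDiff (𝓡 4) 𝓘(ℝ, ℝ) ∞ χ
  map_mul : ∀ x y, ψ (x * y) = ψ x * ψ y
  map_add : ∀ x y, χ (x * y) = χ x + χ y
  normSq_eq : ∀ x, Quaternion.normSq (ψ x) = 1
  injective : ∀ v : GroupLieAlgebra (𝓡 4) G, tanDeriv ψ (1 : G) v = 0 → tanDeriv χ (1 : G) v = 0 →
    v = 0

theorem IsSU2TimesR.exists_isUnitQuaternionHom (hG : IsSU2TimesR G) :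
    ∃ (ψ : G → ℍ[ℝ]) (χ : G → ℝ), IsUnitQuaternionHom ψ χ := by
  obtain ⟨φ, hm, hχ, hinj⟩ := hG
  have hψ : ContMDiff (𝓡 4) 𝓘(ℝ, ℍ[ℝ]) ∞ fun x => quaternionOfMatrix (φ x).1.1 := by
    simp only [quaternionOfMatrix_eq]
    exact (quaternionOfEntryZero.contMDiff.comp (hm 0 0)).add
      (quaternionOfEntryOne.contMDiff.comp (hm 0 1))
  refine ⟨fun x => quaternionOfMatrix (φ x).1.1, fun x => (φ x).2.toAdd, hψ, hχ,
    fun x y => ?_, fun x y => ?_, fun x => normSq_quaternionOfMatrix (φ x).1.2,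
    fun v h1 h2 => hinj 1 v (fun i j => ?_) h2⟩
  · rw [map_mul]
    exact quaternionOfMatrix_mul (φ y).1.2
  · rw [map_mul]; rfl
  · have h3 := tanDeriv_clm (quaternionEntry i j) (x := (1 : G))
      (hψ.mdifferentiableAt (by simp)) v
    rw [h1, map_zero] at h3
    simp only [fun x => quaternionEntry_quaternionOfMatrix (φ x).1.2] at h3
    exact h3

namespace IsUnitQuaternionHom

variable {ψ : G → ℍ[ℝ]} {χ : G → ℝ}

theorem map_one (h : IsUnitQuaternionHom ψ χ) : ψ 1 = 1 := by
  have h1 := h.map_mul 1 1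
  have h2 : ψ 1 ≠ 0 := by
    intro h3
    have := h.normSq_eq 1
    simp [h3] at this
  rw [mul_one] at h1
  exact (mul_eq_left₀ h2).1 h1.symm

/-- Differentiate `|ψ|² = 1` at the identity, where `ψ = 1`. -/
theorem re_tanDeriv (h : IsUnitQuaternionHom ψ χ) (v : GroupLieAlgebra (𝓡 4) G) :
    (tanDeriv ψ (1 : G) v).re = 0 := by
  have hd : HasTanDeriv ψ 1 v (tanDeriv ψ (1 : G) v) :=
    ⟨h.smooth_fst.mdifferentiableAt (by simp), rfl⟩
  have hsq : ∀ x, inner ℝ (ψ x) (ψ x) = (1 : ℝ) := fun x => by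
    rw [Quaternion.inner_self, h.normSq_eq]
  have h2 := tanDeriv_bilin (innerSL ℝ) hd.diff hd.diff v
  have h3 : (fun y => innerSL ℝ (ψ y) (ψ y)) = fun _ => (1 : ℝ) := funext hsq
  rw [h3, tanDeriv_const, h.map_one] at h2
  have h4 : ∀ d : ℍ[ℝ], (0 : ℝ) = inner ℝ d 1 + inner ℝ 1 d → d.re = 0 := fun d hd => by
    simp [Quaternion.inner_def] at hd
    linarith
  exact h4 _ h2

variable [LieGroup (𝓡 4) ∞ G]

theorem tanDeriv_lie (h : IsUnitQuaternionHom ψ χ) (v w : GroupLieAlgebra (𝓡 4) G) :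
    tanDeriv ψ (1 : G) ⁅v, w⁆ = tanDeriv ψ (1 : G) v * tanDeriv ψ (1 : G) w
      - tanDeriv ψ (1 : G) w * tanDeriv ψ (1 : G) v :=
  tanDeriv_lie_of_mul h.smooth_fst h.map_mul v w

theorem exists_isTwistedIso (h : IsUnitQuaternionHom ψ χ) :
    ∃ Φ : GroupLieAlgebra (𝓡 4) G ≃ₗ[ℝ] (Fin 3 → ℝ) × ℝ, IsTwistedIso 1 Φ ∧
      ∀ v, (Φ v).2 = tanDeriv χ (1 : G) v := by
  let d : GroupLieAlgebra (𝓡 4) G →ₗ[ℝ] ℍ[ℝ] := tanDeriv ψ (1 : G)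
  -- The commutator of imaginary quaternions is twice the cross product; doubling the coordinates
  -- absorbs the factor.
  let im : ℍ[ℝ] →ₗ[ℝ] (Fin 3 → ℝ) :=
    { toFun := fun q => ![2 * q.imI, 2 * q.imJ, 2 * q.imK]
      map_add' := fun p q => by ext i; fin_cases i <;> simp <;> ring
      map_smul' := fun r q => by ext i; fin_cases i <;> simp <;> ring }
  have him : ∀ q, im q = ![2 * q.imI, 2 * q.imJ, 2 * q.imK] := fun _ => rfl
  obtain ⟨Φ, hΦ, hΦ'⟩ := exists_isTwistedIso_of (η := 1) (Ψ := im.comp d) (χ := tanDeriv χ (1 : G))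
    (fun v h1 h2 => by
      rw [LinearMap.comp_apply, him] at h1
      have a0 := congrFun h1 0
      have a1 := congrFun h1 1
      have a2 := congrFun h1 2
      simp at a0 a1 a2
      exact h.injective v (by ext <;> simp [h.re_tanDeriv]; exacts [a0, a1, a2]) h2)
    (fun v w => by
      have h1 : d ⁅v, w⁆ = d v * d w - d w * d v := h.tanDeriv_lie v w
      have hv : (d v).re = 0 := h.re_tanDeriv v
      have hw : (d w).re = 0 := h.re_tanDeriv w
      rw [LinearMap.comp_apply, h1, LinearMap.comp_apply, LinearMap.comp_apply, him, him, him]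
      ext i
      fin_cases i <;> simp [twistedCross, hv, hw] <;> ring)
    (fun v w => tanDeriv_lie_of_add h.smooth_snd h.map_add v w)
  exact ⟨Φ, hΦ, fun v => by rw [hΦ']⟩

end IsUnitQuaternionHom

end SpecialUnitary

/-! ### Metric geometry of quaternions -/

section QuaternionGeometry

open scoped Quaternion

theorem quaternion_inner_eq (p q : ℍ[ℝ]) :
    inner ℝ p q = p.re * q.re + p.imI * q.imI + p.imJ * q.imJ + p.imK * q.imK := by
  simp [Quaternion.inner_def]

theorem quaternion_inner_mul_left {p : ℍ[ℝ]} (hp : Quaternion.normSq p = 1) (q r : ℍ[ℝ]) :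
    inner ℝ (p * q) (p * r) = inner ℝ q r := by
  rw [Quaternion.normSq_def'] at hp
  simp only [quaternion_inner_eq, Quaternion.re_mul, Quaternion.imI_mul, Quaternion.imJ_mul,
    Quaternion.imK_mul]
  linear_combination (q.re * r.re + q.imI * r.imI + q.imJ * r.imJ + q.imK * r.imK) * hp

theorem quaternion_inner_mul_right {p : ℍ[ℝ]} (hp : Quaternion.normSq p = 1) (q r : ℍ[ℝ]) :
    inner ℝ (q * p) (r * p) = inner ℝ q r := by
  rw [Quaternion.normSq_def'] at hp
  simp only [quaternion_inner_eq, Quaternion.re_mul, Quaternion.imI_mul, Quaternion.imJ_mul,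
    Quaternion.imK_mul]
  linear_combination (q.re * r.re + q.imI * r.imI + q.imJ * r.imJ + q.imK * r.imK) * hp

/-- Imaginary quaternions with the brackets of a round `𝔰𝔲(2)` are orthogonal, of equal length. -/
theorem quaternion_inner_of_commutator {b : Fin 3 → ℍ[ℝ]} {l : ℝ} (hl : l ≠ 0)
    (hre : ∀ i, (b i).re = 0) (hb : b 0 ≠ 0) (h12 : b 1 * b 2 - b 2 * b 1 = l • b 0)
    (h20 : b 2 * b 0 - b 0 * b 2 = l • b 1) (h01 : b 0 * b 1 - b 1 * b 0 = l • b 2) (i j : Fin 3) :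
    inner ℝ (b i) (b j) = if i = j then l ^ 2 / 4 else 0 := by
  have h0 := hre 0
  have h1 := hre 1
  have h2 := hre 2
  have a1 := congrArg (fun q : ℍ[ℝ] => q.imI) h12
  have a2 := congrArg (fun q : ℍ[ℝ] => q.imJ) h12
  have a3 := congrArg (fun q : ℍ[ℝ] => q.imK) h12
  have b1 := congrArg (fun q : ℍ[ℝ] => q.imI) h20
  have b2 := congrArg (fun q : ℍ[ℝ] => q.imJ) h20
  have b3 := congrArg (fun q : ℍ[ℝ] => q.imK) h20
  have c1 := congrArg (fun q : ℍ[ℝ] => q.imI) h01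
  have c2 := congrArg (fun q : ℍ[ℝ] => q.imJ) h01
  have c3 := congrArg (fun q : ℍ[ℝ] => q.imK) h01
  simp [h0, h1, h2] at a1 a2 a3 b1 b2 b3 c1 c2 c3
  have hb' : (b 0).imI ^ 2 + (b 0).imJ ^ 2 + (b 0).imK ^ 2 ≠ 0 := by
    intro h
    rw [← Quaternion.normSq_ne_zero, Quaternion.normSq_def', h0] at hb
    apply hb
    linear_combination h
  have e01 : inner ℝ (b 0) (b 1) = (0 : ℝ) := by
    rw [quaternion_inner_eq, h0]
    refine (mul_eq_zero.1 ?_).resolve_left hl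
    linear_combination -((b 1).imI * a1 + (b 1).imJ * a2 + (b 1).imK * a3)
  have e02 : inner ℝ (b 0) (b 2) = (0 : ℝ) := by
    rw [quaternion_inner_eq, h0]
    refine (mul_eq_zero.1 ?_).resolve_left hl
    linear_combination -((b 2).imI * a1 + (b 2).imJ * a2 + (b 2).imK * a3)
  have e12 : inner ℝ (b 1) (b 2) = (0 : ℝ) := by
    rw [quaternion_inner_eq, h1]
    refine (mul_eq_zero.1 ?_).resolve_left hl
    linear_combination -((b 2).imI * b1 + (b 2).imJ * b2 + (b 2).imK * b3)
  have e11 : (b 1).imI ^ 2 + (b 1).imJ ^ 2 + (b 1).imK ^ 2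
      = (b 0).imI ^ 2 + (b 0).imJ ^ 2 + (b 0).imK ^ 2 := by
    refine mul_left_cancel₀ hl ?_
    linear_combination (b 0).imI * a1 + (b 0).imJ * a2 + (b 0).imK * a3
      - ((b 1).imI * b1 + (b 1).imJ * b2 + (b 1).imK * b3)
  have e22 : (b 2).imI ^ 2 + (b 2).imJ ^ 2 + (b 2).imK ^ 2
      = (b 0).imI ^ 2 + (b 0).imJ ^ 2 + (b 0).imK ^ 2 := by
    refine mul_left_cancel₀ hl ?_
    linear_combination (b 0).imI * a1 + (b 0).imJ * a2 + (b 0).imK * a3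
      - ((b 2).imI * c1 + (b 2).imJ * c2 + (b 2).imK * c3)
  -- Lagrange's identity for `b 1 × b 2`, with the equality of lengths and the orthogonality already
  -- shown.
  have e00 : (b 0).imI ^ 2 + (b 0).imJ ^ 2 + (b 0).imK ^ 2 = l ^ 2 / 4 := by
    rw [quaternion_inner_eq, h1] at e12
    have : ((b 0).imI ^ 2 + (b 0).imJ ^ 2 + (b 0).imK ^ 2)
        * (l ^ 2 - 4 * ((b 0).imI ^ 2 + (b 0).imJ ^ 2 + (b 0).imK ^ 2)) = 0 := by
      have k1 : l ^ 2 * ((b 0).imI ^ 2 + (b 0).imJ ^ 2 + (b 0).imK ^ 2)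
          = 4 * (((b 1).imI ^ 2 + (b 1).imJ ^ 2 + (b 1).imK ^ 2)
            * ((b 2).imI ^ 2 + (b 2).imJ ^ 2 + (b 2).imK ^ 2)
            - ((b 1).imI * (b 2).imI + (b 1).imJ * (b 2).imJ + (b 1).imK * (b 2).imK) ^ 2) := by
        have : l ^ 2 * ((b 0).imI ^ 2 + (b 0).imJ ^ 2 + (b 0).imK ^ 2)
          = (l * (b 0).imI) ^ 2 + (l * (b 0).imJ) ^ 2 + (l * (b 0).imK) ^ 2 := by ring
        rw [this, ← a1, ← a2, ← a3]
        ring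
      rw [e11, e22] at k1
      have e12' : (b 1).imI * (b 2).imI + (b 1).imJ * (b 2).imJ + (b 1).imK * (b 2).imK = 0 := by
        linear_combination e12
      rw [e12'] at k1
      linear_combination k1
    have := (mul_eq_zero.1 this).resolve_left hb'
    linarith
  have e10 := (real_inner_comm (b 0) (b 1)).trans e01
  have e20 := (real_inner_comm (b 0) (b 2)).trans e02
  have e21 := (real_inner_comm (b 1) (b 2)).trans e12
  have d0 : inner ℝ (b 0) (b 0) = l ^ 2 / 4 := by
    rw [quaternion_inner_eq, h0]; linear_combination e00
  have d1 : inner ℝ (b 1) (b 1) = l ^ 2 / 4 := by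
    rw [quaternion_inner_eq, h1]; linear_combination e11 + e00
  have d2 : inner ℝ (b 2) (b 2) = l ^ 2 / 4 := by
    rw [quaternion_inner_eq, h2]; linear_combination e22 + e00
  rw [real_inner_self_eq_norm_sq] at d0 d1 d2
  fin_cases i <;> fin_cases j <;> simp [e01, e02, e12, e10, e20, e21, d0, d1, d2]

/-- The real part of a quaternion. -/
def quaternionRe : ℍ[ℝ] →L[ℝ] ℝ :=
  LinearMap.toContinuousLinearMap
    { toFun := fun q => q.re
      map_add' := fun _ _ => rfl
      map_smul' := fun _ _ => rfl }

theorem quaternionRe_apply (q : ℍ[ℝ]) : quaternionRe q = q.re := rfl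

/-- The imaginary components of a quaternion. -/
def quaternionIm (i : Fin 3) : ℍ[ℝ] →L[ℝ] ℝ :=
  LinearMap.toContinuousLinearMap
    { toFun := fun q => ![q.imI, q.imJ, q.imK] i
      map_add' := fun _ _ => by fin_cases i <;> rfl
      map_smul' := fun _ _ => by fin_cases i <;> rfl }

theorem quaternionIm_apply (i : Fin 3) (q : ℍ[ℝ]) :
    quaternionIm i q = ![q.imI, q.imJ, q.imK] i := rfl

theorem contDiff_exp_smul_quaternion (w : ℍ[ℝ]) :
    ContDiff ℝ ∞ fun u : ℝ => NormedSpace.exp (u • w) := by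
  have h : ContDiff ℝ ∞ (NormedSpace.exp : ℍ[ℝ] → ℍ[ℝ]) :=
    AnalyticOnNhd.contDiff fun x _ => NormedSpace.exp_analytic x
  exact h.comp (contDiff_id.smul contDiff_const)

theorem normSq_exp_smul_quaternion {w : ℍ[ℝ]} (hw : w.re = 0) (s : ℝ) :
    Quaternion.normSq (NormedSpace.exp (s • w)) = 1 := by
  rw [Quaternion.normSq_exp]
  simp [hw]

end QuaternionGeometry

/-! ### Stereographic projection -/

section RoundSphere

open scoped Quaternion

/-- Stereographic projection of a unit quaternion, with image in the model of the sphere of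
curvature `l² / 4`. -/
def stereo (l : ℝ) (i : Fin 3) (q : ℍ[ℝ]) : ℝ := 4 / l * (quaternionIm i q * (1 + quaternionRe q)⁻¹)

theorem one_add_sum_stereo_sq {l : ℝ} (hl : l ≠ 0) {q : ℍ[ℝ]} (hq : Quaternion.normSq q = 1)
    (h : 0 < 1 + quaternionRe q) :
    1 + l ^ 2 / 4 / 4 * ∑ i, stereo l i q ^ 2 = 2 / (1 + quaternionRe q) := by
  have h0 := h.ne'
  rw [Quaternion.normSq_def'] at hq
  simp only [stereo, Fin.sum_univ_three, quaternionIm_apply, quaternionRe_apply] at h0 ⊢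
  simp only [Matrix.cons_val]
  field_simp
  linear_combination hq

variable {M : Type*} [TopologicalSpace M] [ChartedSpace (EuclideanSpace ℝ (Fin 4)) M]

/-- Stereographic projection is conformal, and the denominator of the model metric cancels its
conformal factor. The constant `4 / l²` is the squared radius of the sphere of curvature `l² / 4`;
`hd` says that `d` is tangent to the unit sphere. -/
theorem sum_tanDeriv_stereo_sq {l : ℝ} (hl : l ≠ 0) {Q : M → ℍ[ℝ]} {x : M}
    {v : TangentSpace (𝓡 4) x} {d : ℍ[ℝ]} (hQ : HasTanDeriv Q x v d)
    (hq : Quaternion.normSq (Q x) = 1) (hd : inner ℝ (Q x) d = (0 : ℝ))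
    (h : 0 < 1 + quaternionRe (Q x)) :
    (∑ i, tanDeriv (fun y => stereo l i (Q y)) x v ^ 2)
        / (1 + l ^ 2 / 4 / 4 * ∑ i, stereo l i (Q x) ^ 2) ^ 2
      = 4 / l ^ 2 * inner ℝ d d := by
  have h0 := h.ne'
  have h1 : ∀ i, tanDeriv (fun y => stereo l i (Q y)) x v
      = 4 / l * ((quaternionIm i d * (1 + quaternionRe (Q x)) - quaternionIm i (Q x)
        * quaternionRe d) / (1 + quaternionRe (Q x)) ^ 2) := fun i => by
    refine (HasTanDeriv.const_mul (4 / l) ((hQ.clm (quaternionIm i)).mul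
      (((HasTanDeriv.const (1 : ℝ)).add (hQ.clm quaternionRe)).inv h0))).eq.trans ?_
    field_simp
    ring
  rw [one_add_sum_stereo_sq hl hq h]
  simp only [h1]
  rw [Quaternion.normSq_def'] at hq
  rw [quaternion_inner_eq] at hd
  simp only [Fin.sum_univ_three, quaternionIm_apply, quaternionRe_apply, quaternion_inner_eq]
    at h0 ⊢
  simp only [Matrix.cons_val]
  generalize (Q x).re = q0 at *
  generalize (Q x).imI = q1 at *
  generalize (Q x).imJ = q2 at *
  generalize (Q x).imK = q3 at *
  field_simp
  linear_combination 4 * d.re ^ 2 * hq - 8 * d.re * (1 + q0) * hd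

theorem contDiffOn_stereo (l : ℝ) (i : Fin 3) :
    ContDiffOn ℝ ∞ (stereo l i) {q | 0 < 1 + quaternionRe q} := by
  refine contDiffOn_const.mul ((quaternionIm i).contDiff.contDiffOn.mul (ContDiffOn.inv ?_ ?_))
  · exact (contDiff_const.add quaternionRe.contDiff).contDiffOn
  · exact fun q hq => (show 0 < 1 + quaternionRe q from hq).ne'

variable {G : Type*} [TopologicalSpace G] [ChartedSpace (EuclideanSpace ℝ (Fin 4)) G] [Group G]
  [LieGroup (𝓡 4) ∞ G] {g : SmoothMetric 4 G} {e : Fin 4 → GroupLieAlgebra (𝓡 4) G}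
  {lam k : Fin 3 → ℝ} {ψ : G → ℍ[ℝ]} {χ : G → ℝ}

/-- A homomorphism to `ℝ` kills commutators, and these three vectors are multiples of commutators.
-/
theorem IsAdaptedBasis.tanDeriv_eq_zero (he : IsAdaptedBasis g e lam k)
    (h : IsUnitQuaternionHom ψ χ) :
    tanDeriv χ (1 : G) (e 0) = 0 ∧ tanDeriv χ (1 : G) (e 1) = 0 ∧ tanDeriv χ (1 : G) (e 2) = 0 := by
  have key : ∀ {v w u : GroupLieAlgebra (𝓡 4) G} {l : ℝ}, l ≠ 0 → ⁅v, w⁆ = l • u →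
      tanDeriv χ (1 : G) u = 0 := by
    intro v w u l hl hu
    have h1 := tanDeriv_lie_of_add h.smooth_snd h.map_add v w
    rw [hu, map_smul, smul_eq_mul] at h1
    exact (mul_eq_zero.1 h1).resolve_left hl
  exact ⟨key (he.lam_ne_zero 0) he.bracket12, key (he.lam_ne_zero 1) he.bracket20,
    key (he.lam_ne_zero 2) he.bracket01⟩

end RoundSphere

/-! ### The centre in an adapted basis -/

section AdaptedCentre

variable {L : Type*} [LieRing L] [LieAlgebra ℝ L]

theorem IsTwistedIso.fst_eq_zero {η : ℝ} (hη : η ≠ 0) {Φ : L ≃ₗ[ℝ] (Fin 3 → ℝ) × ℝ}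
    (hΦ : IsTwistedIso η Φ) {u : L} (hu : ∀ v : L, ⁅u, v⁆ = 0) : (Φ u).1 = 0 := by
  have h1 : ∀ w, twistedCross η (Φ u).1 w = 0 := fun w => by
    have := congrArg Prod.fst (hΦ u (Φ.symm (w, 0)))
    rw [hu, map_zero] at this
    simpa using this.symm
  have a1 := congrFun (h1 ![0, 0, 1]) 0
  have a2 := congrFun (h1 ![1, 0, 0]) 1
  have a0 := congrFun (h1 ![0, 1, 0]) 2
  simp [twistedCross, hη] at a0 a1 a2
  ext i
  fin_cases i
  · exact a0
  · exact a1
  · exact a2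

/-- On `e 0, e 1, e 2` the vector `e 3` acts as `-∑ kᵢ eᵢ`, so their difference is central. -/
theorem lie_add_sum_eq_zero_of_adapted {e : Fin 4 → L} {lam k : Fin 3 → ℝ}
    (hspan : ∀ v, ∃ r : Fin 4 → ℝ, v = ∑ i, r i • e i)
    (h12 : ⁅e 1, e 2⁆ = lam 0 • e 0) (h20 : ⁅e 2, e 0⁆ = lam 1 • e 1)
    (h01 : ⁅e 0, e 1⁆ = lam 2 • e 2)
    (h03 : ⁅e 0, e 3⁆ = (k 2 * lam 1) • e 1 - (k 1 * lam 2) • e 2)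
    (h13 : ⁅e 1, e 3⁆ = (k 0 * lam 2) • e 2 - (k 2 * lam 0) • e 0)
    (h23 : ⁅e 2, e 3⁆ = (k 1 * lam 0) • e 0 - (k 0 * lam 1) • e 1) (v : L) :
    ⁅e 3 + (k 0 • e 0 + k 1 • e 1 + k 2 • e 2), v⁆ = 0 := by
  have h21 : ⁅e 2, e 1⁆ = -(lam 0 • e 0) := by rw [← lie_skew, h12]
  have h02 : ⁅e 0, e 2⁆ = -(lam 1 • e 1) := by rw [← lie_skew, h20]
  have h10 : ⁅e 1, e 0⁆ = -(lam 2 • e 2) := by rw [← lie_skew, h01]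
  set u := e 3 + (k 0 • e 0 + k 1 • e 1 + k 2 • e 2) with hu
  have a0 : ⁅e 0, u⁆ = 0 := by
    simp only [hu, lie_add, lie_smul, lie_self, h03, h01, h02]
    module
  have a1 : ⁅e 1, u⁆ = 0 := by
    simp only [hu, lie_add, lie_smul, lie_self, h13, h10, h12]
    module
  have a2 : ⁅e 2, u⁆ = 0 := by
    simp only [hu, lie_add, lie_smul, lie_self, h23, h20, h21]
    module
  have a3 : ⁅e 3, u⁆ = 0 := by
    have : e 3 = u - (k 0 • e 0 + k 1 • e 1 + k 2 • e 2) := by rw [hu]; abel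
    rw [this]
    simp only [sub_lie, add_lie, smul_lie, lie_self, a0, a1, a2]
    module
  obtain ⟨r, rfl⟩ := hspan v
  rw [← lie_skew, Fin.sum_univ_four]
  simp only [add_lie, smul_lie, a0, a1, a2, a3]
  simp

/-- Otherwise the central vector `e 3 + ∑ kᵢ eᵢ` would have both components zero, although its inner
product with `e 3` is `1`. -/
theorem IsTwistedIso.snd_ne_zero_of_adapted {η : ℝ} (hη : η ≠ 0) {Φ : L ≃ₗ[ℝ] (Fin 3 → ℝ) × ℝ}
    (hΦ : IsTwistedIso η Φ) {B : L →ₗ[ℝ] L →ₗ[ℝ] ℝ} {e : Fin 4 → L} {lam k : Fin 3 → ℝ}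
    (he : ∀ i j, B (e i) (e j) = if i = j then 1 else 0)
    (hspan : ∀ v, ∃ r : Fin 4 → ℝ, v = ∑ i, r i • e i)
    (h12 : ⁅e 1, e 2⁆ = lam 0 • e 0) (h20 : ⁅e 2, e 0⁆ = lam 1 • e 1)
    (h01 : ⁅e 0, e 1⁆ = lam 2 • e 2)
    (h03 : ⁅e 0, e 3⁆ = (k 2 * lam 1) • e 1 - (k 1 * lam 2) • e 2)
    (h13 : ⁅e 1, e 3⁆ = (k 0 * lam 2) • e 2 - (k 2 * lam 0) • e 0)
    (h23 : ⁅e 2, e 3⁆ = (k 1 * lam 0) • e 0 - (k 0 * lam 1) • e 1)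
    (d0 : (Φ (e 0)).2 = 0) (d1 : (Φ (e 1)).2 = 0) (d2 : (Φ (e 2)).2 = 0) : (Φ (e 3)).2 ≠ 0 := by
  intro d3
  have h4 := hΦ.fst_eq_zero hη (lie_add_sum_eq_zero_of_adapted hspan h12 h20 h01 h03 h13 h23)
  have h5 : e 3 + (k 0 • e 0 + k 1 • e 1 + k 2 • e 2) = 0 := by
    apply Φ.injective
    rw [map_zero]
    refine Prod.ext h4 ?_
    simp [d0, d1, d2, d3]
  have h6 : B (e 3 + (k 0 • e 0 + k 1 • e 1 + k 2 • e 2)) (e 3) = 1 := by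
    simp [he]
  rw [h5, map_zero] at h6
  simp at h6

end AdaptedCentre

/-! ### The differential to unit quaternions in a round adapted basis -/

section RoundChart

open scoped Quaternion

variable {G : Type*} [TopologicalSpace G] [ChartedSpace (EuclideanSpace ℝ (Fin 4)) G] [Group G]
  [LieGroup (𝓡 4) ∞ G] {g : SmoothMetric 4 G} {e : Fin 4 → GroupLieAlgebra (𝓡 4) G}
  {lam k : Fin 3 → ℝ} {ψ : G → ℍ[ℝ]} {χ : G → ℝ}

theorem eq_sum_of_orthonormal_lieAlgebra
    (he : ∀ i j, g.inner 1 (e i) (e j) = if i = j then 1 else 0) (v : GroupLieAlgebra (𝓡 4) G) :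
    ∃ r : Fin 4 → ℝ, v = ∑ i, r i • e i :=
  ⟨_, eq_sum_of_orthonormal (finrank_tangentSpace (1 : G)) (metricForm g 1)
    (fun v hv => g.pos 1 v hv) (e := e) he v⟩

theorem IsAdaptedBasis.tanDeriv_three_ne_zero (he : IsAdaptedBasis g e lam k)
    (h : IsUnitQuaternionHom ψ χ) : tanDeriv χ (1 : G) (e 3) ≠ 0 := by
  obtain ⟨d0, d1, d2⟩ := he.tanDeriv_eq_zero h
  obtain ⟨Φ, hΦ, hΦ2⟩ := h.exists_isTwistedIso
  rw [← hΦ2] at d0 d1 d2 ⊢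
  exact hΦ.snd_ne_zero_of_adapted one_ne_zero (B := metricForm g 1) he.orthonormal
    (eq_sum_of_orthonormal_lieAlgebra he.orthonormal)
    he.bracket12 he.bracket20 he.bracket01 he.bracket03 he.bracket13 he.bracket23 d0 d1 d2

theorem IsAdaptedBasis.ne_zero (he : IsAdaptedBasis g e lam k) (i : Fin 4) : e i ≠ 0 := by
  intro h
  have h1 : metricForm g 1 (e i) (e i) = 1 := (he.orthonormal i i).trans (if_pos rfl)
  rw [h, map_zero] at h1
  exact zero_ne_one h1

theorem IsAdaptedBasis.inner_tanDeriv (he : IsAdaptedBasis g e lam k)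
    (h : IsUnitQuaternionHom ψ χ) (h01 : lam 0 = lam 1) (h12 : lam 1 = lam 2) (i j : Fin 3) :
    inner ℝ (tanDeriv ψ (1 : G) (e i.castSucc)) (tanDeriv ψ (1 : G) (e j.castSucc))
      = if i = j then lam 0 ^ 2 / 4 else 0 := by
  have hbr : ∀ {v w u : GroupLieAlgebra (𝓡 4) G} {l : ℝ}, ⁅v, w⁆ = l • u →
      tanDeriv ψ (1 : G) v * tanDeriv ψ (1 : G) w - tanDeriv ψ (1 : G) w * tanDeriv ψ (1 : G) v
        = l • tanDeriv ψ (1 : G) u := fun {v w u l} huv => by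
    rw [← h.tanDeriv_lie, huv, map_smul]
  refine quaternion_inner_of_commutator (b := fun i => tanDeriv ψ (1 : G) (e i.castSucc))
    (he.lam_ne_zero 0) (fun i => h.re_tanDeriv _)
    (fun h0 => he.ne_zero 0 (h.injective _ h0 (he.tanDeriv_eq_zero h).1))
    (hbr he.bracket12) ?_ ?_ i j
  · rw [h01]; exact hbr he.bracket20
  · rw [h01, h12]; exact hbr he.bracket01

end RoundChart

/-! ### The local isometry with `ℝ × N³(λ²/4)` -/

section RoundLocalIsometry

open scoped Quaternion

variable {G : Type*} [TopologicalSpace G] [ChartedSpace (EuclideanSpace ℝ (Fin 4)) G] [Group G]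
  {ψ : G → ℍ[ℝ]} {χ : G → ℝ}

/-- The map `ψ` to the unit quaternions, translated by `a` and corrected along the second factor so
that it is constant along a direction on which `ψ` and `χ` have derivatives `w` and `c`. -/
def quaternionPart (ψ : G → ℍ[ℝ]) (χ : G → ℝ) (a w : ℍ[ℝ]) (c : ℝ) (x : G) : ℍ[ℝ] :=
  a * ψ x * NormedSpace.exp ((-(c⁻¹) * χ x) • w)

namespace IsUnitQuaternionHom

theorem contMDiff_quaternionPart (h : IsUnitQuaternionHom ψ χ) (a w : ℍ[ℝ]) (c : ℝ) :
    ContMDiff (𝓡 4) 𝓘(ℝ, ℍ[ℝ]) ∞ (quaternionPart ψ χ a w c) := by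
  have h1 : ContMDiff (𝓡 4) 𝓘(ℝ, ℝ) ∞ fun x => -(c⁻¹) * χ x :=
    (ContinuousLinearMap.mul ℝ ℝ (-(c⁻¹))).contMDiff.comp h.smooth_snd
  have h2 : ContMDiff (𝓡 4) 𝓘(ℝ, ℍ[ℝ]) ∞ fun x => NormedSpace.exp ((-(c⁻¹) * χ x) • w) :=
    (contDiff_exp_smul_quaternion w).contMDiff.comp h1
  have h3 : ContMDiff (𝓡 4) 𝓘(ℝ, ℍ[ℝ]) ∞ fun x => a * ψ x :=
    (ContinuousLinearMap.mul ℝ ℍ[ℝ] a).contMDiff.comp h.smooth_fst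
  exact (contDiff_mul (𝕜 := ℝ) (𝔸 := ℍ[ℝ])).contMDiff.comp (h3.prodMk_space h2)

theorem normSq_quaternionPart (h : IsUnitQuaternionHom ψ χ) {a w : ℍ[ℝ]}
    (ha : Quaternion.normSq a = 1) (hw : w.re = 0) (c : ℝ) (x : G) :
    Quaternion.normSq (quaternionPart ψ χ a w c x) = 1 := by
  rw [quaternionPart, MonoidWithZeroHom.map_mul, MonoidWithZeroHom.map_mul, ha, h.normSq_eq,
    normSq_exp_smul_quaternion hw]
  norm_num

variable [LieGroup (𝓡 4) ∞ G]

/-- The factors from `ψ` and from the exponential combine because `w` commutes with its own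
exponential. For `w` and `c` the derivatives along `e 3`, the middle factor vanishes on `e 3`. -/
theorem hasTanDeriv_quaternionPart (h : IsUnitQuaternionHom ψ χ) (a w : ℍ[ℝ]) (c : ℝ) (x : G)
    (v : GroupLieAlgebra (𝓡 4) G) :
    HasTanDeriv (quaternionPart ψ χ a w c) x (mulInvariantVectorField v x)
      (a * ψ x * (tanDeriv ψ (1 : G) v - (c⁻¹ * tanDeriv χ (1 : G) v) • w)
        * NormedSpace.exp ((-(c⁻¹) * χ x) • w)) := by
  have h1 : HasTanDeriv ψ x (mulInvariantVectorField v x) (ψ x * tanDeriv ψ (1 : G) v) :=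
    ⟨h.smooth_fst.mdifferentiableAt (by simp),
      tanDeriv_mulInvariantVectorField_of_mul h.smooth_fst h.map_mul x v⟩
  have h2 : HasTanDeriv χ x (mulInvariantVectorField v x) (tanDeriv χ (1 : G) v) :=
    ⟨h.smooth_snd.mdifferentiableAt (by simp),
      tanDeriv_mulInvariantVectorField_of_add h.smooth_snd h.map_add x v⟩
  have h3 := (h2.const_mul (-(c⁻¹))).comp
    (hasDerivAt_exp_smul_const' (𝕂 := ℝ) w (-(c⁻¹) * χ x)).hasFDerivAt
  refine ((h1.const_mul a).mul h3).congr_deriv ?_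
  simp
  noncomm_ring

end IsUnitQuaternionHom

variable [LieGroup (𝓡 4) ∞ G] {g : SmoothMetric 4 G} {e : Fin 4 → GroupLieAlgebra (𝓡 4) G}
  {lam k : Fin 3 → ℝ}

theorem exists_eq_mulInvariantVectorField (hg : IsLeftInvariant g)
    (he : ∀ i j, g.inner 1 (e i) (e j) = if i = j then 1 else 0) (x : G)
    (v : TangentSpace (𝓡 4) x) :
    ∃ r : Fin 4 → ℝ, v = mulInvariantVectorField (∑ i, r i • e i) x := by
  have h := (isOrthonormalFrameOn_mulInvariantVectorField hg he).eq_sum (Set.mem_univ x) v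
  let L : EuclideanSpace ℝ (Fin 4) →L[ℝ] EuclideanSpace ℝ (Fin 4) :=
    mfderiv (𝓡 4) (𝓡 4) (fun y : G => x * y) 1
  have hL : ∀ r : Fin 4 → ℝ, mulInvariantVectorField (∑ i, r i • e i) x
      = ∑ i, r i • mulInvariantVectorField (e i) x := fun r =>
    (map_sum L (fun i => r i • e i) Finset.univ).trans
      (Finset.sum_congr rfl fun i _ => map_smul L (r i) (e i))
  exact ⟨_, h.trans (hL _).symm⟩

theorem inner_sum_smul (he : ∀ i j, g.inner 1 (e i) (e j) = if i = j then 1 else 0)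
    (r : Fin 4 → ℝ) : g.inner 1 (∑ i, r i • e i) (∑ i, r i • e i) = ∑ i, r i ^ 2 := by
  have h := bilin_sum_smul (B := metricForm g 1) he r r
  simp only [← pow_two] at h
  exact h

/-- The first coordinate is `χ` normalised to have derivative `1` along `e 3`, the second the
stereographic image of the corrected quaternion map `Q`. Multiplication by unit quaternions
preserves lengths, so `dQ` multiplies the lengths of combinations of `e 0, e 1, e 2` by `|λ| / 2`,
while it kills `e 3`. -/
theorem IsAdaptedBasis.isLocallyIsometric (he : IsAdaptedBasis g e lam k)
    (hg : IsLeftInvariant g) (h : IsUnitQuaternionHom ψ χ) (h01 : lam 0 = lam 1)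
    (h12 : lam 1 = lam 2) : IsLocallyIsometricToProduct g (lam 0 ^ 2 / 4) := by
  refine IsProductChartOn.isLocallyIsometric fun x => ?_
  obtain ⟨w, hwdef⟩ : ∃ w, w = tanDeriv ψ (1 : G) (e 3) := ⟨_, rfl⟩
  obtain ⟨c, hcdef⟩ : ∃ c, c = tanDeriv χ (1 : G) (e 3) := ⟨_, rfl⟩
  have hw : w.re = 0 := hwdef ▸ h.re_tanDeriv (e 3)
  have hc : c ≠ 0 := hcdef ▸ he.tanDeriv_three_ne_zero h
  have hl := he.lam_ne_zero 0
  obtain ⟨d0, d1, d2⟩ := he.tanDeriv_eq_zero h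
  -- Translating by the conjugate of `b` makes `Q x = 1`, away from the pole `-1` of the projection.
  set b : ℍ[ℝ] := ψ x * NormedSpace.exp ((-(c⁻¹) * χ x) • w) with hb
  have hb1 : Quaternion.normSq b = 1 := by
    rw [hb, MonoidWithZeroHom.map_mul, h.normSq_eq, normSq_exp_smul_quaternion hw, mul_one]
  have ha : Quaternion.normSq (star b) = 1 := by rw [Quaternion.normSq_star, hb1]
  set Q := quaternionPart ψ χ (star b) w c with hQ
  have hQ1 : ∀ y, Quaternion.normSq (Q y) = 1 := h.normSq_quaternionPart ha hw c
  have hQs := h.contMDiff_quaternionPart (star b) w c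
  have hQx : Q x = 1 := by
    rw [hQ, quaternionPart, mul_assoc, ← hb, Quaternion.star_mul_self, hb1]
    simp
  have hU : IsOpen {y | 0 < 1 + quaternionRe (Q y)} :=
    isOpen_lt continuous_const (continuous_const.add (quaternionRe.continuous.comp hQs.continuous))
  refine ⟨{y | 0 < 1 + quaternionRe (Q y)}, fun y => c⁻¹ * χ y, fun i y => stereo (lam 0) i (Q y),
    hU, ?_, ?_⟩
  · simp [hQx, quaternionRe_apply]
  refine ⟨?_, fun i => ?_, fun y hy => ?_, fun y hy v => ?_⟩
  · exact ((ContinuousLinearMap.mul ℝ ℝ c⁻¹).contMDiff.comp h.smooth_snd).contMDiffOn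
  · exact (contDiffOn_stereo (lam 0) i).contMDiffOn.comp hQs.contMDiffOn fun y hy => hy
  · rw [one_add_sum_stereo_sq hl (hQ1 y) hy]
    exact div_pos two_pos hy
  · obtain ⟨r, rfl⟩ := exists_eq_mulInvariantVectorField hg he.orthonormal y v
    have hr : tanDeriv χ (1 : G) (∑ i, r i • e i) = r 3 * c := by
      have key : ∀ T : GroupLieAlgebra (𝓡 4) G →ₗ[ℝ] ℝ, T (e 0) = 0 → T (e 1) = 0 →
          T (e 2) = 0 → T (∑ i, r i • e i) = r 3 * T (e 3) := fun T h0 h1 h2 => by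
        simp [Fin.sum_univ_four, h0, h1, h2]
      rw [hcdef]
      exact key _ d0 d1 d2
    have hβ : tanDeriv ψ (1 : G) (∑ i, r i • e i) - (c⁻¹ * (r 3 * c)) • w
        = ∑ i : Fin 3, r i.castSucc • tanDeriv ψ (1 : G) (e i.castSucc) := by
      have : c⁻¹ * (r 3 * c) = r 3 := by field_simp
      rw [this, map_sum, Fin.sum_univ_castSucc, hwdef]
      simp only [map_smul]
      exact add_sub_cancel_right _ _
    have hd := h.hasTanDeriv_quaternionPart (star b) w c y (∑ i, r i • e i)
    rw [hr, hβ] at hd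
    set β : ℍ[ℝ] := ∑ i : Fin 3, r i.castSucc • tanDeriv ψ (1 : G) (e i.castSucc) with hβdef
    have hβre : β.re = 0 := by
      have : quaternionRe β = 0 := by
        rw [hβdef, map_sum]
        refine Finset.sum_eq_zero fun i _ => ?_
        rw [map_smul, quaternionRe_apply, h.re_tanDeriv, smul_zero]
      exact this
    have hββ : inner ℝ β β = lam 0 ^ 2 / 4 * ∑ i : Fin 3, r i.castSucc ^ 2 := by
      simp only [hβdef, sum_inner, inner_sum, inner_smul_left, inner_smul_right,
        he.inner_tanDeriv h h01 h12]
      simp [Fin.sum_univ_three]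
      ring
    have ha' : Quaternion.normSq (star b * ψ y) = 1 := by
      rw [MonoidWithZeroHom.map_mul, ha, h.normSq_eq, mul_one]
    have he' := normSq_exp_smul_quaternion hw (-(c⁻¹) * χ y)
    rw [sum_tanDeriv_stereo_sq hl hd (hQ1 y) ?_ hy, quaternion_inner_mul_right he',
      quaternion_inner_mul_left ha', hββ, inner_mulInvariantVectorField hg,
      inner_sum_smul he.orthonormal, Fin.sum_univ_castSucc]
    · have hχ : tanDeriv (fun y => c⁻¹ * χ y) y (mulInvariantVectorField (∑ i, r i • e i) y)
          = r 3 := by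
        have := tanDeriv_mulInvariantVectorField_of_add h.smooth_snd h.map_add y (∑ i, r i • e i)
        have h2 := (HasTanDeriv.const_mul c⁻¹
          ⟨h.smooth_snd.mdifferentiableAt (by simp), this.trans hr⟩).eq
        rw [h2]
        field_simp
      rw [hχ]
      have : Fin.last 3 = 3 := rfl
      rw [this]
      field_simp
      ring
    · rw [quaternionPart, quaternion_inner_mul_right he']
      have := quaternion_inner_mul_left ha' 1 β
      rw [mul_one] at this
      rw [this, quaternion_inner_eq, hβre]
      simp

end RoundLocalIsometry

/-! ### Critical left-invariant metrics -/

section CriticalLeftInvariant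

theorem IsTwistedIso.not_isSkewOnDerived {L : Type*} [LieRing L] [LieAlgebra ℝ L]
    {Φ : L ≃ₗ[ℝ] (Fin 3 → ℝ) × ℝ} (hΦ : IsTwistedIso (-1) Φ) {B : L →ₗ[ℝ] L →ₗ[ℝ] ℝ}
    (hpos : ∀ v, v ≠ 0 → 0 < B v v) : ¬ IsSkewOnDerived B := by
  intro h
  -- A null vector of the invariant form which is an eigenvector of `ad` of a hyperbolic element,
  -- hence itself a commutator.
  have h1 : ⁅Φ.symm (![1, 0, 1], 0), Φ.symm (![0, 1, 0], 0)⁆ = Φ.symm (![1, 0, 1], 0) := by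
    rw [hΦ.lie_symm]
    congr 2
    ext i
    fin_cases i <;> simp [twistedCross]
  have h2 := h (Φ.symm (![0, 1, 0], 0)) (Φ.symm (![1, 0, 1], 0)) (Φ.symm (![0, 1, 0], 0))
  rw [h1, ← lie_skew, h1, map_neg, LinearMap.neg_apply, neg_eq_zero] at h2
  refine (hpos (Φ.symm (![1, 0, 1], 0)) fun h3 => ?_).ne' h2
  have h4 := congrArg Prod.fst (Φ.symm.map_eq_zero_iff.1 h3)
  have h5 := congrFun h4 0
  simp at h5

variable {G : Type*} [TopologicalSpace G] [ChartedSpace (EuclideanSpace ℝ (Fin 4)) G] [Group G]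
  [LieGroup (𝓡 4) ∞ G] {g : SmoothMetric 4 G} {e : Fin 4 → GroupLieAlgebra (𝓡 4) G}
  {lam k : Fin 3 → ℝ}

theorem metricForm_comm (x : G) (v w : TangentSpace (𝓡 4) x) :
    metricForm g x v w = metricForm g x w v := g.symm x v w

theorem metricForm_pos (x : G) (v : TangentSpace (𝓡 4) x) (hv : v ≠ 0) : 0 < metricForm g x v v :=
  g.pos x v hv

theorem IsCritical.isSkewOnDerived {t : ℝ} (ht : IsCritical g t) (hg : IsLeftInvariant g) {η : ℝ}
    (hη : η ^ 2 = 1) {Φ : GroupLieAlgebra (𝓡 4) G ≃ₗ[ℝ] (Fin 3 → ℝ) × ℝ}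
    (hΦ : IsTwistedIso η Φ) : IsSkewOnDerived (metricForm g (1 : G)) := by
  obtain ⟨f, a, b, c, x, y, z, ha, hb, hc, hf, hbr, hspan⟩ :=
    hΦ.exists_central hη (metricForm_comm (g := g) 1) (metricForm_pos 1)
  have hf' : ∀ i j, g.inner 1 (f i) (f j) = if i = j then 1 else 0 := hf
  have hframe := isOrthonormalFrameOn_mulInvariantVectorField hg hf'
  have hconst : ∀ i j k, structFn g (fun i => mulInvariantVectorField (f i)) i j k
      = fun _ => centralStruct a b c x y z i j k := fun i j k => by
    rw [structFn_mulInvariantVectorField hg]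
    funext _
    rw [← metricForm_apply, hbr]
    have : ∀ B : GroupLieAlgebra (𝓡 4) G →ₗ[ℝ] GroupLieAlgebra (𝓡 4) G →ₗ[ℝ] ℝ,
        (∀ i j, B (f i) (f j) = if i = j then 1 else 0) → ∀ r : Fin 4 → ℝ,
        B (∑ l, r l • f l) (f k) = r k := fun B hB r => by
      simp [hB]
    exact this _ hf _
  refine isSkewOnDerived_of_isCriticalCentral hf hbr hspan
    (isCriticalCentral_of_algEL (t := t) ha hb hc fun i j => ?_)
  rw [← eulerLagrange_of_const hconst t i j 1]
  exact ht Set.univ _ isOpen_univ hframe 1 (Set.mem_univ _) i j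

theorem IsAdaptedBasis.isSkewOnDerived_iff (he : IsAdaptedBasis g e lam k) :
    IsSkewOnDerived (metricForm g (1 : G)) ↔ lam 0 = lam 1 ∧ lam 1 = lam 2 := by
  have ho : ∀ i j, metricForm g 1 (e i) (e j) = if i = j then 1 else 0 := he.orthonormal
  refine ⟨fun h => ⟨?_, ?_⟩, fun ⟨h01, h12⟩ => ?_⟩
  · exact h.eq_of_lie (he.lam_ne_zero 0) (he.lam_ne_zero 1) he.bracket12 he.bracket20
      (by simp [ho]) (by simp [ho]) (by simp [ho]) (by simp [ho])
  · exact h.eq_of_lie (he.lam_ne_zero 1) (he.lam_ne_zero 2) he.bracket20 he.bracket01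
      (by simp [ho]) (by simp [ho]) (by simp [ho]) (by simp [ho])
  · have b01 := he.bracket01
    have b20 := he.bracket20
    have b03 := he.bracket03
    have b13 := he.bracket13
    have b23 := he.bracket23
    rw [← h12, ← h01] at b01 b03 b13
    rw [← h01] at b20 b23
    exact isSkewOnDerived_of_adapted ho (eq_sum_of_orthonormal_lieAlgebra he.orthonormal)
      he.bracket12 b20 b01 b03 b13 b23

theorem exists_isAdaptedBasis {η : ℝ} (hη : η ^ 2 = 1)
    {Φ : GroupLieAlgebra (𝓡 4) G ≃ₗ[ℝ] (Fin 3 → ℝ) × ℝ} (hΦ : IsTwistedIso η Φ) :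
    ∃ (e : Fin 4 → GroupLieAlgebra (𝓡 4) G) (lam k : Fin 3 → ℝ), IsAdaptedBasis g e lam k := by
  obtain ⟨e, lam, k, h1, h2, h3, h4, h5, h6, h7, h8⟩ :=
    hΦ.exists_adapted hη (metricForm_comm (g := g) 1) (metricForm_pos 1)
  exact ⟨e, lam, k, h1, h2, h3, h4, h5, h6, h7, h8⟩

end CriticalLeftInvariant

end

theorem mainTheorem4 {G : Type*} [TopologicalSpace G]
    [ChartedSpace (EuclideanSpace ℝ (Fin 4)) G] [Group G] [LieGroup (𝓡 4) ∞ G]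
    (hG : IsSL2TildeTimesR G ∨ IsSU2TimesR G)
    (g : SmoothMetric 4 G) (hg : IsLeftInvariant g) :
    ((∃ t : ℝ, IsCritical g t) ↔ ∃ κ : ℝ, IsLocallyIsometricToProduct g κ) ∧
    (∃ (e : Fin 4 → GroupLieAlgebra (𝓡 4) G) (lam k : Fin 3 → ℝ), IsAdaptedBasis g e lam k) ∧
    (∀ (e : Fin 4 → GroupLieAlgebra (𝓡 4) G) (lam k : Fin 3 → ℝ), IsAdaptedBasis g e lam k →
      (∀ t : ℝ, IsCritical g t ↔ (lam 0 = lam 1 ∧ lam 1 = lam 2) ∧ t = -1 / 3) ∧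
      (∀ κ : ℝ, IsLocallyIsometricToProduct g κ ↔
        (lam 0 = lam 1 ∧ lam 1 = lam 2) ∧ κ = lam 0 ^ 2 / 4)) ∧
    (IsSL2TildeTimesR G → ∀ t : ℝ, ¬ IsCritical g t) := by
  obtain ⟨η, Φ, hη, hΦ⟩ : ∃ (η : ℝ) (Φ : GroupLieAlgebra (𝓡 4) G ≃ₗ[ℝ] (Fin 3 → ℝ) × ℝ),
      η ^ 2 = 1 ∧ IsTwistedIso η Φ := by
    rcases hG with h | h
    · obtain ⟨Φ, hΦ⟩ := h.exists_isTwistedIso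
      exact ⟨-1, Φ, by norm_num, hΦ⟩
    · obtain ⟨ψ, χ, hψ⟩ := h.exists_isUnitQuaternionHom
      obtain ⟨Φ, hΦ, -⟩ := hψ.exists_isTwistedIso
      exact ⟨1, Φ, by norm_num, hΦ⟩
  have hSL : IsSL2TildeTimesR G → ¬ IsSkewOnDerived (metricForm g (1 : G)) := fun h => by
    obtain ⟨Φ, hΦ⟩ := h.exists_isTwistedIso
    exact hΦ.not_isSkewOnDerived (metricForm_pos 1)
  have hskew : ∀ t, IsCritical g t → IsSkewOnDerived (metricForm g (1 : G)) :=
    fun t ht => ht.isSkewOnDerived hg hη hΦ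
  have hround : ∀ (e : Fin 4 → GroupLieAlgebra (𝓡 4) G) (lam k : Fin 3 → ℝ),
      IsAdaptedBasis g e lam k → lam 0 = lam 1 ∧ lam 1 = lam 2 →
      IsLocallyIsometricToProduct g (lam 0 ^ 2 / 4) := fun e lam k he hlam => by
    -- Equal `λ` make the metric skew, which rules out `SL̃(2, ℝ) × ℝ`.
    have hSU := hG.resolve_left fun h => hSL h (he.isSkewOnDerived_iff.2 hlam)
    obtain ⟨ψ, χ, hψ⟩ := hSU.exists_isUnitQuaternionHom
    exact he.isLocallyIsometric hg hψ hlam.1 hlam.2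
  have hex := exists_isAdaptedBasis (g := g) hη hΦ
  refine ⟨⟨fun ⟨t, ht⟩ => ?_, fun ⟨κ, hκ⟩ => ⟨_, hκ.isCritical⟩⟩, hex, fun e lam k he =>
    ⟨fun t => ⟨fun ht => ?_, fun ⟨hlam, ht⟩ => ?_⟩, fun κ => ⟨fun hκ => ?_, fun ⟨hlam, hκ⟩ => ?_⟩⟩,
    fun h t ht => hSL h (hskew t ht)⟩
  · obtain ⟨e, lam, k, he⟩ := hex
    exact ⟨_, hround e lam k he (he.isSkewOnDerived_iff.1 (hskew t ht))⟩
  · have hlam := he.isSkewOnDerived_iff.1 (hskew t ht)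
    have hframe := isOrthonormalFrameOn_mulInvariantVectorField hg he.orthonormal
    have hκ0 : lam 0 ^ 2 / 4 ≠ 0 := div_ne_zero (pow_ne_zero 2 (he.lam_ne_zero 0)) four_ne_zero
    exact ⟨hlam, (hround e lam k he hlam).eq_of_isCritical hκ0 isOpen_univ hframe
      (Set.mem_univ 1) ht⟩
  · rw [ht]
    exact (hround e lam k he hlam).isCritical
  -- A local product is critical for `-1/3` whatever `κ` is, so the `λ` agree; the metric is then
  -- also a local product with curvature `λ² / 4`, and comparing scalar curvatures gives `κ`.
  · have hlam := he.isSkewOnDerived_iff.1 (hskew _ hκ.isCritical)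
    have hframe := isOrthonormalFrameOn_mulInvariantVectorField hg he.orthonormal
    have h1 := (hκ.eulerLagrange_eq isOpen_univ hframe (Set.mem_univ 1)).1
    have h2 := ((hround e lam k he hlam).eulerLagrange_eq isOpen_univ hframe (Set.mem_univ 1)).1
    exact ⟨hlam, by linarith⟩
  · rw [hκ]
    exact hround e lam k he hlam
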